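/- **Notation.** For $f:\mathbb R\to\mathbb C$ let $\hat f(\xi)=\frac1{2\pi}\int_{\mathbb R} f(y)e^{-iy\xi}\,dy$ (extended to $L^2(\mathbb R)$ by Plancherel). For $s>0$ let $H^s(\mathbb R)$ be the set of $f\in L^2(\mathbb R)$ with $\|f\|_{H^s}=\big(\int_{\mathbb R}(1+|\xi|^2)^s|\hat f(\xi)|^2\,d\xi\big)^{1/2}<\infty$. For $0<a\le 1$, $\gamma>0$ and $t>0$ let $$P^t_{a,\gamma}f(x)=e^{i(t+it^\gamma)(-\Delta)^{a/2}}f(x)=\int_{\mathbb R}\hat f(\xi)\,e^{it|\xi|^a-t^\gamma|\xi|^a}e^{ix\xi}\,d\xi ,\qquad P^*_{a,\gamma}f(x)=\sup_{0<t<1}|P^t_{a,\gamma}f(x)| .$$ For $f\in L^p(\mathbb R)$, $1\le p\le\infty$, $P^t_{a,\gamma}f$ is understood as the convolution of $f$ with the kernel $K_t(x)=\frac1{2\pi}\int_{\mathbb R} e^{it|\xi|^a-t^\gamma|\xi|^a}e^{ix\xi}\,d\xi$ (this agrees with the formula above when $f\in L^1$ or $f\in L^2$). Write $r_+=\max\{0,r\}$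 and $B(0,1)=(-1,1)$. **Theorem 1.1.** (i) *Local estimate.* Let $\gamma\in(0,\infty)$, and let either $0<a<1$ and $s>\frac a4\big(1-\frac1\gamma\big)_+$, or $a=1$ and $s>\frac12\big(1-\frac1\gamma\big)_+$. Then there is a constant $C=C(a,\gamma,s)$ such that for all $f\in H^s(\mathbb R)$ $$\|P^*_{a,\gamma}f\|_{L^2(B(0,1))}\le C\,\|f\|_{H^s(\mathbb R)} .$$ (ii) *Global estimate.* Let $\gamma\in(1,\infty)$, and let either $0<a<1$ and $s>\frac a4\big(1-\frac1\gamma\big)$, or $a=1$ and $s>\frac12\big(1-\frac1\gamma\big)$. Then there is a constant $C=C(a,\gamma,s)$ such that for all $f\in H^s(\mathbb R)$ $$\|P^*_{a,\gamma}f\|_{L^2(\mathbb R)}\le C\,\|f\|_{H^s(\mathbb R)} .$$ (iii) *$L^p$ estimate.* Let $a\in(0,1]$ and $\gamma\in(0,1]$. For every $f\in L^p(\mathbb R)$, $1\le p\le\infty$, the convolution integral defining $P^t_{a,\gamma}f(x)$ converges absolutely for all $0<t<1$ and $x\in\mathbb R$, and $P^*_{a,\gamma}f$ is measurable. For every $1<p\le\infty$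 there is a constant $C=C(a,\gamma,p)$ such that for all $f\in L^p(\mathbb R)$ $$\|P^*_{a,\gamma}f\|_{L^p(\mathbb R)}\le C\,\|f\|_{L^p(\mathbb R)} ,$$ and there is a constant $C=C(a,\gamma)$ such that for all $f\in L^1(\mathbb R)$ and $\lambda>0$ $$\big|\{x\in\mathbb R: P^*_{a,\gamma}f(x)>\lambda\}\big|\le \frac{C\,\|f\|_{L^1(\mathbb R)}}{\lambda} .$$ -/

import Mathlib

open MeasureTheory Set
open scoped ENNReal NNReal FourierTransform

namespace FracSchrodinger

noncomputable section

/-- The symbol `e^{i t |ξ|^a - t^γ |ξ|^a}` of the operator `e^{i (t + i t^γ) (-Δ)^{a/2}}`. -/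
def symbol (a γ t ξ : ℝ) : ℂ :=
  Complex.exp (((t : ℂ) * Complex.I - ((t ^ γ : ℝ) : ℂ)) * ((|ξ| ^ a : ℝ) : ℂ))

/-- The Fourier transform in angular frequency of an `L²` function, normalised so that no constant
appears in the inversion formula: on `L¹ ∩ L²` it is `f̂(ξ) = (2π)⁻¹ ∫ f(y) e^{-i y ξ} dy`.
It is obtained from Mathlib's `L²` Fourier transform `𝓕` (the Plancherel extension of
`∫ f(y) e^{-2π i y ξ} dy`) by rescaling. -/
def fhat (f : Lp ℂ 2 (volume : Measure ℝ)) (ξ : ℝ) : ℂ :=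
  ((2 * Real.pi : ℝ) : ℂ)⁻¹ * (𝓕 f : Lp ℂ 2 (volume : Measure ℝ)) (ξ / (2 * Real.pi))

/-- The Sobolev norm `‖f‖_{H^s} = (∫ (1 + ξ²)^s |f̂(ξ)|² dξ)^{1/2}`, with values in `[0, ∞]`. -/
def sobolevNorm (s : ℝ) (f : Lp ℂ 2 (volume : Measure ℝ)) : ℝ≥0∞ :=
  (∫⁻ ξ : ℝ, ENNReal.ofReal ((1 + ξ ^ 2) ^ s) * ‖fhat f ξ‖ₑ ^ 2) ^ (1 / 2 : ℝ)

/-- Membership of an `L²` function in the Sobolev space `H^s(ℝ)`. -/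
def MemSobolev (s : ℝ) (f : Lp ℂ 2 (volume : Measure ℝ)) : Prop :=
  sobolevNorm s f < ∞

/-- The operator `P^t_{a,γ}` on `L²(ℝ)`:
`P^t f(x) = ∫ f̂(ξ) e^{i t |ξ|^a - t^γ |ξ|^a} e^{i x ξ} dξ`. -/
def propagator (a γ : ℝ) (f : Lp ℂ 2 (volume : Measure ℝ)) (t x : ℝ) : ℂ :=
  ∫ ξ : ℝ, fhat f ξ * symbol a γ t ξ * Complex.exp (Complex.I * x * ξ)

/-- The convolution kernel `(2π)⁻¹ ∫ e^{i t |ξ|^a - t^γ |ξ|^a} e^{i x ξ} dξ` of `P^t_{a,γ}`. -/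
def kernel (a γ t x : ℝ) : ℂ :=
  ((2 * Real.pi : ℝ) : ℂ)⁻¹ * ∫ ξ : ℝ, symbol a γ t ξ * Complex.exp (Complex.I * x * ξ)

/-- The operator `P^t_{a,γ}` on a general function (used for `f ∈ L^p(ℝ)`, `1 ≤ p ≤ ∞`): the
convolution of `f` with the kernel of `P^t_{a,γ}`. On `L²` and on `L¹` it coincides with the
Fourier integral, see `convPropagator_eq_propagator` and `convPropagator_eq_of_integrable`. -/
def convPropagator (a γ : ℝ) (f : ℝ → ℂ) (t x : ℝ) : ℂ :=
  ∫ y : ℝ, kernel a γ t (x - y) * f y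

/-- The maximal function `sup_{0 < t < 1} |u(t, x)|`, with values in `[0, ∞]`. -/
def maximal (u : ℝ → ℝ → ℂ) (x : ℝ) : ℝ≥0∞ :=
  ⨆ t ∈ Ioo (0 : ℝ) 1, ‖u t x‖ₑ

/-! ### The integrals above converge, and the two definitions of the operator agree -/

lemma norm_symbol (a γ t ξ : ℝ) : ‖symbol a γ t ξ‖ = Real.exp (-(t ^ γ) * |ξ| ^ a) := by
  rw [symbol, Complex.norm_exp]
  congr 1
  rw [Complex.re_mul_ofReal]
  simp

lemma measurable_symbol (a γ t : ℝ) : Measurable (symbol a γ t) := by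
  unfold symbol
  fun_prop

lemma integrable_exp_neg_mul_abs_rpow {a b : ℝ} (ha : 0 < a) (hb : 0 < b) :
    Integrable (fun ξ : ℝ => Real.exp (-b * |ξ| ^ a)) := by
  have h := integrableOn_rpow_mul_exp_neg_mul_rpow (p := a) (s := 0) (by norm_num) ha hb
  simp only [Real.rpow_zero, one_mul] at h
  have h' : IntegrableOn (fun ξ : ℝ => Real.exp (-b * |ξ| ^ a)) (Ioi 0) :=
    h.congr_fun (fun ξ hξ => by simp [abs_of_pos (mem_Ioi.1 hξ)]) measurableSet_Ioi
  have h'' : IntegrableOn (fun ξ : ℝ => Real.exp (-b * |ξ| ^ a)) (Iio 0) := by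
    have := ((Measure.measurePreserving_neg (volume : Measure ℝ)).integrableOn_comp_preimage
      (MeasurableEquiv.neg ℝ).measurableEmbedding).2 h'
    simpa [Function.comp_def] using this
  rw [← integrableOn_univ, ← Iic_union_Ioi (a := (0 : ℝ))]
  exact ((integrableOn_Iic_iff_integrableOn_Iio).2 h'').union h'

lemma integrable_symbol {a γ t : ℝ} (ha : 0 < a) (ht : 0 < t) :
    Integrable (symbol a γ t) := by
  refine (integrable_exp_neg_mul_abs_rpow ha (Real.rpow_pos_of_pos ht γ)).mono'
    (measurable_symbol a γ t).aestronglyMeasurable (ae_of_all _ fun ξ => ?_)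
  rw [norm_symbol]

lemma memLp_two_symbol {a γ t : ℝ} (ha : 0 < a) (ht : 0 < t) :
    MemLp (symbol a γ t) 2 volume := by
  rw [memLp_two_iff_integrable_sq_norm (measurable_symbol a γ t).aestronglyMeasurable]
  refine (integrable_exp_neg_mul_abs_rpow ha
    (mul_pos two_pos (Real.rpow_pos_of_pos ht γ))).congr (ae_of_all _ fun ξ => ?_)
  simp only [norm_symbol, ← Real.exp_nat_mul]
  congr 1
  push_cast
  ring

lemma norm_exp_I (x ξ : ℝ) : ‖Complex.exp (Complex.I * x * ξ)‖ = 1 := by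
  have : Complex.I * (x : ℂ) * ξ = ((x * ξ : ℝ) : ℂ) * Complex.I := by push_cast; ring
  rw [this, Complex.norm_exp_ofReal_mul_I]

lemma memLp_two_fhat (f : Lp ℂ 2 (volume : Measure ℝ)) : MemLp (fhat f) 2 volume := by
  have hm : MemLp (fun ξ : ℝ => (𝓕 f : Lp ℂ 2 (volume : Measure ℝ)) (ξ / (2 * Real.pi))) 2
      volume := by
    have hp : (2 * Real.pi)⁻¹ ≠ 0 := by positivity
    have hq : Measure.QuasiMeasurePreserving (fun ξ : ℝ => ξ / (2 * Real.pi)) volume volume := by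
      simp only [div_eq_mul_inv]
      refine ⟨by fun_prop, ?_⟩
      rw [Real.map_volume_mul_right hp]
      exact Measure.smul_absolutelyContinuous
    have hg := Lp.memLp (𝓕 f : Lp ℂ 2 (volume : Measure ℝ))
    refine (memLp_two_iff_integrable_sq_norm (hg.1.comp_quasiMeasurePreserving hq)).2 ?_
    have := (memLp_two_iff_integrable_sq_norm hg.1).1 hg
    exact this.comp_div (by positivity)
  exact hm.const_mul _

/-- The integral defining `P^t f(x)` converges absolutely for every `f ∈ L²` and every `t > 0`. -/
lemma integrable_propagator {a γ t : ℝ} (ha : 0 < a) (ht : 0 < t)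
    (f : Lp ℂ 2 (volume : Measure ℝ)) (x : ℝ) :
    Integrable (fun ξ : ℝ => fhat f ξ * symbol a γ t ξ * Complex.exp (Complex.I * x * ξ)) := by
  have h : Integrable (fun ξ : ℝ => fhat f ξ * symbol a γ t ξ) :=
    (memLp_two_fhat f).integrable_mul (memLp_two_symbol ha ht)
  refine h.mul_bdd (c := 1) (by fun_prop) (ae_of_all _ fun ξ => ?_)
  rw [norm_exp_I]

/-- The maximal function of `f ∈ L²` is measurable. -/
lemma measurable_maximal_propagator {a γ : ℝ} (ha : 0 < a) (f : Lp ℂ 2 (volume : Measure ℝ)) :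
    Measurable (maximal (propagator a γ f)) := by
  refine LowerSemicontinuous.measurable (lowerSemicontinuous_iSup fun t =>
    lowerSemicontinuous_iSup fun ht => Continuous.lowerSemicontinuous (continuous_enorm.comp ?_))
  refine continuous_of_dominated (fun x => (integrable_propagator ha ht.1 f x).1)
    (fun x => ae_of_all _ fun ξ => ?_) (integrable_propagator (γ := γ) ha ht.1 f 0).norm
    (ae_of_all _ fun ξ => by fun_prop)
  simp only [norm_mul, norm_exp_I, le_refl]

/-- On `L¹` the convolution operator is the Fourier integral with
`f̂(ξ) = (2π)⁻¹ ∫ f(y) e^{-i y ξ} dy`. -/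
theorem convPropagator_eq_of_integrable {a γ t : ℝ} (ha : 0 < a) (ht : 0 < t)
    {f : ℝ → ℂ} (hf : Integrable f) (x : ℝ) :
    convPropagator a γ f t x =
      ∫ ξ : ℝ, (((2 * Real.pi : ℝ) : ℂ)⁻¹ * ∫ y : ℝ, f y * Complex.exp (-(Complex.I * y * ξ))) *
        symbol a γ t ξ * Complex.exp (Complex.I * x * ξ) := by
  have hF : Integrable (fun p : ℝ × ℝ => f p.1 * symbol a γ t p.2 *
      Complex.exp (Complex.I * ((x - p.1 : ℝ) : ℂ) * p.2)) (volume.prod volume) := by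
    refine (hf.mul_prod (integrable_symbol ha ht (γ := γ))).mul_bdd (c := 1)
      (by fun_prop) (ae_of_all _ fun p => ?_)
    rw [norm_exp_I]
  calc convPropagator a γ f t x
      = ((2 * Real.pi : ℝ) : ℂ)⁻¹ * ∫ y : ℝ, ∫ ξ : ℝ, f y * symbol a γ t ξ *
          Complex.exp (Complex.I * ((x - y : ℝ) : ℂ) * ξ) := by
        rw [convPropagator, ← integral_const_mul]
        congr 1 with y
        simp only [mul_assoc, integral_const_mul, kernel]
        ring
    _ = ((2 * Real.pi : ℝ) : ℂ)⁻¹ * ∫ ξ : ℝ, ∫ y : ℝ, f y * symbol a γ t ξ *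
          Complex.exp (Complex.I * ((x - y : ℝ) : ℂ) * ξ) := by
        rw [integral_integral_swap hF]
    _ = _ := by
        rw [← integral_const_mul]
        congr 1 with ξ
        rw [mul_assoc, mul_assoc, ← integral_mul_const]
        congr 2 with y
        have : Complex.I * ((x - y : ℝ) : ℂ) * ξ =
            -(Complex.I * y * ξ) + Complex.I * x * ξ := by push_cast; ring
        rw [this, Complex.exp_add]
        ring

/-- On `L¹ ∩ L²` the Plancherel Fourier transform is the Fourier integral. -/
lemma coeFn_fourier_toLp {h : ℝ → ℂ} (h1 : Integrable h) (h2 : MemLp h 2 volume) :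
    (𝓕 (h2.toLp h) : Lp ℂ 2 (volume : Measure ℝ)) =ᵐ[volume] 𝓕 h := by
  have hc : Continuous (𝓕 h) :=
    VectorFourier.fourierIntegral_continuous Real.continuous_fourierChar
      (L := innerₗ ℝ) continuous_inner h1
  refine ae_eq_of_integral_contDiff_smul_eq
    ((Lp.memLp _).locallyIntegrable (by norm_num)) hc.locallyIntegrable fun g hg hgc => ?_
  have hg1 : HasCompactSupport (Complex.ofRealCLM ∘ g) := hgc.comp_left rfl
  have hg2 : ContDiff ℝ ((⊤ : ℕ∞) : WithTop ℕ∞) (Complex.ofRealCLM ∘ g) := by fun_prop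
  set G : SchwartzMap ℝ ℂ := hg1.toSchwartzMap hg2 with hG
  have hGg : ∀ x, G x = (g x : ℂ) := fun x => rfl
  have key := congrArg (fun T : TemperedDistribution ℝ ℂ => T G)
    (Lp.fourier_toTemperedDistribution_eq (h2.toLp h))
  simp only [TemperedDistribution.fourier_apply, Lp.toTemperedDistribution_apply] at key
  have e1 : ∫ x, g x • (𝓕 (h2.toLp h) : Lp ℂ 2 (volume : Measure ℝ)) x
      = ∫ x, G x • (𝓕 (h2.toLp h) : Lp ℂ 2 (volume : Measure ℝ)) x := by
    congr 1
  have e2 : ∫ x, (𝓕 G) x • (h2.toLp h) x = ∫ x, (𝓕 G) x • h x :=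
    integral_congr_ae (by filter_upwards [h2.coeFn_toLp] with x hx; rw [hx])
  have e3 : ∫ x, (𝓕 G) x • h x = ∫ x, G x • (𝓕 h) x := by
    have := VectorFourier.integral_fourierIntegral_smul_eq_flip (L := innerₗ ℝ)
      Real.continuous_fourierChar (by exact continuous_inner) (G.integrable (μ := volume)) h1
    rw [flip_innerₗ] at this
    exact this
  rw [e1, ← key, e2, e3]
  congr 1

lemma integral_coeFn_fourier_mul (f : Lp ℂ 2 (volume : Measure ℝ)) {h : ℝ → ℂ}
    (h1 : Integrable h) (h2 : MemLp h 2 volume) :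
    ∫ ξ, (𝓕 f : Lp ℂ 2 (volume : Measure ℝ)) ξ * h ξ = ∫ y, f y * (𝓕 h) y := by
  have hin : ∀ u v : Lp ℂ 2 (volume : Measure ℝ),
      ∫ x, u x * v x = inner ℂ (star v) u := by
    intro u v
    rw [L2.inner_def]
    refine integral_congr_ae ?_
    filter_upwards [Lp.coeFn_star v] with x hx
    rw [hx]
    simp
  have h2F : ∫ ξ, (𝓕 f : Lp ℂ 2 (volume : Measure ℝ)) ξ * h ξ
      = ∫ ξ, (𝓕 f : Lp ℂ 2 (volume : Measure ℝ)) ξ * (h2.toLp h) ξ :=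
    integral_congr_ae (by filter_upwards [h2.coeFn_toLp] with x hx; rw [hx])
  have h3F : ∫ y, f y * (𝓕 h) y
      = ∫ y, f y * (𝓕 (h2.toLp h) : Lp ℂ 2 (volume : Measure ℝ)) y :=
    integral_congr_ae (by filter_upwards [coeFn_fourier_toLp h1 h2] with x hx; rw [hx])
  rw [h2F, h3F, hin, hin]
  refine DenseRange.induction_on (p := fun f : Lp ℂ 2 (volume : Measure ℝ) =>
      inner ℂ (star (h2.toLp h)) (𝓕 f) = inner ℂ (star (𝓕 (h2.toLp h))) f)
    (SchwartzMap.denseRange_toLpCLM (p := 2) ENNReal.ofNat_ne_top) f ?_ ?_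
  · exact isClosed_eq
      (continuous_const.inner (FourierTransform.fourierCLM ℂ (Lp ℂ 2 (volume : Measure ℝ))).continuous)
      (continuous_const.inner continuous_id)
  · intro g
    rw [← hin, ← hin]
    have key := congrArg (fun T : TemperedDistribution ℝ ℂ => T g)
      (Lp.fourier_toTemperedDistribution_eq (h2.toLp h))
    simp only [TemperedDistribution.fourier_apply, Lp.toTemperedDistribution_apply,
      smul_eq_mul] at key
    have e1 : (𝓕 (SchwartzMap.toLpCLM ℝ ℂ 2 volume g) : Lp ℂ 2 (volume : Measure ℝ))
        =ᵐ[volume] (𝓕 g : SchwartzMap ℝ ℂ) := by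
      rw [SchwartzMap.toLpCLM_apply, SchwartzMap.toLp_fourier_eq]
      exact SchwartzMap.coeFn_toLp _ _ _
    have e2 : (SchwartzMap.toLpCLM ℝ ℂ 2 volume g) =ᵐ[volume] g := SchwartzMap.coeFn_toLp _ _ _
    calc _ = ∫ x, (𝓕 g : SchwartzMap ℝ ℂ) x * (h2.toLp h) x :=
          integral_congr_ae (by filter_upwards [e1] with x hx; rw [hx])
      _ = ∫ x, g x * (𝓕 (h2.toLp h) : Lp ℂ 2 (volume : Measure ℝ)) x := key
      _ = _ := integral_congr_ae (by filter_upwards [e2] with x hx; rw [hx])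

/-- On `L²` the convolution operator is the Fourier integral defining `P^t_{a,γ}`. -/
theorem convPropagator_eq_propagator {a γ t : ℝ} (ha : 0 < a) (ht : 0 < t)
    (f : Lp ℂ 2 (volume : Measure ℝ)) (x : ℝ) :
    convPropagator a γ f t x = propagator a γ f t x := by
  have hpi : (2 * Real.pi : ℝ) ≠ 0 := by positivity
  set h₀ : ℝ → ℂ := fun ξ => symbol a γ t ξ * Complex.exp (Complex.I * x * ξ) with hh₀
  have h₀1 : Integrable h₀ := (integrable_symbol ha ht).mul_bdd (c := 1) (by fun_prop)
    (ae_of_all _ fun ξ => by rw [norm_exp_I])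
  have hm₀ : Measurable h₀ := (measurable_symbol a γ t).mul (by fun_prop)
  have h₀2 : Integrable (fun ξ => ‖h₀ ξ‖ ^ 2) := by
    refine ((memLp_two_iff_integrable_sq_norm
      (measurable_symbol a γ t).aestronglyMeasurable).1 (memLp_two_symbol ha ht)).congr
        (ae_of_all _ fun ξ => ?_)
    simp only [hh₀, norm_mul, norm_exp_I, mul_one]
  set h : ℝ → ℂ := fun η => h₀ (2 * Real.pi * η) with hh
  have h1 : Integrable h := h₀1.comp_mul_left' hpi
  have h2 : MemLp h 2 volume := by
    have hmh : Measurable h := hm₀.comp (measurable_const_mul (2 * Real.pi))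
    rw [memLp_two_iff_integrable_sq_norm hmh.aestronglyMeasurable]
    exact h₀2.comp_mul_left' hpi
  have hk : ∀ y, (𝓕 h) y = kernel a γ t (x - y) := by
    intro y
    have := Measure.integral_comp_mul_left
      (fun ξ : ℝ => symbol a γ t ξ * Complex.exp (Complex.I * ((x - y : ℝ) : ℂ) * ξ)) (2 * Real.pi)
    rw [Real.fourier_real_eq_integral_exp_smul, kernel, ← Complex.ofReal_inv,
      ← Complex.real_smul, ← abs_of_pos (a := (2 * Real.pi)⁻¹) (by positivity), ← this]
    congr 1 with η
    simp only [hh, hh₀, smul_eq_mul]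
    rw [mul_left_comm, ← Complex.exp_add]
    congr 2
    push_cast
    ring
  rw [convPropagator, propagator]
  have := Measure.integral_comp_div
    (fun η : ℝ => (𝓕 f : Lp ℂ 2 (volume : Measure ℝ)) η * h η) (2 * Real.pi)
  rw [integral_coeFn_fourier_mul f h1 h2, abs_of_pos (by positivity : 0 < 2 * Real.pi)] at this
  have e : ∫ ξ : ℝ, fhat f ξ * symbol a γ t ξ * Complex.exp (Complex.I * x * ξ) =
      ((2 * Real.pi : ℝ) : ℂ)⁻¹ * ∫ ξ : ℝ, (𝓕 f : Lp ℂ 2 (volume : Measure ℝ)) (ξ / (2 * Real.pi)) *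
        h (ξ / (2 * Real.pi)) := by
    rw [← integral_const_mul]
    congr 1 with ξ
    simp only [hh, hh₀, fhat, mul_div_cancel₀ ξ hpi]
    ring
  rw [e, this, Complex.real_smul, inv_mul_cancel_left₀ (by exact_mod_cast hpi)]
  congr 1 with y
  rw [hk, mul_comm]

end

end FracSchrodinger

namespace FracSchrodinger

/-! The argument splits at `γ = 1`. For `γ > 1` it is a linearised `T T*` argument. Choosing a
measurable time `t(x)` replaces the supremum by a linear operator. With the weight `(1+|ξ|)^{-σ}`,
`σ = 2s`, the kernel of `T T*` is an oscillatory integral in `y - x` with phase coefficient `τ =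
t(y) - t(x)` and damping `μ = t(x)^γ + t(y)^γ`. The link between the two is `|τ|^γ ≤ μ`: a large
time difference, which could produce a stationary point, forces damping there. This gives a bound by
one even integrable function, independent of the choice of times (`exists_integrable_majorant`).
Schur's test and duality then bound the linearised operator (`lintegral_evol_sq_le`), and Fatou's
lemma along a dense sequence of times recovers the supremum (`lintegral_maximal_evol_sq_le`).

The majorant has two pieces. For `|x| ≥ 2` one integration by parts on each half-line leaves
boundary terms that are odd in `x` and cancel, and the remainder is `O(|x|^{-1-a})`. Near the origin
the nonstationary part contributes `|x|^{σ-1}`. If `a < 1`, a stationary point `ρ` contributes about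
`(ρ/|x|)^{1/2} ρ^{-σ} e^{-cμρ^a}` with `μ ≥ (|x|ρ^{1-a})^γ`. Maximising over `ρ` gives a power of
`|x|` that is integrable exactly when `σ > (a/2)(1 - 1/γ)`. If `a = 1` the phase is linear: either
it is nonstationary, or `μ ≥ (|x|/2)^γ` and absolute values give `|x|^{γ(σ-1)}`, integrable exactly
when `σ > 1 - 1/γ`.

For `γ ≤ 1` the damping dominates. Rescaling frequency by `t^{γ/a}` makes the damping `1` and the
phase coefficient `t^{1-γ} ≤ 1` (`kernel_eq`), so the same decay at infinity shows that all kernels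
are dominated by `L¹`-dilates of a single function `max(1,|x|)^{-1-a}`. Hence the maximal function
is at most a multiple of the Hardy–Littlewood one (`exists_maximal_le_hlMaximal`), which yields the
strong and weak type bounds and, for `p = 2`, the Sobolev estimates in this range. The local
estimate is always obtained by restricting a global one. -/

/-! ### Van der Corput's first derivative test. -/

/-- Van der Corput's first derivative test with a nonnegative decreasing amplitude. -/
lemma norm_oscillatory_integral_le {φ φ' φ'' g g' : ℝ → ℝ} {A B l ε : ℝ} (hAB : A ≤ B) (hl : 0 < l)
    (hφ : ∀ x ∈ Icc A B, HasDerivAt φ (φ' x) x) (hφ' : ∀ x ∈ Icc A B, HasDerivAt φ' (φ'' x) x)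
    (hφc : ContinuousOn φ'' (Icc A B)) (hg : ∀ x ∈ Icc A B, HasDerivAt g (g' x) x)
    (hgc : ContinuousOn g' (Icc A B)) (hg0 : ∀ x ∈ Icc A B, 0 ≤ g x)
    (hg' : ∀ x ∈ Icc A B, g' x ≤ 0) (hlow : ∀ x ∈ Icc A B, l ≤ φ' x)
    (hε : ε = 1 ∨ ε = -1) (hεφ : ∀ x ∈ Icc A B, 0 ≤ ε * φ'' x) :
    ‖∫ x in A..B, Complex.exp (Complex.I * φ x) * g x‖ ≤ 4 * g A / l := by
  have huI : uIcc A B = Icc A B := uIcc_of_le hAB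
  have hAm : A ∈ Icc A B := left_mem_Icc.2 hAB
  have hBm : B ∈ Icc A B := right_mem_Icc.2 hAB
  have hpos : ∀ x ∈ Icc A B, 0 < φ' x := fun x hx => hl.trans_le (hlow x hx)
  have cφ : ContinuousOn φ (Icc A B) := fun x hx => (hφ x hx).continuousAt.continuousWithinAt
  have cφ' : ContinuousOn φ' (Icc A B) := fun x hx => (hφ' x hx).continuousAt.continuousWithinAt
  have cg : ContinuousOn g (Icc A B) := fun x hx => (hg x hx).continuousAt.continuousWithinAt
  have hanti : AntitoneOn g (Icc A B) := by
    refine antitoneOn_of_hasDerivWithinAt_nonpos (f' := g') (convex_Icc A B) cg (fun x hx => ?_)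
      fun x hx => ?_
    · exact (hg x (interior_subset hx)).hasDerivWithinAt
    · exact hg' x (interior_subset hx)
  have hgA : ∀ x ∈ Icc A B, g x ≤ g A := fun x hx => hanti hAm hx hx.1
  -- The integrand is `u v'` with `u = g/φ'` and `v = -i e^{iφ}`; integrating by parts moves the
  -- derivative onto `u`.
  set u : ℝ → ℂ := fun x => ((g x / φ' x : ℝ) : ℂ) with hu
  set w : ℝ → ℝ := fun x => (g' x * φ' x - g x * φ'' x) / φ' x ^ 2 with hw
  set v : ℝ → ℂ := fun x => -Complex.I * Complex.exp (Complex.I * φ x) with hv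
  have hud : ∀ x ∈ uIcc A B, HasDerivAt u ((w x : ℝ) : ℂ) x := by
    intro x hx
    rw [huI] at hx
    exact ((hg x hx).div (hφ' x hx) (hpos x hx).ne').ofReal_comp
  have hvd : ∀ x ∈ uIcc A B, HasDerivAt v ((φ' x : ℂ) * Complex.exp (Complex.I * φ x)) x := by
    intro x hx
    rw [huI] at hx
    have h1 := (((hφ x hx).ofReal_comp).const_mul Complex.I).cexp.const_mul (-Complex.I)
    refine h1.congr_deriv ?_
    linear_combination (-(φ' x : ℂ) * Complex.exp (Complex.I * φ x)) * Complex.I_mul_I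
  have cw : ContinuousOn w (Icc A B) :=
    ((hgc.mul cφ').sub (cg.mul hφc)).div (cφ'.pow 2) fun x hx => (pow_pos (hpos x hx) 2).ne'
  have iw : IntervalIntegrable (fun x => ((w x : ℝ) : ℂ)) volume A B := by
    refine ContinuousOn.intervalIntegrable ?_
    rw [huI]
    exact Complex.continuous_ofReal.comp_continuousOn cw
  have iv : IntervalIntegrable (fun x => (φ' x : ℂ) * Complex.exp (Complex.I * φ x)) volume A B := by
    refine ContinuousOn.intervalIntegrable ?_
    rw [huI]
    exact (Complex.continuous_ofReal.comp_continuousOn cφ').mul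
      (Complex.continuous_exp.comp_continuousOn
        (continuousOn_const.mul (Complex.continuous_ofReal.comp_continuousOn cφ)))
  have key := intervalIntegral.integral_mul_deriv_eq_deriv_mul hud hvd iw iv
  have e1 : ∫ x in A..B, Complex.exp (Complex.I * φ x) * g x =
      ∫ x in A..B, u x * ((φ' x : ℂ) * Complex.exp (Complex.I * φ x)) := by
    refine intervalIntegral.integral_congr fun x hx => ?_
    rw [huI] at hx
    have : (φ' x : ℂ) ≠ 0 := by exact_mod_cast (hpos x hx).ne'
    simp only [hu]
    push_cast
    field_simp
  have nv : ∀ x, ‖v x‖ = 1 := by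
    intro x
    simp only [hv, norm_mul, norm_neg, Complex.norm_I, one_mul, mul_comm Complex.I,
      Complex.norm_exp_ofReal_mul_I]
  have hbd : ∀ x ∈ Icc A B, ‖u x‖ ≤ g A / l := by
    intro x hx
    rw [hu, Complex.norm_real, Real.norm_of_nonneg (div_nonneg (hg0 x hx) (hpos x hx).le)]
    exact div_le_div₀ (hg0 A hAm) (hgA x hx) hl (hlow x hx)
  have hwb : ∀ x ∈ Icc A B, |w x| ≤ -(g' x) / l + g A * (ε * φ'' x / φ' x ^ 2) := by
    intro x hx
    have hp := hpos x hx
    have e : w x = g' x / φ' x - g x * (φ'' x / φ' x ^ 2) := by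
      simp only [hw]; field_simp
    have h1 : |g' x / φ' x| ≤ -(g' x) / l := by
      rw [abs_div, abs_of_nonpos (hg' x hx), abs_of_pos hp]
      exact div_le_div_of_nonneg_left (by linarith [hg' x hx]) hl (hlow x hx)
    have h2 : |φ'' x| = ε * φ'' x := by
      have := hεφ x hx
      rcases hε with rfl | rfl
      · rw [abs_of_nonneg (by linarith)]; ring
      · rw [abs_of_nonpos (by linarith)]; ring
    have h3 : |g x * (φ'' x / φ' x ^ 2)| ≤ g A * (ε * φ'' x / φ' x ^ 2) := by
      rw [abs_mul, abs_div, h2, abs_of_nonneg (hg0 x hx), abs_of_pos (pow_pos hp 2)]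
      exact mul_le_mul_of_nonneg_right (hgA x hx) (div_nonneg (hεφ x hx) (by positivity))
    rw [e]
    exact (abs_sub _ _).trans (add_le_add h1 h3)
  -- Since `φ''` has constant sign, the pointwise bound for `|u'|` is itself an exact derivative, so
  -- its integral is read off at the endpoints. It costs `2 g(A)/l`; the two boundary terms account
  -- for the rest of the constant `4`.
  have hVd : ∀ x ∈ uIcc A B, HasDerivAt (fun y => -(g y) / l + g A * (-ε * (φ' y)⁻¹))
      (-(g' x) / l + g A * (ε * φ'' x / φ' x ^ 2)) x := by
    intro x hx
    rw [huI] at hx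
    have := ((hg x hx).neg.div_const l).add
      ((((hφ' x hx).inv (hpos x hx).ne').const_mul (-ε)).const_mul (g A))
    refine this.congr_deriv ?_
    ring
  have cV : ContinuousOn (fun x => -(g' x) / l + g A * (ε * φ'' x / φ' x ^ 2)) (Icc A B) :=
    (hgc.neg.div_const l).add (continuousOn_const.mul ((continuousOn_const.mul hφc).div
      (cφ'.pow 2) fun x hx => (pow_pos (hpos x hx) 2).ne'))
  have iV : IntervalIntegrable (fun x => -(g' x) / l + g A * (ε * φ'' x / φ' x ^ 2)) volume A B := by
    refine ContinuousOn.intervalIntegrable ?_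
    rwa [huI]
  have h3 : ‖∫ x in A..B, ((w x : ℝ) : ℂ) * v x‖ ≤ 2 * g A / l := by
    calc ‖∫ x in A..B, ((w x : ℝ) : ℂ) * v x‖
        ≤ ∫ x in A..B, (-(g' x) / l + g A * (ε * φ'' x / φ' x ^ 2)) := by
          refine intervalIntegral.norm_integral_le_of_norm_le hAB
            (ae_of_all _ fun x hx => ?_) iV
          rw [norm_mul, nv, mul_one, Complex.norm_real]
          exact hwb x (Ioc_subset_Icc_self hx)
      _ = _ := intervalIntegral.integral_eq_sub_of_hasDerivAt hVd iV
      _ ≤ 2 * g A / l := by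
          have hA := hpos A hAm
          have hB := hpos B hBm
          have h4 : -ε * (φ' B)⁻¹ - -ε * (φ' A)⁻¹ ≤ l⁻¹ := by
            have hA' := inv_anti₀ hl (hlow A hAm)
            have hB' := inv_anti₀ hl (hlow B hBm)
            have := inv_pos.2 hA
            have := inv_pos.2 hB
            rcases hε with rfl | rfl <;> linarith
          have h5 := mul_le_mul_of_nonneg_left h4 (hg0 A hAm)
          have h6 : 0 ≤ g B / l := div_nonneg (hg0 B hBm) hl.le
          have : 2 * g A / l = g A / l + g A * l⁻¹ := by ring
          rw [this]
          have e : -g B / l + g A * (-ε * (φ' B)⁻¹) - (-g A / l + g A * (-ε * (φ' A)⁻¹)) =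
            g A / l - g B / l + g A * (-ε * (φ' B)⁻¹ - -ε * (φ' A)⁻¹) := by ring
          rw [e]
          linarith
  rw [e1, key]
  calc _ ≤ ‖u B * v B‖ + ‖u A * v A‖ + ‖∫ x in A..B, ((w x : ℝ) : ℂ) * v x‖ :=
        (norm_sub_le _ _).trans (by gcongr; exact norm_sub_le _ _)
    _ ≤ g A / l + g A / l + 2 * g A / l := by
        rw [norm_mul (u B) (v B), norm_mul (u A) (v A), nv, nv, mul_one, mul_one]
        exact add_le_add (add_le_add (hbd B hBm) (hbd A hAm)) h3
    _ = 4 * g A / l := by ring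

/-! ### Half-line oscillatory integrals and their nonstationary bounds. -/

/-- The phase `x ξ + τ ξ^a`. -/
noncomputable def phase (a x τ ξ : ℝ) : ℝ := x * ξ + τ * ξ ^ a

/-- The amplitude `ξ^{-α} (1 + ξ)^{-σ} e^{-μ ξ^a}`. -/
noncomputable def amp (a α σ μ ξ : ℝ) : ℝ :=
  ξ ^ (-α) * (1 + ξ) ^ (-σ) * Real.exp (-μ * ξ ^ a)

lemma hasDerivAt_phase (a x τ : ℝ) {ξ : ℝ} (hξ : 0 < ξ) :
    HasDerivAt (phase a x τ) (x + a * τ * ξ ^ (a - 1)) ξ := by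
  have := ((hasDerivAt_id ξ).const_mul x).add
    ((Real.hasDerivAt_rpow_const (p := a) (Or.inl hξ.ne')).const_mul τ)
  refine this.congr_deriv ?_
  ring

lemma hasDerivAt_phase_deriv (a x τ : ℝ) {ξ : ℝ} (hξ : 0 < ξ) :
    HasDerivAt (fun ξ => x + a * τ * ξ ^ (a - 1)) (a * τ * ((a - 1) * ξ ^ (a - 1 - 1))) ξ :=
  ((Real.hasDerivAt_rpow_const (p := a - 1) (Or.inl hξ.ne')).const_mul (a * τ)).const_add x

/-- The derivative of the amplitude. -/
noncomputable def ampDeriv (a α σ μ ξ : ℝ) : ℝ :=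
  -(α * ξ ^ (-α - 1) * (1 + ξ) ^ (-σ) * Real.exp (-μ * ξ ^ a)
    + σ * ξ ^ (-α) * (1 + ξ) ^ (-σ - 1) * Real.exp (-μ * ξ ^ a)
    + μ * a * ξ ^ (a - 1) * amp a α σ μ ξ)

lemma hasDerivAt_amp (a α σ μ : ℝ) {ξ : ℝ} (hξ : 0 < ξ) :
    HasDerivAt (amp a α σ μ) (ampDeriv a α σ μ ξ) ξ := by
  have h1 := Real.hasDerivAt_rpow_const (x := ξ) (p := -α) (Or.inl hξ.ne')
  have h2 := ((hasDerivAt_id ξ).const_add 1).rpow_const (p := -σ) (Or.inl (by positivity : (1 + ξ) ≠ 0))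
  have h3 := ((Real.hasDerivAt_rpow_const (x := ξ) (p := a) (Or.inl hξ.ne')).const_mul (-μ)).exp
  have := (h1.mul h2).mul h3
  refine this.congr_deriv ?_
  simp only [ampDeriv, amp, id, Pi.mul_apply]
  ring

lemma amp_pos (a α σ μ : ℝ) {ξ : ℝ} (hξ : 0 < ξ) : 0 < amp a α σ μ ξ := by
  unfold amp; positivity

lemma ampDeriv_nonpos {a α σ μ ξ : ℝ} (ha : 0 ≤ a) (hα : 0 ≤ α) (hσ : 0 ≤ σ) (hμ : 0 ≤ μ)
    (hξ : 0 < ξ) : ampDeriv a α σ μ ξ ≤ 0 := by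
  unfold ampDeriv
  have := amp_pos a α σ μ hξ
  rw [neg_nonpos]
  positivity

lemma continuousOn_amp (a α σ μ : ℝ) : ContinuousOn (amp a α σ μ) (Ioi 0) :=
  fun _ hx => (hasDerivAt_amp a α σ μ hx).continuousAt.continuousWithinAt

lemma continuousOn_ampDeriv (a α σ μ : ℝ) : ContinuousOn (ampDeriv a α σ μ) (Ioi 0) := by
  have h (p : ℝ) : ContinuousOn (fun ξ : ℝ => ξ ^ p) (Ioi 0) := fun x hx =>
    (Real.continuousAt_rpow_const x p (Or.inl (ne_of_gt hx))).continuousWithinAt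
  have h' (p : ℝ) : ContinuousOn (fun ξ : ℝ => (1 + ξ) ^ p) (Ioi 0) :=
    (continuousOn_const.add continuousOn_id).rpow_const fun x hx =>
      Or.inl (by have : 0 < x := hx; exact (by positivity : (1 + x) ≠ 0))
  have h3 : ContinuousOn (fun ξ : ℝ => Real.exp (-μ * ξ ^ a)) (Ioi 0) :=
    Real.continuous_exp.comp_continuousOn (continuousOn_const.mul (h a))
  exact ((((continuousOn_const.mul (h _)).mul (h' _)).mul h3).add
    (((continuousOn_const.mul (h _)).mul (h' _)).mul h3)).add
    ((continuousOn_const.mul (h _)).mul (continuousOn_amp a α σ μ)) |>.neg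

lemma antitoneOn_amp {a α σ μ : ℝ} (ha : 0 ≤ a) (hα : 0 ≤ α) (hσ : 0 ≤ σ) (hμ : 0 ≤ μ) :
    AntitoneOn (amp a α σ μ) (Ioi 0) := by
  refine antitoneOn_of_hasDerivWithinAt_nonpos (f' := ampDeriv a α σ μ) (convex_Ioi 0)
    (continuousOn_amp a α σ μ) (fun x hx => ?_) fun x hx => ?_
  · exact (hasDerivAt_amp a α σ μ (interior_subset hx)).hasDerivWithinAt
  · exact ampDeriv_nonpos ha hα hσ hμ (interior_subset hx)

/-- The integrand of the half-line oscillatory integrals. -/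
noncomputable def osc (a α σ x τ μ ξ : ℝ) : ℂ :=
  Complex.exp (Complex.I * phase a x τ ξ) * amp a α σ μ ξ

lemma star_osc (a α σ x τ μ ξ : ℝ) :
    (starRingEnd ℂ) (osc a α σ x τ μ ξ) = osc a α σ (-x) (-τ) μ ξ := by
  rw [osc, osc, map_mul, ← Complex.exp_conj, map_mul, Complex.conj_I, Complex.conj_ofReal,
    Complex.conj_ofReal]
  congr 2
  simp only [phase]
  push_cast
  ring

lemma norm_osc (a α σ x τ μ : ℝ) {ξ : ℝ} (hξ : 0 < ξ) :
    ‖osc a α σ x τ μ ξ‖ = amp a α σ μ ξ := by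
  rw [osc, norm_mul, mul_comm Complex.I, Complex.norm_exp_ofReal_mul_I, one_mul,
    Complex.norm_real, Real.norm_of_nonneg (amp_pos a α σ μ hξ).le]

lemma continuousOn_osc (a α σ x τ μ : ℝ) : ContinuousOn (osc a α σ x τ μ) (Ioi 0) := by
  refine (Complex.continuous_exp.comp_continuousOn (continuousOn_const.mul
    (Complex.continuous_ofReal.comp_continuousOn fun y hy => ?_))).mul
    (Complex.continuous_ofReal.comp_continuousOn (continuousOn_amp a α σ μ))
  exact (hasDerivAt_phase a x τ hy).continuousAt.continuousWithinAt

lemma norm_integral_osc_le_of_le {a α σ x τ μ A B l : ℝ} (ha : 0 ≤ a) (hα : 0 ≤ α) (hσ : 0 ≤ σ)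
    (hμ : 0 ≤ μ) (hA : 0 < A) (hAB : A ≤ B) (hl : 0 < l)
    (hlow : ∀ ξ ∈ Icc A B, l ≤ x + a * τ * ξ ^ (a - 1)) :
    ‖∫ ξ in A..B, osc a α σ x τ μ ξ‖ ≤ 4 * amp a α σ μ A / l := by
  have hsub : Icc A B ⊆ Ioi 0 := fun y hy => hA.trans_le hy.1
  -- The second derivative of the phase is `aτ(a-1)ξ^{a-2}`, whose sign does not depend on `ξ`; `ε`
  -- records it.
  have main (ε : ℝ) (hε : ε = 1 ∨ ε = -1) (h : 0 ≤ ε * (a * τ * (a - 1))) :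
      ‖∫ ξ in A..B, osc a α σ x τ μ ξ‖ ≤ 4 * amp a α σ μ A / l := by
    refine norm_oscillatory_integral_le hAB hl (fun y hy => hasDerivAt_phase a x τ (hsub hy))
      (fun y hy => hasDerivAt_phase_deriv a x τ (hsub hy)) ?_
      (fun y hy => hasDerivAt_amp a α σ μ (hsub hy)) ((continuousOn_ampDeriv a α σ μ).mono hsub)
      (fun y hy => (amp_pos a α σ μ (hsub hy)).le)
      (fun y hy => ampDeriv_nonpos ha hα hσ hμ (hsub hy)) hlow hε fun y hy => ?_
    · refine continuousOn_const.mul (continuousOn_const.mul fun y hy => ?_)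
      exact (Real.continuousAt_rpow_const y _
        (Or.inl (ne_of_gt (hsub hy)))).continuousWithinAt
    · have : 0 ≤ y ^ (a - 1 - 1) := Real.rpow_nonneg (le_of_lt (hsub hy)) _
      have := mul_nonneg h this
      linarith
  rcases le_total 0 (a * τ * (a - 1)) with h | h
  · exact main 1 (Or.inl rfl) (by linarith)
  · exact main (-1) (Or.inr rfl) (by linarith)

lemma norm_integral_osc_le {a α σ x τ μ A B l : ℝ} (ha : 0 ≤ a) (hα : 0 ≤ α) (hσ : 0 ≤ σ)
    (hμ : 0 ≤ μ) (hA : 0 < A) (hAB : A ≤ B) (hl : 0 < l)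
    (hlow : (∀ ξ ∈ Icc A B, l ≤ x + a * τ * ξ ^ (a - 1)) ∨
      ∀ ξ ∈ Icc A B, x + a * τ * ξ ^ (a - 1) ≤ -l) :
    ‖∫ ξ in A..B, osc a α σ x τ μ ξ‖ ≤ 4 * amp a α σ μ A / l := by
  rcases hlow with hlow | hlow
  · exact norm_integral_osc_le_of_le ha hα hσ hμ hA hAB hl hlow
  -- Conjugation flips the signs of `x` and `τ`, hence of the phase derivative, and keeps the norm.
  · rw [← Complex.norm_conj, ← intervalIntegral.intervalIntegral_conj]
    simp only [star_osc]
    refine norm_integral_osc_le_of_le ha hα hσ hμ hA hAB hl fun ξ hξ => ?_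
    have := hlow ξ hξ
    linarith

lemma norm_integral_Ioi_osc_le {a α σ x τ μ A l : ℝ} (ha : 0 ≤ a) (hα : 0 ≤ α) (hσ : 0 ≤ σ)
    (hμ : 0 ≤ μ) (hA : 0 < A) (hl : 0 < l) (hi : IntegrableOn (osc a α σ x τ μ) (Ioi A))
    (hlow : (∀ ξ ∈ Ici A, l ≤ x + a * τ * ξ ^ (a - 1)) ∨
      ∀ ξ ∈ Ici A, x + a * τ * ξ ^ (a - 1) ≤ -l) :
    ‖∫ ξ in Ioi A, osc a α σ x τ μ ξ‖ ≤ 4 * amp a α σ μ A / l := by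
  refine le_of_tendsto (intervalIntegral_tendsto_integral_Ioi A hi Filter.tendsto_id).norm ?_
  filter_upwards [Filter.eventually_ge_atTop A] with B hB
  exact norm_integral_osc_le ha hα hσ hμ hA hB hl
    (hlow.imp (fun h ξ hξ => h ξ hξ.1) (fun h ξ hξ => h ξ hξ.1))

lemma amp_le {a α σ μ ξ : ℝ} (hσ : 0 ≤ σ) (hξ : 0 < ξ) :
    amp a α σ μ ξ ≤ ξ ^ (-α) * Real.exp (-μ * ξ ^ a) := by
  unfold amp
  have h : (1 + ξ) ^ (-σ) ≤ 1 := Real.rpow_le_one_of_one_le_of_nonpos (by linarith) (by linarith)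
  have h1 : 0 ≤ ξ ^ (-α) := by positivity
  gcongr
  exact mul_le_of_le_one_right h1 h

lemma amp_zero_le {a σ μ ξ : ℝ} (hσ : 0 ≤ σ) (hξ : 0 < ξ) :
    amp a 0 σ μ ξ ≤ ξ ^ (-σ) * Real.exp (-μ * ξ ^ a) := by
  unfold amp
  have h : (1 + ξ) ^ (-σ) ≤ ξ ^ (-σ) :=
    Real.rpow_le_rpow_of_nonpos hξ (by linarith) (by linarith)
  simp only [neg_zero, Real.rpow_zero, one_mul]
  gcongr

lemma exp_neg_mul_rpow_le_one {a μ ξ : ℝ} (hμ : 0 ≤ μ) (hξ : 0 < ξ) :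
    Real.exp (-μ * ξ ^ a) ≤ 1 := by
  rw [Real.exp_le_one_iff, neg_mul, neg_nonpos]
  positivity

lemma integrableOn_osc {a α σ μ : ℝ} (x τ : ℝ) (ha : 0 < a) (hα : α < 1) (hσ : 0 ≤ σ)
    (hμ : 0 < μ) : IntegrableOn (osc a α σ x τ μ) (Ioi 0) := by
  have h := integrableOn_rpow_mul_exp_neg_mul_rpow (p := a) (s := -α) (by linarith) ha hμ
  refine Integrable.mono' h ((continuousOn_osc a α σ x τ μ).aestronglyMeasurable
    measurableSet_Ioi) ?_
  filter_upwards [ae_restrict_mem measurableSet_Ioi] with ξ hξ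
  rw [norm_osc _ _ _ _ _ _ hξ]
  exact amp_le hσ hξ

/-- The half-line oscillatory integral. -/
noncomputable def oscInt (a α σ x τ μ : ℝ) : ℂ := ∫ ξ in Ioi 0, osc a α σ x τ μ ξ

lemma star_oscInt (a α σ x τ μ : ℝ) :
    (starRingEnd ℂ) (oscInt a α σ x τ μ) = oscInt a α σ (-x) (-τ) μ := by
  rw [oscInt, ← integral_conj]
  simp only [star_osc, oscInt]

lemma norm_integral_osc_near_le {a α σ x τ μ β A : ℝ} (hβ : β < 1) (hA : 0 ≤ A)
    (h : ∀ ξ, 0 < ξ → amp a α σ μ ξ ≤ ξ ^ (-β)) :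
    ‖∫ ξ in (0 : ℝ)..A, osc a α σ x τ μ ξ‖ ≤ A ^ (1 - β) / (1 - β) := by
  calc _ ≤ ∫ ξ in (0 : ℝ)..A, ξ ^ (-β) := by
        refine intervalIntegral.norm_integral_le_of_norm_le hA (ae_of_all _ fun ξ hξ => ?_)
          (intervalIntegral.intervalIntegrable_rpow' (by linarith))
        rw [norm_osc _ _ _ _ _ _ hξ.1]
        exact h ξ hξ.1
    _ = _ := by
        rw [integral_rpow (Or.inl (by linarith)), Real.zero_rpow (by linarith), sub_zero,
          neg_add_eq_sub]

/-- Cut at `k/|x|`. Below the cut, absolute values and the singularity `ξ^{-β}` give `|x|^{β-1}`.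
Above it the derivative test gives amplitude at the cut, at most `|x|^β`, divided by `c|x|`: the
same power. The phase only needs control beyond the cut, which leaves its singularity at the origin
harmless. -/
lemma norm_oscInt_le_of_nonstationary {a α σ x τ μ β c k : ℝ} (ha : 0 < a) (hα : 0 ≤ α)
    (hα1 : α < 1) (hσ : 0 ≤ σ) (hμ : 0 < μ) (hβ0 : 0 ≤ β) (hβ : β < 1) (hx : x ≠ 0) (hc : 0 < c)
    (hk : 1 ≤ k) (h : ∀ ξ, 0 < ξ → amp a α σ μ ξ ≤ ξ ^ (-β))
    (hlow : (∀ ξ ∈ Ici (k / |x|), c * |x| ≤ x + a * τ * ξ ^ (a - 1)) ∨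
      ∀ ξ ∈ Ici (k / |x|), x + a * τ * ξ ^ (a - 1) ≤ -(c * |x|)) :
    ‖oscInt a α σ x τ μ‖ ≤ (k / (1 - β) + 4 / c) * |x| ^ (β - 1) := by
  have hx' : 0 < |x| := abs_pos.2 hx
  have hk0 : 0 < k := by linarith
  have hA : 0 < k / |x| := by positivity
  have hi := integrableOn_osc (σ := σ) x τ ha hα1 hσ hμ
  have hi' := hi.mono_set (Ioi_subset_Ioi hA.le)
  rw [oscInt, ← intervalIntegral.integral_interval_add_Ioi hi hi', add_mul]
  have e1 : |x| ^ (β - 1) = |x|⁻¹ ^ (1 - β) := by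
    rw [Real.inv_rpow hx'.le, ← Real.rpow_neg hx'.le]; congr 1; ring
  refine (norm_add_le _ _).trans (add_le_add ?_ ?_)
  · refine (norm_integral_osc_near_le hβ hA.le h).trans ?_
    rw [div_eq_mul_inv k |x|, Real.mul_rpow hk0.le (by positivity), ← e1, mul_div_right_comm]
    have : k ^ (1 - β) ≤ k := by
      calc k ^ (1 - β) ≤ k ^ (1 : ℝ) := Real.rpow_le_rpow_of_exponent_le hk (by linarith)
        _ = k := Real.rpow_one k
    have : 0 < 1 - β := by linarith
    gcongr
  · refine (norm_integral_Ioi_osc_le ha.le hα hσ hμ.le hA (mul_pos hc hx') hi' hlow).trans ?_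
    have h1 : amp a α σ μ (k / |x|) ≤ |x| ^ β := by
      refine (h _ hA).trans ?_
      rw [Real.rpow_neg hA.le, ← Real.inv_rpow hA.le, inv_div]
      refine Real.rpow_le_rpow (by positivity) ?_ hβ0
      exact div_le_self hx'.le hk
    have e : |x| ^ (β - 1) = |x| ^ β / |x| := Real.rpow_sub_one hx'.ne' β
    rw [e]
    calc 4 * amp a α σ μ (k / |x|) / (c * |x|) ≤ 4 * |x| ^ β / (c * |x|) := by gcongr
      _ = _ := by field_simp

/-! ### Integration by parts and decay at infinity. -/

lemma hasDerivAt_osc (a σ x τ μ : ℝ) {ξ : ℝ} (hξ : 0 < ξ) :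
    HasDerivAt (osc a 0 σ x τ μ) (Complex.I * x * osc a 0 σ x τ μ ξ +
      (a * (Complex.I * τ - μ) * osc a (1 - a) σ x τ μ ξ - σ * osc a 0 (σ + 1) x τ μ ξ)) ξ := by
  have h1 := (((hasDerivAt_phase a x τ hξ).ofReal_comp).const_mul Complex.I).cexp
  have h2 := (hasDerivAt_amp a 0 σ μ hξ).ofReal_comp
  refine (h1.mul h2).congr_deriv ?_
  have e1 : amp a (1 - a) σ μ ξ = ξ ^ (a - 1) * amp a 0 σ μ ξ := by
    simp only [amp, neg_zero, Real.rpow_zero, one_mul, neg_sub]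
    ring
  have e2 : amp a 0 (σ + 1) μ ξ = (1 + ξ) ^ (-σ - 1) * Real.exp (-μ * ξ ^ a) := by
    simp only [amp, neg_zero, Real.rpow_zero, one_mul, neg_add, sub_eq_add_neg]
  simp only [osc, e1, e2, ampDeriv, neg_zero, Real.rpow_zero]
  push_cast
  ring

lemma osc_zero {a σ x τ μ : ℝ} (ha : 0 < a) : osc a 0 σ x τ μ 0 = 1 := by
  simp [osc, phase, amp, Real.zero_rpow ha.ne']

lemma tendsto_osc_atTop {a σ x τ μ : ℝ} (ha : 0 < a) (hσ : 0 ≤ σ) (hμ : 0 < μ) :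
    Filter.Tendsto (osc a 0 σ x τ μ) Filter.atTop (nhds 0) := by
  have h : Filter.Tendsto (fun ξ : ℝ => Real.exp (-(μ * ξ ^ a))) Filter.atTop (nhds 0) :=
    Real.tendsto_exp_neg_atTop_nhds_zero.comp ((tendsto_rpow_atTop ha).const_mul_atTop hμ)
  refine squeeze_zero_norm' ?_ h
  filter_upwards [Filter.eventually_gt_atTop 0] with ξ hξ
  rw [norm_osc _ _ _ _ _ _ hξ]
  have := amp_le (a := a) (α := 0) (μ := μ) hσ hξ
  simpa using this

lemma continuousWithinAt_osc_zero {a σ x τ μ : ℝ} (ha : 0 < a) :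
    ContinuousWithinAt (osc a 0 σ x τ μ) (Ici 0) 0 := by
  have hr : ContinuousAt (fun ξ : ℝ => ξ ^ a) 0 := Real.continuousAt_rpow_const 0 a (Or.inr ha.le)
  have h1 : ContinuousAt (fun ξ : ℝ => (1 + ξ) ^ (-σ)) 0 :=
    (continuousAt_const.add continuousAt_id).rpow_const (Or.inl (by simp))
  refine ContinuousAt.continuousWithinAt ?_
  unfold osc phase amp
  simp only [neg_zero, Real.rpow_zero, one_mul]
  fun_prop

/-- Integrate the derivative of the integrand over the half-line: the damping kills infinity and the
value `1` at the origin gives the right-hand side. The two other integrals carry amplitudes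
`ξ^{a-1}` and `(1+ξ)^{-σ-1}`, which are handled again by the nonstationary bound. -/
lemma oscInt_integration_by_parts {a σ x τ μ : ℝ} (ha : 0 < a) (hσ : 0 ≤ σ)
    (hμ : 0 < μ) : Complex.I * x * oscInt a 0 σ x τ μ +
      (a * (Complex.I * τ - μ) * oscInt a (1 - a) σ x τ μ - σ * oscInt a 0 (σ + 1) x τ μ) = -1 := by
  have i1 := integrableOn_osc (σ := σ) x τ ha (α := 0) one_pos hσ hμ
  have i2 := integrableOn_osc (σ := σ) x τ ha (α := 1 - a) (by linarith) hσ hμ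
  have i3 := integrableOn_osc (σ := σ + 1) x τ ha (α := 0) one_pos (by linarith) hμ
  have j := (i2.const_mul (a * (Complex.I * τ - μ))).sub (i3.const_mul (σ : ℂ))
  have key := integral_Ioi_of_hasDerivAt_of_tendsto
    (continuousWithinAt_osc_zero (σ := σ) (x := x) (τ := τ) (μ := μ) ha)
    (fun ξ hξ => hasDerivAt_osc a σ x τ μ hξ) ((i1.const_mul (Complex.I * x)).add j)
    (tendsto_osc_atTop ha hσ hμ)
  rw [osc_zero ha] at key
  have e := integral_add (i1.const_mul (Complex.I * x)) j
  have e' := integral_sub (i2.const_mul (a * (Complex.I * τ - μ))) (i3.const_mul (σ : ℂ))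
  simp only [Pi.sub_apply] at e
  rw [e, e'] at key
  simp only [integral_const_mul] at key
  simpa [oscInt] using key

/-- Away from the origin the half-line integral is its boundary term up to `O(|x|^{-1-a})`. -/
lemma exists_norm_oscInt_add_le {a σ : ℝ} (ha : 0 < a) (ha1 : a ≤ 1) (hσ : 0 ≤ σ) :
    ∃ C : ℝ, 0 ≤ C ∧ ∀ x τ μ : ℝ, 2 ≤ |x| → |τ| ≤ 1 → 0 < μ → μ ≤ 2 →
      ‖oscInt a 0 σ x τ μ + 1 / (Complex.I * x)‖ ≤ C * |x| ^ (-1 - a) := by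
  set c : ℝ := 1 - 2 ^ (-a) with hc
  have hc0 : 0 < c := by
    have : (2 : ℝ) ^ (-a) < 1 := Real.rpow_lt_one_of_one_lt_of_neg (by norm_num) (by linarith)
    linarith
  have hB : (0 : ℝ) ≤ 1 / (1 - (1 - a)) + 4 / c := by
    have : 0 < 1 - (1 - a) := by linarith
    positivity
  refine ⟨(a * 3 + σ) * (1 / (1 - (1 - a)) + 4 / c), by positivity, fun x τ μ hx hτ hμ hμ2 => ?_⟩
  have hx0 : 0 < |x| := by linarith
  have hxne : x ≠ 0 := abs_pos.1 hx0
  have hlow : (∀ ξ ∈ Ici (1 / |x|), c * |x| ≤ x + a * τ * ξ ^ (a - 1)) ∨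
      ∀ ξ ∈ Ici (1 / |x|), x + a * τ * ξ ^ (a - 1) ≤ -(c * |x|) := by
    -- Beyond `1/|x|` the term from `τ ξ^a` is at most `|x|^{1-a}`, and `|x| ≥ 2` turns this into a
    -- fixed fraction `2^{-a}` of `|x|`. The remaining fraction is `c`.
    have hb : ∀ ξ ∈ Ici (1 / |x|), |a * τ * ξ ^ (a - 1)| ≤ 2 ^ (-a) * |x| := by
      intro ξ hξ
      have hA : 0 < 1 / |x| := by positivity
      have hξ0 : 0 < ξ := hA.trans_le hξ
      have h1 : ξ ^ (a - 1) ≤ |x| ^ (-a) * |x| := by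
        calc ξ ^ (a - 1) ≤ (1 / |x|) ^ (a - 1) :=
              Real.rpow_le_rpow_of_nonpos hA hξ (by linarith)
          _ = |x| ^ (-a + 1) := by
              rw [one_div, Real.inv_rpow hx0.le, ← Real.rpow_neg hx0.le]; congr 1; ring
          _ = _ := Real.rpow_add_one hx0.ne' _
      have h2 : |x| ^ (-a) ≤ 2 ^ (-a) :=
        Real.rpow_le_rpow_of_nonpos (by norm_num) hx (by linarith)
      have h3 : 0 ≤ ξ ^ (a - 1) := by positivity
      rw [abs_mul, abs_mul, abs_of_pos ha, abs_of_nonneg h3]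
      calc a * |τ| * ξ ^ (a - 1) ≤ 1 * 1 * (|x| ^ (-a) * |x|) := by gcongr
        _ ≤ _ := by rw [one_mul, one_mul]; gcongr
    rcases lt_or_gt_of_ne hxne with h | h
    · right
      intro ξ hξ
      have := (abs_le.1 (hb ξ hξ)).2
      rw [abs_of_neg h] at this ⊢
      rw [hc]; linarith
    · left
      intro ξ hξ
      have := (abs_le.1 (hb ξ hξ)).1
      rw [abs_of_pos h] at this ⊢
      rw [hc]; linarith
  have hb1 := norm_oscInt_le_of_nonstationary (α := 1 - a) (σ := σ) (β := 1 - a) (μ := μ) ha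
    (by linarith) (by linarith) hσ hμ (by linarith) (by linarith) hxne hc0 le_rfl
    (fun ξ hξ => (amp_le hσ hξ).trans
      (mul_le_of_le_one_right (by positivity) (exp_neg_mul_rpow_le_one hμ.le hξ))) hlow
  -- The amplitude `(1+ξ)^{-σ-1}` is weakened to `ξ^{-(1-a)}` so that both remainders have size
  -- `|x|^{-a}`.
  have hb2 := norm_oscInt_le_of_nonstationary (α := 0) (σ := σ + 1) (β := 1 - a) (μ := μ) ha
    le_rfl one_pos (by linarith) hμ (by linarith) (by linarith) hxne hc0 le_rfl
    (fun ξ hξ => by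
      have e : (1 + ξ) ^ (-(σ + 1)) ≤ ξ ^ (-(1 - a)) := by
        calc (1 + ξ) ^ (-(σ + 1)) ≤ (1 + ξ) ^ (-(1 - a)) :=
              Real.rpow_le_rpow_of_exponent_le (by linarith) (by linarith)
          _ ≤ _ := Real.rpow_le_rpow_of_nonpos hξ (by linarith) (by linarith)
      unfold amp
      simp only [neg_zero, Real.rpow_zero, one_mul]
      exact (mul_le_of_le_one_right (by positivity) (exp_neg_mul_rpow_le_one hμ.le hξ)).trans e)
    hlow
  have hI := oscInt_integration_by_parts (x := x) (τ := τ) ha hσ hμ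
  have hxc : (x : ℂ) ≠ 0 := by exact_mod_cast hxne
  have e : oscInt a 0 σ x τ μ + 1 / (Complex.I * x) = -(1 / (Complex.I * x)) *
      (a * (Complex.I * τ - μ) * oscInt a (1 - a) σ x τ μ - σ * oscInt a 0 (σ + 1) x τ μ) := by
    have hne : Complex.I * x ≠ 0 := mul_ne_zero Complex.I_ne_zero hxc
    field_simp
    linear_combination hI
  have e0 : 1 - a - 1 = -a := by ring
  rw [e0] at hb1 hb2
  have n1 : ‖Complex.I * (τ : ℂ) - μ‖ ≤ 3 := by
    refine (norm_sub_le _ _).trans ?_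
    rw [norm_mul, Complex.norm_I, one_mul, Complex.norm_real, Complex.norm_real, Real.norm_eq_abs,
      Real.norm_eq_abs, abs_of_pos hμ]
    linarith
  have e3 : |x| ^ (-1 - a) = |x|⁻¹ * |x| ^ (-a) := by
    rw [show -1 - a = -a - 1 by ring, Real.rpow_sub_one hx0.ne', div_eq_inv_mul]
  rw [e, norm_mul, norm_neg, norm_div, norm_mul, Complex.norm_I, norm_one, one_mul,
    Complex.norm_real, Real.norm_eq_abs, e3, one_div]
  calc |x|⁻¹ * _ ≤ |x|⁻¹ * (a * 3 * ((1 / (1 - (1 - a)) + 4 / c) * |x| ^ (-a)) +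
        σ * ((1 / (1 - (1 - a)) + 4 / c) * |x| ^ (-a))) := by
        gcongr
        refine (norm_sub_le _ _).trans ?_
        rw [norm_mul, norm_mul, norm_mul, Complex.norm_real, Complex.norm_real,
          Real.norm_of_nonneg ha.le, Real.norm_of_nonneg hσ]
        gcongr
    _ = _ := by ring

/-! ### Kernels on the whole line. -/

/-- The integrand of the kernel with the weight `(1 + |ξ|)^{-σ}`. -/
noncomputable def fullOsc (a σ x τ μ ξ : ℝ) : ℂ :=
  Complex.exp (Complex.I * x * ξ) * Complex.exp ((τ * Complex.I - μ) * ((|ξ| ^ a : ℝ) : ℂ)) *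
    (((1 + |ξ|) ^ (-σ) : ℝ) : ℂ)

lemma fullOsc_eq_osc (a σ x τ μ : ℝ) {ξ : ℝ} (hξ : 0 < ξ) :
    fullOsc a σ x τ μ ξ = osc a 0 σ x τ μ ξ := by
  rw [fullOsc, osc, abs_of_pos hξ, ← Complex.exp_add, amp, neg_zero, Real.rpow_zero, one_mul,
    Complex.ofReal_mul, Complex.ofReal_exp, mul_comm (((1 + ξ) ^ (-σ) : ℝ) : ℂ), ← mul_assoc,
    ← Complex.exp_add]
  congr 2
  simp only [phase]
  push_cast
  ring

lemma fullOsc_neg (a σ x τ μ ξ : ℝ) : fullOsc a σ x τ μ (-ξ) = fullOsc a σ (-x) τ μ ξ := by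
  simp [fullOsc]

lemma integral_fullOsc {a σ μ : ℝ} (x τ : ℝ) (ha : 0 < a) (hσ : 0 ≤ σ) (hμ : 0 < μ) :
    ∫ ξ, fullOsc a σ x τ μ ξ = oscInt a 0 σ (-x) τ μ + oscInt a 0 σ x τ μ := by
  have hi (y : ℝ) : IntegrableOn (fullOsc a σ y τ μ) (Ioi 0) :=
    (integrableOn_osc y τ ha one_pos hσ hμ).congr_fun
      (fun ξ hξ => (fullOsc_eq_osc a σ y τ μ hξ).symm) measurableSet_Ioi
  have hn : IntegrableOn (fullOsc a σ x τ μ) (Iic 0) := by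
    have := ((Measure.measurePreserving_neg (volume : Measure ℝ)).integrableOn_comp_preimage
      (MeasurableEquiv.neg ℝ).measurableEmbedding (f := fullOsc a σ (-x) τ μ)).2 (hi (-x))
    rw [integrableOn_Iic_iff_integrableOn_Iio]
    refine (this.congr_fun (fun ξ _ => ?_) ?_).mono_set (t := Neg.neg ⁻¹' (Ioi 0)) ?_
    · simp [fullOsc]
    · exact measurable_neg measurableSet_Ioi
    · intro y hy
      simpa using hy
  have he (y : ℝ) : ∫ ξ in Ioi 0, fullOsc a σ y τ μ ξ = oscInt a 0 σ y τ μ :=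
    setIntegral_congr_fun measurableSet_Ioi fun ξ hξ => fullOsc_eq_osc a σ y τ μ hξ
  rw [← intervalIntegral.integral_Iic_add_Ioi hn (hi x), he, ← he (-x)]
  congr 1
  have := integral_comp_neg_Ioi (0 : ℝ) (fullOsc a σ x τ μ)
  rw [neg_zero] at this
  rw [← this]
  simp only [fullOsc_neg]

/-- The two half-lines contribute the half-line integral at `x` and at `-x`. Their leading terms
`∓1/(ix)` cancel, and this upgrades the non-integrable decay `|x|^{-1}` to `|x|^{-1-a}`. -/
lemma exists_norm_integral_fullOsc_le {a σ : ℝ} (ha : 0 < a) (ha1 : a ≤ 1) (hσ : 0 ≤ σ) :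
    ∃ C : ℝ, 0 ≤ C ∧ ∀ x τ μ : ℝ, 2 ≤ |x| → |τ| ≤ 1 → 0 < μ → μ ≤ 2 →
      ‖∫ ξ, fullOsc a σ x τ μ ξ‖ ≤ C * |x| ^ (-1 - a) := by
  obtain ⟨C, hC, h⟩ := exists_norm_oscInt_add_le ha ha1 hσ
  refine ⟨C + C, by positivity, fun x τ μ hx hτ hμ hμ2 => ?_⟩
  have h1 := h x τ μ hx hτ hμ hμ2
  have h2 := h (-x) τ μ (by rwa [abs_neg]) hτ hμ hμ2
  rw [abs_neg] at h2
  have e : ∫ ξ, fullOsc a σ x τ μ ξ = (oscInt a 0 σ (-x) τ μ + 1 / (Complex.I * ((-x : ℝ) : ℂ))) +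
      (oscInt a 0 σ x τ μ + 1 / (Complex.I * x)) := by
    rw [integral_fullOsc x τ ha hσ hμ]
    push_cast
    rw [mul_neg, div_neg]
    ring
  rw [e, add_mul]
  exact (norm_add_le _ _).trans (add_le_add h2 h1)

/-! ### Stationary points and the singularity at the origin for `a < 1`. -/

lemma amp_zero_le_rpow {a σ μ ξ : ℝ} (hσ : 0 ≤ σ) (hμ : 0 ≤ μ) (hξ : 0 < ξ) :
    amp a 0 σ μ ξ ≤ ξ ^ (-σ) :=
  (amp_zero_le hσ hξ).trans (mul_le_of_le_one_right (by positivity)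
    (exp_neg_mul_rpow_le_one hμ hξ))

lemma rpow_le_one_sub_mul {b z u : ℝ} (hb0 : 0 ≤ b) (hb1 : b ≤ 1) (hz : 0 ≤ z)
    (h : z ≤ 1 - u) : z ^ b ≤ 1 - b * u := by
  have hy := rpow_one_add_le_one_add_mul_self (s := z - 1) (by linarith) hb0 hb1
  rw [add_sub_cancel] at hy
  nlinarith

lemma one_add_mul_le_rpow_of_inv_le {b z u : ℝ} (hb0 : 0 ≤ b) (hb1 : b ≤ 1) (hz : 0 < z)
    (hu : 0 ≤ u) (hu1 : u ≤ 1 / 2) (h : z⁻¹ ≤ 1 - u) : 1 + b * u ≤ z ^ b := by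
  have hy := rpow_le_one_sub_mul hb0 hb1 (inv_nonneg.2 hz.le) h
  have hz0 : 0 < z ^ b := by positivity
  rw [Real.inv_rpow hz.le, inv_eq_one_div, div_le_iff₀ hz0] at hy
  have hbu : 0 ≤ b * u := by positivity
  have hbu1 : b * u ≤ 1 / 2 := by nlinarith
  nlinarith

set_option maxHeartbeats 1000000 in
/-- The half-line integral with a stationary point at `ρ`. -/
lemma exists_norm_oscInt_le_of_stationary {a σ : ℝ} (ha : 0 < a) (ha1 : a < 1) (hσ : 0 ≤ σ)
    (hσ1 : σ < 1) :
    ∃ C : ℝ, 0 ≤ C ∧ ∀ x T μ ρ : ℝ, 0 < x → 0 < ρ → 0 < μ → a * T = x * ρ ^ (1 - a) →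
      ‖oscInt a 0 σ x (-T) μ‖ ≤
        C * (x ^ (σ - 1) + Real.sqrt (ρ / (2 * x)) * amp a 0 σ μ (ρ / 2)) := by
  set b := 1 - a with hb
  have hb0 : 0 < b := by linarith
  have hb1 : b ≤ 1 := by linarith
  set c : ℝ := 1 - 2 ^ (-b) with hc
  have hc0 : 0 < c := by
    have : (2 : ℝ) ^ (-b) < 1 := Real.rpow_lt_one_of_one_lt_of_neg (by norm_num) (by linarith)
    linarith
  set d : ℝ := 2 ^ b - 1 with hd
  have hd0 : 0 < d := by
    have : 1 < (2 : ℝ) ^ b := Real.one_lt_rpow (by norm_num) hb0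
    linarith
  have hσ2 : 0 < 1 - σ := by linarith
  set C1 : ℝ := 4 / (1 - σ) + 4 / c + 4 / d with hC1
  set C2 : ℝ := 32 / b + 2 with hC2
  have hC1' : 0 ≤ C1 := by positivity
  have hC2' : 0 ≤ C2 := by positivity
  refine ⟨C1 + C2, by positivity, fun x T μ ρ hx hρ hμ hT => ?_⟩
  -- Substituting the stationarity relation makes the phase derivative a function of `ρ/ξ` alone, up
  -- to the factor `x`.
  have hphase : ∀ ξ, 0 < ξ → x + a * (-T) * ξ ^ (a - 1) = x * (1 - (ρ / ξ) ^ b) := by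
    intro ξ hξ
    rw [mul_neg, hT, Real.div_rpow hρ.le hξ.le, show a - 1 = -b by rw [hb]; ring,
      Real.rpow_neg hξ.le]
    ring
  set P := x ^ (σ - 1) with hP
  set Q := Real.sqrt (ρ / (2 * x)) * amp a 0 σ μ (ρ / 2) with hQ
  have hP0 : 0 ≤ P := by positivity
  have hQ0 : 0 ≤ Q := mul_nonneg (Real.sqrt_nonneg _) (amp_pos _ _ _ _ (by positivity)).le
  -- If `ρ ≤ 2/x`, the stationary point lies inside the region estimated trivially: beyond `4/x ≥
  -- 2ρ` the phase derivative is at least `c x`.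
  rcases le_or_gt ρ (2 / x) with hρx | hρx
  · have h1 := norm_oscInt_le_of_nonstationary (α := 0) (β := σ) (k := 4) (c := c) (τ := -T)
      ha le_rfl one_pos hσ hμ hσ hσ1 hx.ne' hc0 (by norm_num)
      (fun ξ hξ => amp_zero_le_rpow hσ hμ.le hξ) (Or.inl fun ξ hξ => ?_)
    · rw [abs_of_pos hx, ← hP] at h1
      refine h1.trans ?_
      have : 0 ≤ 4 / d := by positivity
      have h2 : 0 ≤ (C1 + C2) * Q := by positivity
      have h3 : 0 ≤ (4 / d + C2) * P := by positivity
      rw [mul_add]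
      have : (C1 + C2) * P = (4 / (1 - σ) + 4 / c) * P + (4 / d + C2) * P := by rw [hC1]; ring
      linarith
    · rw [abs_of_pos hx] at hξ ⊢
      have hξ0 : 0 < ξ := lt_of_lt_of_le (by positivity) hξ
      have h2 : ρ / ξ ≤ 2⁻¹ := by
        rw [div_le_iff₀ hξ0]
        have : (4 : ℝ) / x ≤ ξ := hξ
        have e : (2 : ℝ) / x = 2⁻¹ * (4 / x) := by ring
        linarith
      have h3 : (ρ / ξ) ^ b ≤ 2 ^ (-b) := by
        rw [Real.rpow_neg (by norm_num), ← Real.inv_rpow (by norm_num)]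
        exact Real.rpow_le_rpow (by positivity) h2 hb0.le
      rw [hphase ξ hξ0, mul_comm]
      gcongr
      linarith
  -- Otherwise the half-line is cut at `1/x`, `ρ/2`, `ρ - η`, `ρ + η`. The phase curvature at `ρ` is
  -- comparable to `x/ρ`, so a window of width `(ρ/x)^{1/2}` balances the trivial bound inside
  -- against the derivative test outside. The factor `2` and `ρx > 2` guarantee `η ≤ ρ/2`.
  · set η := Real.sqrt (ρ / (2 * x)) with hη
    have hη0 : 0 < η := Real.sqrt_pos.2 (by positivity)
    have hη2 : η ^ 2 = ρ / (2 * x) := Real.sq_sqrt (by positivity)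
    have hxρ : 2 < ρ * x := by rwa [div_lt_iff₀ hx] at hρx
    have hηρ : η ≤ ρ / 2 := by
      rw [hη]
      refine Real.sqrt_le_iff.2 ⟨by positivity, ?_⟩
      rw [div_le_iff₀ (by positivity)]
      nlinarith
    have hl : (0 : ℝ) < x * (b * η / (2 * ρ)) := by positivity
    -- This is the balancing: `ρ = 2xη²` turns the derivative-test bound into a multiple of window
    -- width times amplitude.
    have hquot : ∀ G : ℝ, 4 * G / (x * (b * η / (2 * ρ))) = 16 / b * (η * G) := by
      intro G
      have : ρ = η ^ 2 * (2 * x) := by rw [hη2]; field_simp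
      rw [this]
      field_simp
      ring
    have hi := integrableOn_osc (σ := σ) x (-T) ha (α := 0) one_pos hσ hμ
    have hIi (A : ℝ) (hA : 0 ≤ A) := hi.mono_set (Ioi_subset_Ioi hA)
    have p1 : 0 < 1 / x := by positivity
    have p2 : 1 / x ≤ ρ / 2 := by
      rw [div_le_iff₀ hx]; linarith
    have p3 : ρ / 2 ≤ ρ - η := by linarith
    have p4 : ρ - η ≤ ρ + η := by linarith
    have g1 : ‖∫ ξ in (0 : ℝ)..(1 / x), osc a 0 σ x (-T) μ ξ‖ ≤ 1 / (1 - σ) * P := by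
      refine (norm_integral_osc_near_le hσ1 p1.le
        fun ξ hξ => amp_zero_le_rpow hσ hμ.le hξ).trans (le_of_eq ?_)
      rw [hP, one_div x, Real.inv_rpow hx.le, ← Real.rpow_neg hx.le, neg_sub]
      ring
    have g2 : ‖∫ ξ in (1 / x)..(ρ / 2), osc a 0 σ x (-T) μ ξ‖ ≤ 4 / d * P := by
      refine (norm_integral_osc_le (l := d * x) ha.le le_rfl hσ hμ.le p1 p2 (by positivity)
        (Or.inr fun ξ hξ => ?_)).trans ?_
      · have hξ0 : 0 < ξ := p1.trans_le hξ.1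
        have h2 : 2 ≤ ρ / ξ := by
          rw [le_div_iff₀ hξ0]; linarith [hξ.2]
        have h3 : 2 ^ b ≤ (ρ / ξ) ^ b := Real.rpow_le_rpow (by norm_num) h2 hb0.le
        rw [hphase ξ hξ0]
        nlinarith
      · have h4 : amp a 0 σ μ (1 / x) ≤ x ^ σ := by
          refine (amp_zero_le_rpow hσ hμ.le p1).trans (le_of_eq ?_)
          rw [one_div, Real.inv_rpow hx.le, Real.rpow_neg hx.le, inv_inv]
        rw [hP, Real.rpow_sub_one hx.ne']
        calc 4 * amp a 0 σ μ (1 / x) / (d * x) ≤ 4 * x ^ σ / (d * x) := by gcongr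
          _ = _ := by field_simp
    have g3 : ‖∫ ξ in (ρ / 2)..(ρ - η), osc a 0 σ x (-T) μ ξ‖ ≤ 16 / b * Q := by
      rw [hQ, ← hquot]
      refine norm_integral_osc_le ha.le le_rfl hσ hμ.le (by positivity) p3 hl
        (Or.inr fun ξ hξ => ?_)
      have hξ0 : 0 < ξ := lt_of_lt_of_le (by positivity) hξ.1
      have hηρ' : 0 < η / ρ := by positivity
      have hz1 : 1 + b * (η / ρ) ≤ (ρ / ξ) ^ b := by
        refine one_add_mul_le_rpow_of_inv_le hb0.le hb1 (by positivity) hηρ'.le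
          (by rw [div_le_iff₀ hρ]; linarith) ?_
        rw [inv_div, div_le_iff₀ hρ, sub_mul, div_mul_cancel₀ _ hρ.ne']
        linarith [hξ.2]
      rw [hphase ξ hξ0, ← mul_neg]
      refine mul_le_mul_of_nonneg_left ?_ hx.le
      -- The left side allows twice this lower bound; half of it is kept so that the same `l` serves
      -- to the right of `ρ`, where `η/(2ρ)` is what is available.
      have e : b * η / (2 * ρ) = b * (η / ρ) / 2 := by field_simp
      have : 0 < b * (η / ρ) := by positivity
      rw [e]; linarith
    have g4 : ‖∫ ξ in (ρ - η)..(ρ + η), osc a 0 σ x (-T) μ ξ‖ ≤ 2 * Q := by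
      refine (intervalIntegral.norm_integral_le_of_norm_le_const
        (C := amp a 0 σ μ (ρ / 2)) fun ξ hξ => ?_).trans (le_of_eq ?_)
      · rw [uIoc_of_le p4] at hξ
        have hξ1 : ρ / 2 ≤ ξ := by linarith [hξ.1]
        have hξ0 : 0 < ξ := lt_of_lt_of_le (by positivity) hξ1
        rw [norm_osc _ _ _ _ _ _ hξ0]
        exact antitoneOn_amp ha.le le_rfl hσ hμ.le (half_pos hρ) hξ0 hξ1
      · rw [add_sub_sub_cancel, abs_of_pos (by positivity), hQ]; ring
    have g5 : ‖∫ ξ in Ioi (ρ + η), osc a 0 σ x (-T) μ ξ‖ ≤ 16 / b * Q := by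
      have hpos : 0 < ρ + η := by positivity
      refine (norm_integral_Ioi_osc_le (l := x * (b * η / (2 * ρ))) ha.le le_rfl hσ hμ.le hpos hl
        (hIi _ hpos.le) (Or.inl fun ξ hξ => ?_)).trans ?_
      · have hξ' : ρ + η ≤ ξ := hξ
        have hξ0 : 0 < ξ := hpos.trans_le hξ
        have hy : (ρ / ξ) ^ b ≤ 1 - b * (η / (2 * ρ)) := by
          refine rpow_le_one_sub_mul hb0.le hb1 (by positivity) ?_
          rw [div_le_iff₀ hξ0]
          have h4 : η / (2 * ρ) * ρ = η / 2 := by field_simp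
          have h5 : η / (2 * ρ) ≤ 1 / 4 := by rw [div_le_iff₀ (by positivity)]; linarith
          nlinarith
        rw [hphase ξ hξ0]
        refine mul_le_mul_of_nonneg_left ?_ hx.le
        have e : b * η / (2 * ρ) = b * (η / (2 * ρ)) := by ring
        rw [e]; linarith
      · rw [hquot]
        have := antitoneOn_amp ha.le le_rfl hσ hμ.le (a := a) (α := 0) (half_pos hρ) hpos
          (show ρ / 2 ≤ ρ + η by linarith)
        rw [hQ]
        gcongr
    have i2 := intervalIntegral.integral_interval_add_Ioi hi (hIi _ p1.le)
    have i3 := intervalIntegral.integral_interval_add_Ioi (hIi _ p1.le)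
      (hIi _ (show 0 ≤ ρ / 2 by positivity))
    have i4 := intervalIntegral.integral_interval_add_Ioi (hIi _ (show 0 ≤ ρ / 2 by positivity))
      (hIi _ (show 0 ≤ ρ - η by linarith))
    have i5 := intervalIntegral.integral_interval_add_Ioi (hIi _ (show 0 ≤ ρ - η by linarith))
      (hIi _ (show 0 ≤ ρ + η by linarith))
    rw [oscInt, ← i2, ← i3, ← i4, ← i5]
    refine (norm_add_le _ _).trans ((add_le_add_right (norm_add_le _ _) _).trans
      ((add_le_add_right (add_le_add_right (norm_add_le _ _) _) _).trans
      ((add_le_add_right (add_le_add_right (add_le_add_right (norm_add_le _ _) _) _) _).trans ?_)))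
    have h4c : 0 < 4 / c := by positivity
    have hd4 : 0 < 4 / d := by positivity
    have hs : 0 < 1 / (1 - σ) := by positivity
    have k1 : (1 / (1 - σ) + 4 / d) * P ≤ (C1 + C2) * P := by
      refine mul_le_mul_of_nonneg_right ?_ hP0
      rw [hC1, show 4 / (1 - σ) = 4 * (1 / (1 - σ)) by ring]
      linarith
    have k2 : (16 / b + 2 + 16 / b) * Q ≤ (C1 + C2) * Q := by
      refine mul_le_mul_of_nonneg_right ?_ hQ0
      rw [hC2, show 32 / b = 16 / b + 16 / b by ring]
      linarith
    rw [mul_add]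
    linarith

lemma exists_rpow_mul_exp_neg_le {κ c : ℝ} (hκ : 0 < κ) (hc : 0 < c) :
    ∃ C : ℝ, 0 ≤ C ∧ ∀ y : ℝ, 0 ≤ y → y ^ κ * Real.exp (-(c * y)) ≤ C := by
  refine ⟨(κ / c) ^ κ, by positivity, fun y hy => ?_⟩
  have h1 : y ≤ κ / c * Real.exp (c * y / κ) := by
    have := Real.add_one_le_exp (c * y / κ)
    calc y = κ / c * (c * y / κ) := by field_simp
      _ ≤ _ := by gcongr; linarith
  have h2 : y ^ κ ≤ (κ / c) ^ κ * Real.exp (c * y) := by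
    refine (Real.rpow_le_rpow hy h1 hκ.le).trans (le_of_eq ?_)
    rw [Real.mul_rpow (by positivity) (by positivity), ← Real.exp_mul]
    congr 2
    field_simp
  calc _ ≤ (κ / c) ^ κ * Real.exp (c * y) * Real.exp (-(c * y)) := by gcongr
    _ = _ := by rw [mul_assoc, ← Real.exp_add]; simp

/-- Reduction of the half-line bounds to positive `x`. -/
lemma norm_oscInt_le_of_pos {a σ γ : ℝ} {F : ℝ → ℝ}
    (h : ∀ x τ μ : ℝ, 0 < x → |τ| ^ γ ≤ μ → 0 < μ → ‖oscInt a 0 σ x τ μ‖ ≤ F x)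
    {x τ μ : ℝ} (hx : x ≠ 0) (hτ : |τ| ^ γ ≤ μ) (hμ : 0 < μ) :
    ‖oscInt a 0 σ x τ μ‖ ≤ F |x| := by
  rcases lt_or_gt_of_ne hx with hx | hx
  · rw [← Complex.norm_conj, star_oscInt, abs_of_neg hx]
    exact h _ _ _ (by linarith) (by rwa [abs_neg]) hμ
  · rw [abs_of_pos hx]
    exact h _ _ _ hx hτ hμ

/-- Only `τ < 0` (for `x > 0`) produces a stationary point. There `|τ| ≥ xρ^{1-a}`, so the
hypothesis on `μ` makes the damping at `ρ/2` at least a constant times `Y = x^γ ρ^β`. The stationary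
term is then `x^{-1/2} ρ^{1/2-σ} e^{-cY}`, and `Y^κ e^{-cY}` is bounded. -/
lemma exists_norm_oscInt_le_of_lt_one {a γ σ : ℝ} (ha : 0 < a) (ha1 : a < 1) (hγ : 0 < γ)
    (hσ : 0 ≤ σ) (hσ2 : σ < 1 / 2) (hσγ : a / 2 * (1 - 1 / γ) < σ) :
    ∃ C q : ℝ, 0 ≤ C ∧ -1 < q ∧ ∀ x τ μ : ℝ, x ≠ 0 → |τ| ^ γ ≤ μ → 0 < μ →
      ‖oscInt a 0 σ x τ μ‖ ≤ C * (|x| ^ (σ - 1) + |x| ^ q) := by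
  set β : ℝ := (1 - a) * γ + a with hβ
  have hβ0 : 0 < β := by
    have : 0 < (1 - a) * γ := mul_pos (by linarith) hγ
    linarith
  -- This exponent makes `Y^κ` contain exactly `ρ^{1/2-σ}`, so that `ρ` disappears from the final
  -- bound. It is positive because `σ < 1/2`.
  set κ : ℝ := (1 / 2 - σ) / β with hκ
  have hκ0 : 0 < κ := div_pos (by linarith) hβ0
  obtain ⟨C1, hC1, h1⟩ := exists_norm_oscInt_le_of_stationary ha ha1 hσ (by linarith : σ < 1)
  obtain ⟨C2, hC2, h2⟩ := exists_rpow_mul_exp_neg_le hκ0 (by positivity : (0 : ℝ) < 2 ^ (-a))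
  have hC3 : 0 < 1 / (1 - σ) + 4 / 1 := by
    have : 0 < 1 - σ := by linarith
    positivity
  refine ⟨(1 / (1 - σ) + 4 / 1) + C1 + C1 * (2 * C2), -(1 / 2) - γ * κ, by positivity, ?_, ?_⟩
  -- Integrability of the power at the origin, `γκ < 1/2`, is equivalent to the hypothesis `hσγ`.
  · have : γ * κ < 1 / 2 := by
      rw [hκ, mul_div_assoc', div_lt_iff₀ hβ0]
      have e : a / 2 * (1 - 1 / γ) * γ = a / 2 * (γ - 1) := by field_simp
      have := mul_lt_mul_of_pos_right hσγ hγ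
      rw [hβ]
      nlinarith
    linarith
  intro x τ μ hx hτ hμ
  refine norm_oscInt_le_of_pos (γ := γ) (F := fun x => ((1 / (1 - σ) + 4 / 1) + C1 +
    C1 * (2 * C2)) * (x ^ (σ - 1) + x ^ (-(1 / 2) - γ * κ))) ?_ hx hτ hμ
  clear hx hτ hμ x τ μ
  intro x τ μ hx hτ hμ
  have q1 : 0 ≤ x ^ (σ - 1) := by positivity
  have q2 : 0 ≤ x ^ (-(1 / 2) - γ * κ) := by positivity
  rcases le_or_gt 0 τ with hτ0 | hτ0
  · have h3 := norm_oscInt_le_of_nonstationary (α := 0) (β := σ) (k := 1) (c := 1) (τ := τ)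
      ha le_rfl one_pos hσ hμ hσ (by linarith) hx.ne' one_pos le_rfl
      (fun ξ hξ => amp_zero_le_rpow hσ hμ.le hξ) (Or.inl fun ξ hξ => ?_)
    · rw [abs_of_pos hx] at h3
      refine h3.trans ?_
      refine mul_le_mul ?_ (by linarith) q1 (by positivity)
      have : 0 ≤ C1 * (2 * C2) := by positivity
      linarith
    · rw [abs_of_pos hx] at hξ ⊢
      have hξ0 : 0 < ξ := lt_of_lt_of_le (by positivity) hξ
      have : 0 ≤ a * τ * ξ ^ (a - 1) := by positivity
      linarith
  · set T := -τ with hT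
    have hT0 : 0 < T := by linarith
    -- The zero of the phase derivative `x - aTξ^{a-1}`.
    set ρ : ℝ := (a * T / x) ^ (1 - a)⁻¹ with hρ
    have hρ0 : 0 < ρ := by positivity
    have hρe : ρ ^ (1 - a) = a * T / x := Real.rpow_inv_rpow (by positivity) (by linarith)
    have h3 := h1 x T μ ρ hx hρ0 hμ (by rw [hρe]; field_simp)
    rw [hT, neg_neg] at h3
    have hxT : x * ρ ^ (1 - a) ≤ T := by
      rw [hρe, mul_div_cancel₀ _ hx.ne']; nlinarith
    have hμ' : (x * ρ ^ (1 - a)) ^ γ ≤ μ := by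
      refine le_trans (Real.rpow_le_rpow (by positivity) hxT hγ.le) ?_
      rwa [abs_of_neg hτ0] at hτ
    set Y : ℝ := x ^ γ * ρ ^ β with hY
    have hY0 : 0 < Y := by positivity
    have hYμ : 2 ^ (-a) * Y ≤ μ * (ρ / 2) ^ a := by
      have e : 2 ^ (-a) * Y = (x * ρ ^ (1 - a)) ^ γ * (ρ / 2) ^ a := by
        rw [hY, hβ, Real.rpow_add hρ0, Real.rpow_mul hρ0.le, Real.mul_rpow hx.le (by positivity),
          Real.div_rpow hρ0.le (by norm_num), Real.rpow_neg (by norm_num)]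
        ring
      rw [e]
      gcongr
    have hYκ : Y ^ κ = x ^ (γ * κ) * ρ ^ (1 / 2 - σ) := by
      rw [hY, Real.mul_rpow (by positivity) (by positivity), ← Real.rpow_mul hx.le,
        ← Real.rpow_mul hρ0.le, hκ, mul_div_cancel₀ _ hβ0.ne']
    have hs : Real.sqrt (ρ / (2 * x)) ≤ x ^ (-(1 / 2) : ℝ) * ρ ^ (1 / 2 : ℝ) := by
      rw [Real.sqrt_eq_rpow, Real.rpow_neg hx.le, ← Real.inv_rpow hx.le,
        ← Real.mul_rpow (by positivity) hρ0.le]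
      refine Real.rpow_le_rpow (by positivity) ?_ (by norm_num)
      rw [div_le_iff₀ (by positivity)]
      field_simp
      linarith
    have hamp : amp a 0 σ μ (ρ / 2) ≤ 2 * ρ ^ (-σ) * Real.exp (-(2 ^ (-a) * Y)) := by
      refine (amp_zero_le hσ (by positivity)).trans ?_
      have e1 : (ρ / 2) ^ (-σ) ≤ 2 * ρ ^ (-σ) := by
        rw [Real.div_rpow hρ0.le (by norm_num), Real.rpow_neg (by norm_num : (0 : ℝ) ≤ 2),
          div_inv_eq_mul, mul_comm]
        gcongr
        calc (2 : ℝ) ^ σ ≤ 2 ^ (1 : ℝ) :=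
              Real.rpow_le_rpow_of_exponent_le (by norm_num) (by linarith)
          _ = 2 := Real.rpow_one 2
      have e2 : Real.exp (-μ * (ρ / 2) ^ a) ≤ Real.exp (-(2 ^ (-a) * Y)) := by
        rw [Real.exp_le_exp]; linarith
      gcongr
    have hfin : Real.sqrt (ρ / (2 * x)) * amp a 0 σ μ (ρ / 2) ≤
        2 * C2 * x ^ (-(1 / 2) - γ * κ) := by
      calc _ ≤ (x ^ (-(1 / 2) : ℝ) * ρ ^ (1 / 2 : ℝ)) *
            (2 * ρ ^ (-σ) * Real.exp (-(2 ^ (-a) * Y))) :=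
            mul_le_mul hs hamp (amp_pos _ _ _ _ (by positivity)).le (by positivity)
        _ = 2 * (Y ^ κ * Real.exp (-(2 ^ (-a) * Y))) * x ^ (-(1 / 2) - γ * κ) := by
            rw [hYκ, Real.rpow_sub hx, sub_eq_add_neg, Real.rpow_add hρ0]
            field_simp
        _ ≤ _ := by
            gcongr
            exact h2 Y hY0.le
    refine h3.trans ?_
    calc C1 * (x ^ (σ - 1) + Real.sqrt (ρ / (2 * x)) * amp a 0 σ μ (ρ / 2))
        ≤ C1 * (x ^ (σ - 1) + 2 * C2 * x ^ (-(1 / 2) - γ * κ)) := by gcongr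
      _ = C1 * x ^ (σ - 1) + C1 * (2 * C2) * x ^ (-(1 / 2) - γ * κ) := by ring
      _ ≤ ((1 / (1 - σ) + 4 / 1) + C1 + C1 * (2 * C2)) * x ^ (σ - 1) +
          ((1 / (1 - σ) + 4 / 1) + C1 + C1 * (2 * C2)) * x ^ (-(1 / 2) - γ * κ) := by
          have : 0 ≤ C1 * (2 * C2) := by positivity
          gcongr <;> linarith
      _ = _ := by ring

/-! ### The singularity at the origin for `a = 1`. -/

/-- The phase derivative is the constant `x + τ`. If `|τ| < x/2` it is nonstationary. Otherwise the
damping satisfies `μ ≥ (x/2)^γ`, and oscillation is discarded: the absolute integral is at most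
`Γ(1-σ) μ^{σ-1}`. -/
lemma exists_norm_oscInt_one_le {γ σ : ℝ} (hγ : 0 < γ)
    (hσ : 0 ≤ σ) (hσ1 : σ < 1) (hσγ : 1 - 1 / γ < σ) :
    ∃ C q : ℝ, 0 ≤ C ∧ -1 < q ∧ ∀ x τ μ : ℝ, x ≠ 0 → |τ| ^ γ ≤ μ → 0 < μ →
      ‖oscInt 1 0 σ x τ μ‖ ≤ C * (|x| ^ (σ - 1) + |x| ^ q) := by
  have hΓ : 0 < Real.Gamma (1 - σ) := Real.Gamma_pos_of_pos (by linarith)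
  have hC3 : 0 < 1 / (1 - σ) + 4 / (1 / 2) := by
    have : 0 < 1 - σ := by linarith
    positivity
  set D : ℝ := (1 / 2) ^ (γ * (σ - 1)) * Real.Gamma (1 - σ) with hD
  have hD0 : 0 ≤ D := by positivity
  refine ⟨(1 / (1 - σ) + 4 / (1 / 2)) + D, γ * (σ - 1), by positivity, ?_, ?_⟩
  · have := mul_lt_mul_of_pos_right hσγ hγ
    have e : (1 - 1 / γ) * γ = γ - 1 := by field_simp
    linarith
  intro x τ μ hx hτ hμ
  refine norm_oscInt_le_of_pos (γ := γ) (F := fun x => ((1 / (1 - σ) + 4 / (1 / 2)) + D) *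
    (x ^ (σ - 1) + x ^ (γ * (σ - 1)))) ?_ hx hτ hμ
  clear hx hτ hμ x τ μ
  intro x τ μ hx hτ hμ
  have q1 : 0 ≤ x ^ (σ - 1) := by positivity
  have q2 : 0 ≤ x ^ (γ * (σ - 1)) := by positivity
  rcases lt_or_ge |τ| (1 / 2 * x) with hτx | hτx
  · have h3 := norm_oscInt_le_of_nonstationary (α := 0) (β := σ) (k := 1) (c := 1 / 2) (τ := τ)
      one_pos le_rfl one_pos hσ hμ hσ hσ1 hx.ne' (by norm_num) le_rfl
      (fun ξ hξ => amp_zero_le_rpow hσ hμ.le hξ) (Or.inl fun ξ hξ => ?_)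
    · rw [abs_of_pos hx] at h3
      refine h3.trans ?_
      exact mul_le_mul (by linarith) (by linarith) q1 (by positivity)
    · rw [abs_of_pos hx, sub_self, Real.rpow_zero]
      linarith [(abs_lt.1 hτx).1]
  · have hμx : (1 / 2 * x) ^ γ ≤ μ := (Real.rpow_le_rpow (by positivity) hτx hγ.le).trans hτ
    have h1 : ‖oscInt 1 0 σ x τ μ‖ ≤ (1 / μ) ^ (1 - σ) * Real.Gamma (1 - σ) := by
      rw [← Real.integral_rpow_mul_exp_neg_mul_Ioi (by linarith) hμ]
      refine norm_integral_le_of_norm_le ?_ ?_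
      · have := integrableOn_rpow_mul_exp_neg_mul_rpow (p := 1) (s := -σ) (by linarith) one_pos hμ
        refine this.congr_fun (fun ξ _ => ?_) measurableSet_Ioi
        simp only [Real.rpow_one]
        rw [show 1 - σ - 1 = -σ by ring, neg_mul]
      · filter_upwards [ae_restrict_mem measurableSet_Ioi] with ξ hξ
        rw [norm_osc _ _ _ _ _ _ hξ]
        have := amp_zero_le (a := 1) (μ := μ) hσ hξ
        rwa [Real.rpow_one, neg_mul, show -σ = 1 - σ - 1 by ring] at this
    have h2 : (1 / μ) ^ (1 - σ) ≤ (1 / 2) ^ (γ * (σ - 1)) * x ^ (γ * (σ - 1)) := by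
      rw [← Real.mul_rpow (by norm_num) hx.le, Real.rpow_mul (by positivity), one_div μ,
        Real.inv_rpow hμ.le, ← Real.rpow_neg hμ.le, neg_sub]
      exact Real.rpow_le_rpow_of_nonpos (by positivity) hμx (by linarith)
    refine h1.trans ?_
    calc (1 / μ) ^ (1 - σ) * Real.Gamma (1 - σ)
        ≤ (1 / 2) ^ (γ * (σ - 1)) * x ^ (γ * (σ - 1)) * Real.Gamma (1 - σ) := by gcongr
      _ = D * x ^ (γ * (σ - 1)) := by rw [hD]; ring
      _ ≤ _ := mul_le_mul (by linarith) (by linarith) q2 (by positivity)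

/-! ### The integrable majorant. -/

/-- The weighted kernels are uniformly dominated by an integrable function. -/
theorem exists_integrable_majorant {a γ σ : ℝ} (ha : 0 < a) (ha1 : a ≤ 1) (hγ : 0 < γ)
    (hσ : 0 < σ) (h : (a < 1 ∧ σ < 1 / 2 ∧ a / 2 * (1 - 1 / γ) < σ) ∨
      (a = 1 ∧ σ < 1 ∧ 1 - 1 / γ < σ)) :
    ∃ Φ : ℝ → ℝ≥0∞, Measurable Φ ∧ ∫⁻ x, Φ x < ∞ ∧ (∀ x, Φ (-x) = Φ x) ∧
      ∀ x τ μ : ℝ, |τ| ≤ 1 → |τ| ^ γ ≤ μ → 0 < μ → μ ≤ 2 →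
        ‖∫ ξ, fullOsc a σ x τ μ ξ‖ₑ ≤ Φ x := by
  obtain ⟨C, q, hC, hq, hs⟩ : ∃ C q : ℝ, 0 ≤ C ∧ -1 < q ∧ ∀ x τ μ : ℝ, x ≠ 0 → |τ| ^ γ ≤ μ →
      0 < μ → ‖oscInt a 0 σ x τ μ‖ ≤ C * (|x| ^ (σ - 1) + |x| ^ q) := by
    rcases h with ⟨h1, h2, h3⟩ | ⟨rfl, h2, h3⟩
    · exact exists_norm_oscInt_le_of_lt_one ha h1 hγ hσ.le h2 h3
    · exact exists_norm_oscInt_one_le hγ hσ.le h2 h3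
  obtain ⟨D, hD, hl⟩ := exists_norm_integral_fullOsc_le ha ha1 hσ.le
  set f : ℝ → ℝ := fun r => if r < 2 then 2 * C * (r ^ (σ - 1) + r ^ q) else D * r ^ (-1 - a)
    with hf
  have hfm : Measurable f := by
    refine Measurable.ite measurableSet_Iio ?_ ?_ <;> fun_prop
  have hf1 : IntegrableOn f (Ioo 0 2) := by
    have h1 : IntegrableOn (fun r : ℝ => 2 * C * (r ^ (σ - 1) + r ^ q)) (Ioc 0 2) :=
      ((intervalIntegrable_iff_integrableOn_Ioc_of_le (by norm_num)).1
        ((intervalIntegral.intervalIntegrable_rpow' (by linarith)).add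
          (intervalIntegral.intervalIntegrable_rpow' hq))).const_mul _
    refine (h1.mono_set Ioo_subset_Ioc_self).congr_fun (fun r hr => ?_) measurableSet_Ioo
    simp only [hf, if_pos hr.2]
  have hf2 : IntegrableOn f (Ici 2) := by
    rw [integrableOn_Ici_iff_integrableOn_Ioi]
    have h1 : IntegrableOn (fun r : ℝ => D * r ^ (-1 - a)) (Ioi 2) :=
      (integrableOn_Ioi_rpow_of_lt (by linarith) (by norm_num)).const_mul _
    refine h1.congr_fun (fun r hr => ?_) measurableSet_Ioi
    simp only [hf, if_neg (not_lt.2 (le_of_lt (show (2 : ℝ) < r from hr)))]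
  have hf3 : IntegrableOn f (Ioi 0) := by
    rw [← Ioo_union_Ici_eq_Ioi (by norm_num : (0 : ℝ) < 2)]
    exact hf1.union hf2
  have hfa : Integrable (fun x => f |x|) := by
    have h1 : IntegrableOn (fun x => f |x|) (Ioi 0) :=
      hf3.congr_fun (fun ξ hξ => by simp [abs_of_pos (mem_Ioi.1 hξ)]) measurableSet_Ioi
    have h2 : IntegrableOn (fun x => f |x|) (Iio 0) := by
      have := ((Measure.measurePreserving_neg (volume : Measure ℝ)).integrableOn_comp_preimage
        (MeasurableEquiv.neg ℝ).measurableEmbedding).2 h1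
      simpa [Function.comp_def] using this
    rw [← integrableOn_univ, ← Iic_union_Ioi (a := (0 : ℝ))]
    exact ((integrableOn_Iic_iff_integrableOn_Iio).2 h2).union h1
  -- The bounds near the origin are only available for `x ≠ 0`; the value `∞` at that one point
  -- makes the pointwise domination unconditional without affecting the integral.
  refine ⟨fun x => if x = 0 then ∞ else ENNReal.ofReal (f |x|), ?_, ?_, ?_, ?_⟩
  · refine Measurable.ite (measurableSet_singleton 0) measurable_const ?_
    exact (hfm.comp measurable_norm).ennreal_ofReal
  · refine lt_of_eq_of_lt (lintegral_congr_ae ?_) hfa.lintegral_lt_top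
    filter_upwards [Measure.ae_ne volume (0 : ℝ)] with x hx
    rw [if_neg hx]
  · intro x
    simp
  · intro x τ μ hτ hτμ hμ hμ2
    by_cases hx : x = 0
    · simp [hx]
    simp only [if_neg hx]
    rw [← ofReal_norm]
    refine ENNReal.ofReal_le_ofReal ?_
    simp only [hf]
    split_ifs with hx2
    · rw [integral_fullOsc x τ ha hσ.le hμ]
      have h1 := hs x τ μ hx hτμ hμ
      have h2 := hs (-x) τ μ (neg_ne_zero.2 hx) hτμ hμ
      rw [abs_neg] at h2
      refine (norm_add_le _ _).trans ((add_le_add h2 h1).trans (le_of_eq ?_))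
      ring
    · exact hl x τ μ (not_lt.1 hx2) hτ hμ hμ2

/-! ### Linearisation and the `T T*` kernel. -/

/-- The propagator acting on the Fourier side. -/
noncomputable def evol (a γ : ℝ) (F : ℝ → ℂ) (t x : ℝ) : ℂ :=
  ∫ ξ : ℝ, F ξ * symbol a γ t ξ * Complex.exp (Complex.I * x * ξ)

/-- The transpose of the linearised operator `F ↦ evol a γ F (t x) x`. -/
noncomputable def evolTranspose (a γ : ℝ) (t : ℝ → ℝ) (h : ℝ → ℂ) (ξ : ℝ) : ℂ :=
  ∫ x : ℝ, h x * (symbol a γ (t x) ξ * Complex.exp (Complex.I * x * ξ))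

lemma norm_symbol_le {a γ δ t : ℝ} (hγ : 0 < γ) (hδ : 0 < δ) (h : δ ≤ t) (ξ : ℝ) :
    ‖symbol a γ t ξ‖ ≤ ‖symbol a γ δ ξ‖ := by
  rw [norm_symbol, norm_symbol, Real.exp_le_exp]
  have := Real.rpow_le_rpow hδ.le h hγ.le
  have h2 : 0 ≤ |ξ| ^ a := by positivity
  nlinarith

lemma norm_symbol_le_one {a γ t : ℝ} (ht : 0 ≤ t) (ξ : ℝ) : ‖symbol a γ t ξ‖ ≤ 1 := by
  rw [norm_symbol, Real.exp_le_one_iff, neg_mul, neg_nonpos]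
  positivity

lemma measurable_symbol_prod (a γ : ℝ) {t : ℝ → ℝ} (ht : Measurable t) :
    Measurable (fun p : ℝ × ℝ => symbol a γ (t p.1) p.2) := by
  unfold symbol
  fun_prop

lemma measurable_evol (a γ : ℝ) {F : ℝ → ℂ} {t : ℝ → ℝ} (hF : Measurable F) (ht : Measurable t) :
    Measurable (fun x => evol a γ F (t x) x) := by
  have : StronglyMeasurable (fun p : ℝ × ℝ => F p.2 * symbol a γ (t p.1) p.2 *
      Complex.exp (Complex.I * p.1 * p.2)) :=
    (((hF.comp measurable_snd).mul (measurable_symbol_prod a γ ht)).mul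
      (by fun_prop)).stronglyMeasurable
  exact this.integral_prod_right.measurable

lemma measurable_evolTranspose (a γ : ℝ) {h : ℝ → ℂ} {t : ℝ → ℝ} (hh : Measurable h)
    (ht : Measurable t) : Measurable (evolTranspose a γ t h) := by
  have : StronglyMeasurable (fun p : ℝ × ℝ => h p.1 * (symbol a γ (t p.1) p.2 *
      Complex.exp (Complex.I * p.1 * p.2))) :=
    ((hh.comp measurable_fst).mul ((measurable_symbol_prod a γ ht).mul
      (by fun_prop))).stronglyMeasurable
  exact this.integral_prod_left.measurable

lemma norm_evol_le {a γ δ t : ℝ} {F : ℝ → ℂ} (hγ : 0 < γ) (hδ : 0 < δ) (ht : δ ≤ t)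
    (hF : Integrable (fun ξ => F ξ * symbol a γ δ ξ)) (x : ℝ) :
    ‖evol a γ F t x‖ ≤ ∫ ξ, ‖F ξ * symbol a γ δ ξ‖ := by
  refine norm_integral_le_of_norm_le hF.norm (ae_of_all _ fun ξ => ?_)
  rw [norm_mul, norm_exp_I, mul_one, norm_mul, norm_mul]
  exact mul_le_mul_of_nonneg_left (norm_symbol_le hγ hδ ht ξ) (norm_nonneg _)

lemma norm_evolTranspose_le {a γ δ : ℝ} {t : ℝ → ℝ} {h : ℝ → ℂ} (hγ : 0 < γ) (hδ : 0 < δ)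
    (hh : Integrable h) (ht : ∀ x, δ ≤ t x) (ξ : ℝ) :
    ‖evolTranspose a γ t h ξ‖ ≤ (∫ x, ‖h x‖) * ‖symbol a γ δ ξ‖ := by
  rw [← integral_mul_const]
  refine norm_integral_le_of_norm_le (hh.norm.mul_const _) (ae_of_all _ fun x => ?_)
  rw [norm_mul, norm_mul, norm_exp_I, mul_one]
  exact mul_le_mul_of_nonneg_left (norm_symbol_le hγ hδ (ht x) ξ) (norm_nonneg _)

/-- Fubini. Times bounded below by `δ` let the single symbol at time `δ` dominate all the others,
which gives absolute convergence of the double integral. -/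
lemma integral_mul_evol {a γ δ : ℝ} {F h : ℝ → ℂ} {t : ℝ → ℝ} (hγ : 0 < γ) (hδ : 0 < δ)
    (ht : Measurable t) (htδ : ∀ x, δ ≤ t x) (hh : Integrable h) (hFm : Measurable F)
    (hF : Integrable (fun ξ => F ξ * symbol a γ δ ξ)) :
    ∫ x, h x * evol a γ F (t x) x = ∫ ξ, F ξ * evolTranspose a γ t h ξ := by
  have hi : Integrable (fun p : ℝ × ℝ => h p.1 * (F p.2 * symbol a γ (t p.1) p.2 *
      Complex.exp (Complex.I * p.1 * p.2))) (volume.prod volume) := by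
    refine (hh.mul_prod hF).mono (hh.1.comp_fst.mul ?_) (ae_of_all _ fun p => ?_)
    · exact (((hFm.comp measurable_snd).mul (measurable_symbol_prod a γ ht)).mul
        (by fun_prop)).aestronglyMeasurable
    · rw [norm_mul, norm_mul, norm_exp_I, mul_one, norm_mul, norm_mul, norm_mul]
      gcongr
      exact norm_symbol_le hγ hδ (htδ _) _
  calc ∫ x, h x * evol a γ F (t x) x
      = ∫ x, ∫ ξ, h x * (F ξ * symbol a γ (t x) ξ * Complex.exp (Complex.I * x * ξ)) := by
        simp only [evol, integral_const_mul]
    _ = ∫ ξ, ∫ x, h x * (F ξ * symbol a γ (t x) ξ * Complex.exp (Complex.I * x * ξ)) :=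
        integral_integral_swap hi
    _ = _ := by
        congr 1 with ξ
        rw [evolTranspose, ← integral_const_mul]
        congr 1 with x
        ring

/-- Conjugation reverses the phase but not the damping, so in the `T T*` kernel times subtract and
their `γ`-th powers add. -/
lemma star_symbol_mul (a γ σ t r x y ξ : ℝ) :
    (((1 + |ξ|) ^ (-σ) : ℝ) : ℂ) *
      (starRingEnd ℂ) (symbol a γ t ξ * Complex.exp (Complex.I * x * ξ)) * symbol a γ r ξ *
        Complex.exp (Complex.I * y * ξ) = fullOsc a σ (y - x) (r - t) (r ^ γ + t ^ γ) ξ := by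
  have e1 : (starRingEnd ℂ) (symbol a γ t ξ * Complex.exp (Complex.I * x * ξ)) =
      Complex.exp (((-(t : ℂ) * Complex.I - ((t ^ γ : ℝ) : ℂ)) * ((|ξ| ^ a : ℝ) : ℂ)) -
        Complex.I * x * ξ) := by
    rw [symbol, ← Complex.exp_add, ← Complex.exp_conj]
    congr 1
    simp only [map_add, map_sub, map_mul, Complex.conj_I, Complex.conj_ofReal]
    ring
  rw [e1, fullOsc, symbol, mul_assoc, mul_assoc, ← Complex.exp_add, ← Complex.exp_add, mul_comm,
    ← Complex.exp_add]
  congr 2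
  push_cast
  ring

/-- The `T T*` identity, in the form of a bound for the transpose in a weighted `L²` space. -/
lemma lintegral_evolTranspose_sq_le {a γ σ δ : ℝ} {Φ : ℝ → ℝ≥0∞} {h : ℝ → ℂ} {t : ℝ → ℝ}
    (ha : 0 < a) (hγ : 0 < γ) (hσ : 0 ≤ σ)
    (hΦ : ∀ x τ μ : ℝ, |τ| ≤ 1 → |τ| ^ γ ≤ μ → 0 < μ → μ ≤ 2 →
        ‖∫ ξ, fullOsc a σ x τ μ ξ‖ₑ ≤ Φ x)
    (hδ : 0 < δ) (ht : Measurable t) (htδ : ∀ x, δ ≤ t x) (ht1 : ∀ x, t x < 1)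
    (hhm : Measurable h) (hh : Integrable h) :
    ∫⁻ ξ, ENNReal.ofReal ((1 + |ξ|) ^ (-σ)) * ‖evolTranspose a γ t h ξ‖ₑ ^ 2 ≤
      ∫⁻ x, ‖h x‖ₑ * ∫⁻ y, ‖h y‖ₑ * Φ (y - x) := by
  set w : ℝ → ℂ := fun ξ => (((1 + |ξ|) ^ (-σ) : ℝ) : ℂ) with hw
  have hwm : Measurable w := by fun_prop
  have hw0 : ∀ ξ : ℝ, 0 ≤ (1 + |ξ|) ^ (-σ) := fun ξ => by positivity
  have hw1 : ∀ ξ, ‖w ξ‖ ≤ 1 := by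
    intro ξ
    rw [hw, Complex.norm_real, Real.norm_of_nonneg (hw0 ξ)]
    exact Real.rpow_le_one_of_one_le_of_nonpos (by linarith [abs_nonneg ξ]) (by linarith)
  set S := evolTranspose a γ t h with hS
  have hSm : Measurable S := measurable_evolTranspose a γ hhm ht
  have ht0 : ∀ x, 0 ≤ t x := fun x => hδ.le.trans (htδ x)
  have hI0 : 0 ≤ ∫ x, ‖h x‖ := integral_nonneg fun x => norm_nonneg _
  have hSb' : ∀ ξ, ‖S ξ‖ ≤ (∫ x, ‖h x‖) * ‖symbol a γ δ ξ‖ :=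
    norm_evolTranspose_le hγ hδ hh htδ
  have hSb : ∀ ξ, ‖S ξ‖ ≤ ∫ x, ‖h x‖ := fun ξ =>
    (hSb' ξ).trans (mul_le_of_le_one_right hI0 (norm_symbol_le_one hδ.le ξ))
  have hE := integrable_symbol (γ := γ) ha hδ
  -- For fixed `x`, the value of `T(w T*h)` is again a pairing with `T*h`, so transposing once more
  -- exposes the kernel at `(x, y)`.
  have hV : ∀ x, ‖evol a γ (fun ξ => w ξ * (starRingEnd ℂ) (S ξ)) (t x) x‖ₑ ≤
      ∫⁻ y, ‖h y‖ₑ * Φ (y - x) := by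
    intro x
    set F : ℝ → ℂ := fun ξ => w ξ *
      (starRingEnd ℂ) (symbol a γ (t x) ξ * Complex.exp (Complex.I * x * ξ)) with hF
    have hFm : Measurable F :=
      hwm.mul (Complex.continuous_conj.measurable.comp
        ((measurable_symbol a γ (t x)).mul (by fun_prop)))
    have hFi : Integrable (fun ξ => F ξ * symbol a γ δ ξ) := by
      refine hE.bdd_mul (c := 1) hFm.aestronglyMeasurable (ae_of_all _ fun ξ => ?_)
      rw [hF, norm_mul, Complex.norm_conj, norm_mul, norm_exp_I, mul_one]
      exact mul_le_one₀ (hw1 ξ) (norm_nonneg _) (norm_symbol_le_one (ht0 x) ξ)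
    have h1 := integral_mul_evol (a := a) hγ hδ ht htδ hh hFm hFi
    have h2 : evol a γ (fun ξ => w ξ * (starRingEnd ℂ) (S ξ)) (t x) x =
        (starRingEnd ℂ) (∫ ξ, F ξ * S ξ) := by
      rw [← integral_conj, evol]
      congr 1 with ξ
      simp only [hF, hw, map_mul, Complex.conj_conj, Complex.conj_ofReal]
      ring
    rw [h2, ← h1, ← ofReal_norm, Complex.norm_conj, ofReal_norm]
    refine (enorm_integral_le_lintegral_enorm _).trans (lintegral_mono fun y => ?_)
    simp only [enorm_mul]
    gcongr
    have h3 : evol a γ F (t y) y = ∫ ξ, fullOsc a σ (y - x) (t y - t x) (t y ^ γ + t x ^ γ) ξ := by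
      rw [evol]
      congr 1 with ξ
      rw [← star_symbol_mul]
    rw [h3]
    have px : 0 < t x := hδ.trans_le (htδ x)
    have py : 0 < t y := hδ.trans_le (htδ y)
    have hx1 : t x ^ γ ≤ 1 := Real.rpow_le_one px.le (ht1 x).le hγ.le
    have hy1 : t y ^ γ ≤ 1 := Real.rpow_le_one py.le (ht1 y).le hγ.le
    have hx0 : 0 < t x ^ γ := by positivity
    have hy0 : 0 < t y ^ γ := by positivity
    refine hΦ _ _ _ (abs_le.2 ⟨by linarith [ht1 x], by linarith [ht1 y]⟩) ?_
      (by positivity) (by linarith)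
    -- The decisive relation `|τ|^γ ≤ μ`: the difference of two positive times is at most the larger
    -- one, whose `γ`-th power is one of the summands of `μ`. This works for every `γ > 0`.
    rcases le_total (t x) (t y) with hxy | hxy
    · rw [abs_of_nonneg (by linarith)]
      have := Real.rpow_le_rpow (z := γ) (by linarith) (by linarith : t y - t x ≤ t y) hγ.le
      linarith
    · rw [abs_of_nonpos (by linarith)]
      have := Real.rpow_le_rpow (z := γ) (by linarith) (by linarith : -(t y - t x) ≤ t x) hγ.le
      linarith
  have hFm : Measurable (fun ξ => w ξ * (starRingEnd ℂ) (S ξ)) :=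
    hwm.mul (Complex.continuous_conj.measurable.comp hSm)
  have hFi : Integrable (fun ξ => w ξ * (starRingEnd ℂ) (S ξ) * symbol a γ δ ξ) := by
    refine hE.bdd_mul (c := 1 * ∫ x, ‖h x‖) hFm.aestronglyMeasurable (ae_of_all _ fun ξ => ?_)
    rw [norm_mul, Complex.norm_conj]
    exact mul_le_mul (hw1 ξ) (hSb ξ) (norm_nonneg _) zero_le_one
  have h1 := integral_mul_evol (a := a) hγ hδ ht htδ hh hFm hFi
  have hSS : ∀ ξ, w ξ * (starRingEnd ℂ) (S ξ) * S ξ =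
      (((1 + |ξ|) ^ (-σ) * ‖S ξ‖ ^ 2 : ℝ) : ℂ) := by
    intro ξ
    rw [mul_assoc, Complex.conj_mul', hw]
    push_cast
    rfl
  have hfin : Integrable (fun ξ => (1 + |ξ|) ^ (-σ) * ‖S ξ‖ ^ 2) := by
    refine (hE.norm.const_mul ((∫ x, ‖h x‖) * ∫ x, ‖h x‖)).mono'
      (Measurable.aestronglyMeasurable (by fun_prop)) (ae_of_all _ fun ξ => ?_)
    have h2 : (1 + |ξ|) ^ (-σ) ≤ 1 :=
      Real.rpow_le_one_of_one_le_of_nonpos (by linarith [abs_nonneg ξ]) (by linarith)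
    rw [Real.norm_of_nonneg (mul_nonneg (hw0 ξ) (by positivity)), sq, mul_assoc]
    refine (mul_le_of_le_one_left (by positivity) h2).trans ?_
    exact mul_le_mul (hSb ξ) (hSb' ξ) (norm_nonneg _) hI0
  have h4 : ∫⁻ ξ, ENNReal.ofReal ((1 + |ξ|) ^ (-σ)) * ‖S ξ‖ₑ ^ 2 =
      ‖∫ ξ, w ξ * (starRingEnd ℂ) (S ξ) * S ξ‖ₑ := by
    simp only [hSS]
    rw [integral_complex_ofReal, ← ofReal_norm, Complex.norm_real, Real.norm_of_nonneg
      (integral_nonneg fun ξ => mul_nonneg (hw0 ξ) (by positivity)),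
      ofReal_integral_eq_lintegral_ofReal hfin
        (ae_of_all _ fun ξ => mul_nonneg (hw0 ξ) (by positivity))]
    refine lintegral_congr fun ξ => ?_
    rw [ENNReal.ofReal_mul (hw0 ξ), ENNReal.ofReal_pow (norm_nonneg _), ofReal_norm]
  rw [h4, ← h1]
  refine (enorm_integral_le_lintegral_enorm _).trans (lintegral_mono fun x => ?_)
  simp only [enorm_mul]
  gcongr
  exact hV x

/-! ### Schur's test and the linearised estimate. -/

/-- Schur's test for a symmetric convolution kernel: `2uv ≤ u² + v²` under the double integral, and
each of the two resulting terms integrates out by translation invariance. -/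
lemma lintegral_mul_lintegral_conv_le {Φ H : ℝ → ℝ≥0∞} (hΦ : Measurable Φ)
    (hΦn : ∀ x, Φ (-x) = Φ x) (hH : Measurable H) :
    ∫⁻ x, H x * ∫⁻ y, H y * Φ (y - x) ≤ (∫⁻ x, Φ x) * ∫⁻ x, H x ^ 2 := by
  have hprod : ∀ u v : ℝ≥0∞, 2 * (u * v) ≤ u ^ 2 + v ^ 2 := by
    intro u v
    rcases eq_or_ne u ∞ with rfl | hu
    · simp
    rcases eq_or_ne v ∞ with rfl | hv
    · simp
    lift u to ℝ≥0 using hu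
    lift v to ℝ≥0 using hv
    have := two_mul_le_add_sq u v
    rw [mul_assoc] at this
    exact_mod_cast this
  have hm : Measurable (fun p : ℝ × ℝ => Φ (p.2 - p.1)) :=
    hΦ.comp (measurable_snd.sub measurable_fst)
  have e1 : ∀ x, ∫⁻ y, Φ (y - x) = ∫⁻ y, Φ y := fun x => lintegral_sub_right_eq_self Φ x
  have e2 : ∀ y, ∫⁻ x, Φ (y - x) = ∫⁻ x, Φ x := by
    intro y
    rw [← lintegral_sub_right_eq_self Φ y]
    refine lintegral_congr fun x => ?_
    rw [← hΦn, neg_sub]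
  have k1 : ∫⁻ x, ∫⁻ y, H x ^ 2 * Φ (y - x) = (∫⁻ x, Φ x) * ∫⁻ x, H x ^ 2 := by
    rw [← lintegral_const_mul _ (by fun_prop)]
    refine lintegral_congr fun x => ?_
    rw [lintegral_const_mul _ (by fun_prop), e1, mul_comm]
  have k2 : ∫⁻ x, ∫⁻ y, H y ^ 2 * Φ (y - x) = (∫⁻ x, Φ x) * ∫⁻ x, H x ^ 2 := by
    rw [lintegral_lintegral_swap (by fun_prop), ← lintegral_const_mul _ (by fun_prop)]
    refine lintegral_congr fun x => ?_
    rw [lintegral_const_mul _ (by fun_prop), e2, mul_comm]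
  have k3 : 2 * ∫⁻ x, H x * ∫⁻ y, H y * Φ (y - x) ≤ 2 * ((∫⁻ x, Φ x) * ∫⁻ x, H x ^ 2) := by
    calc 2 * ∫⁻ x, H x * ∫⁻ y, H y * Φ (y - x)
        = ∫⁻ x, ∫⁻ y, 2 * (H x * H y) * Φ (y - x) := by
          have hm2 : Measurable (fun x => ∫⁻ y, H y * Φ (y - x)) :=
            Measurable.lintegral_prod_right (by fun_prop)
          rw [← lintegral_const_mul _ (by fun_prop)]
          refine lintegral_congr fun x => ?_
          rw [← mul_assoc, ← lintegral_const_mul _ (by fun_prop)]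
          refine lintegral_congr fun y => ?_
          ring
      _ ≤ ∫⁻ x, ∫⁻ y, (H x ^ 2 * Φ (y - x) + H y ^ 2 * Φ (y - x)) := by
          refine lintegral_mono fun x => lintegral_mono fun y => ?_
          rw [← add_mul]
          gcongr
          exact hprod _ _
      _ = (∫⁻ x, ∫⁻ y, H x ^ 2 * Φ (y - x)) + ∫⁻ x, ∫⁻ y, H y ^ 2 * Φ (y - x) := by
          rw [← lintegral_add_left (Measurable.lintegral_prod_right (by fun_prop))]
          refine lintegral_congr fun x => ?_
          rw [lintegral_add_left (by fun_prop)]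
      _ = _ := by rw [k1, k2, two_mul]
  exact (ENNReal.mul_le_mul_iff_right (by norm_num) (by norm_num)).1 k3

/-- Cauchy–Schwarz with a weight. -/
lemma enorm_integral_mul_sq_le {w : ℝ → ℝ} (hw : ∀ ξ, 0 < w ξ) (hwm : Measurable w)
    {F S : ℝ → ℂ} (hF : Measurable F) (hS : Measurable S) :
    ‖∫ ξ, F ξ * S ξ‖ₑ ^ 2 ≤ (∫⁻ ξ, ENNReal.ofReal (w ξ) * ‖F ξ‖ₑ ^ 2) *
      ∫⁻ ξ, ENNReal.ofReal (w ξ)⁻¹ * ‖S ξ‖ₑ ^ 2 := by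
  set A : ℝ → ℝ≥0∞ := fun ξ => ENNReal.ofReal (Real.sqrt (w ξ)) * ‖F ξ‖ₑ with hA
  set B : ℝ → ℝ≥0∞ := fun ξ => ENNReal.ofReal (Real.sqrt (w ξ)⁻¹) * ‖S ξ‖ₑ with hB
  have h1 : ‖∫ ξ, F ξ * S ξ‖ₑ ≤ ∫⁻ ξ, (A * B) ξ := by
    refine (enorm_integral_le_lintegral_enorm _).trans (lintegral_mono fun ξ => ?_)
    have e : ENNReal.ofReal (Real.sqrt (w ξ)) * ENNReal.ofReal (Real.sqrt (w ξ)⁻¹) = 1 := by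
      rw [← ENNReal.ofReal_mul (Real.sqrt_nonneg _), ← Real.sqrt_mul (hw ξ).le,
        mul_inv_cancel₀ (hw ξ).ne', Real.sqrt_one, ENNReal.ofReal_one]
    rw [enorm_mul, Pi.mul_apply, hA, hB]
    refine le_of_eq ?_
    calc _ = 1 * (‖F ξ‖ₑ * ‖S ξ‖ₑ) := (one_mul _).symm
      _ = _ := by rw [← e]; ring
  have h2 := ENNReal.lintegral_mul_le_Lp_mul_Lq volume Real.HolderConjugate.two_two
    (f := A) (g := B) (by fun_prop) (by fun_prop)
  have eA : ∀ ξ, A ξ ^ (2 : ℝ) = ENNReal.ofReal (w ξ) * ‖F ξ‖ₑ ^ 2 := by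
    intro ξ
    rw [ENNReal.rpow_two, hA, mul_pow, ← ENNReal.ofReal_pow (Real.sqrt_nonneg _),
      Real.sq_sqrt (hw ξ).le]
  have eB : ∀ ξ, B ξ ^ (2 : ℝ) = ENNReal.ofReal (w ξ)⁻¹ * ‖S ξ‖ₑ ^ 2 := by
    intro ξ
    rw [ENNReal.rpow_two, hB, mul_pow, ← ENNReal.ofReal_pow (Real.sqrt_nonneg _),
      Real.sq_sqrt (inv_pos.2 (hw ξ)).le]
  simp only [eA, eB] at h2
  have h3 := ENNReal.rpow_le_rpow (h1.trans h2) (by norm_num : (0 : ℝ) ≤ 2)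
  rw [ENNReal.rpow_two, ENNReal.mul_rpow_of_nonneg _ _ (by norm_num), ← ENNReal.rpow_mul,
    ← ENNReal.rpow_mul] at h3
  simpa using h3

/-- Duality. Testing `U = TF` against its conjugate on a bounded window, with `A` the square
integral there, the transpose identity, weighted Cauchy–Schwarz and Schur's test give `A² ≤ N ‖Φ‖₁
A`. Dividing by `A` and letting the window grow finishes. -/
lemma lintegral_evol_sq_le {a γ σ δ : ℝ} {Φ : ℝ → ℝ≥0∞} {F : ℝ → ℂ} {t : ℝ → ℝ}
    (ha : 0 < a) (hγ : 0 < γ) (hσ : 0 ≤ σ) (hΦm : Measurable Φ) (hΦn : ∀ x, Φ (-x) = Φ x)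
    (hΦ : ∀ x τ μ : ℝ, |τ| ≤ 1 → |τ| ^ γ ≤ μ → 0 < μ → μ ≤ 2 →
        ‖∫ ξ, fullOsc a σ x τ μ ξ‖ₑ ≤ Φ x)
    (hδ : 0 < δ) (ht : Measurable t) (htδ : ∀ x, δ ≤ t x) (ht1 : ∀ x, t x < 1)
    (hFm : Measurable F) (hF : MemLp F 2 volume) :
    ∫⁻ x, ‖evol a γ F (t x) x‖ₑ ^ 2 ≤
      (∫⁻ x, Φ x) * ∫⁻ ξ, ENNReal.ofReal ((1 + |ξ|) ^ σ) * ‖F ξ‖ₑ ^ 2 := by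
  set U : ℝ → ℂ := fun x => evol a γ F (t x) x with hU
  have hUm : Measurable U := measurable_evol a γ hFm ht
  have hFi : Integrable (fun ξ => F ξ * symbol a γ δ ξ) :=
    hF.integrable_mul (memLp_two_symbol ha hδ)
  set M : ℝ := ∫ ξ, ‖F ξ * symbol a γ δ ξ‖ with hM
  have hUb : ∀ x, ‖U x‖ ≤ M := fun x => norm_evol_le hγ hδ (htδ x) hFi x
  have main : ∀ n : ℕ, ∫⁻ x in Icc (-n : ℝ) n, ‖U x‖ₑ ^ 2 ≤
      (∫⁻ x, Φ x) * ∫⁻ ξ, ENNReal.ofReal ((1 + |ξ|) ^ σ) * ‖F ξ‖ₑ ^ 2 := by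
    intro n
    set I := Icc (-n : ℝ) n with hI
    set h : ℝ → ℂ := I.indicator (fun x => (starRingEnd ℂ) (U x)) with hh
    have hcU : Measurable (fun x => (starRingEnd ℂ) (U x)) :=
      Complex.continuous_conj.measurable.comp hUm
    have hhm : Measurable h := hcU.indicator measurableSet_Icc
    have hvol : volume I < ∞ := measure_Icc_lt_top
    have hhi : Integrable h := by
      rw [hh, integrable_indicator_iff measurableSet_Icc]
      exact IntegrableOn.of_bound hvol hcU.aestronglyMeasurable M
        (ae_of_all _ fun x => by rw [Complex.norm_conj]; exact hUb x)
    have hhe : ∀ x, ‖h x‖ₑ ^ 2 = I.indicator (fun x => ‖U x‖ₑ ^ 2) x := by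
      intro x
      by_cases hx : x ∈ I
      · simp only [hh, indicator_of_mem hx]
        rw [← ofReal_norm, Complex.norm_conj, ofReal_norm]
      · simp [hh, indicator_of_notMem hx]
    set A := ∫⁻ x in I, ‖U x‖ₑ ^ 2 with hA
    have hAh : ∫⁻ x, ‖h x‖ₑ ^ 2 = A := by
      simp only [hhe]
      rw [lintegral_indicator measurableSet_Icc]
    -- Finiteness is what allows the division by `A`; it comes from the crude bound on `U` and the
    -- bounded window.
    have hAfin : A ≠ ∞ := by
      have : A ≤ ∫⁻ x in I, ENNReal.ofReal M ^ 2 := by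
        refine lintegral_mono fun x => ?_
        gcongr
        rw [← ofReal_norm]
        exact ENNReal.ofReal_le_ofReal (hUb x)
      refine (this.trans_lt ?_).ne
      rw [setLIntegral_const]
      exact ENNReal.mul_lt_top (by finiteness) hvol
    have h1 : A ≤ ‖∫ x, h x * U x‖ₑ := by
      have e : ∀ x, h x * U x = ((‖h x‖ ^ 2 : ℝ) : ℂ) := by
        intro x
        by_cases hx : x ∈ I
        · simp only [hh, indicator_of_mem hx, Complex.norm_conj]
          rw [Complex.conj_mul']
          push_cast
          rfl
        · simp [hh, indicator_of_notMem hx]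
      have hi : Integrable (fun x => ‖h x‖ ^ 2) := by
        have := (hhi.bdd_mul (c := M) hUm.aestronglyMeasurable
          (ae_of_all _ hUb)).norm
        refine this.congr (ae_of_all _ fun x => ?_)
        simp only [mul_comm (U x), e, Complex.norm_real]
        exact Real.norm_of_nonneg (by positivity)
      simp only [e]
      rw [integral_complex_ofReal, ← ofReal_norm, Complex.norm_real, Real.norm_of_nonneg
        (integral_nonneg fun ξ => by positivity),
        ofReal_integral_eq_lintegral_ofReal hi (ae_of_all _ fun x => by positivity), ← hAh]
      refine le_of_eq (lintegral_congr fun x => ?_)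
      rw [ENNReal.ofReal_pow (norm_nonneg _), ofReal_norm]
    have h2 := integral_mul_evol (a := a) hγ hδ ht htδ hhi hFm hFi
    have h3 := enorm_integral_mul_sq_le (w := fun ξ => (1 + |ξ|) ^ σ)
      (fun ξ => by positivity) (by fun_prop) hFm (measurable_evolTranspose a γ hhm ht)
    have h4 := lintegral_evolTranspose_sq_le ha hγ hσ hΦ hδ ht htδ ht1 hhm hhi
    have h5 := lintegral_mul_lintegral_conv_le hΦm hΦn hhm.enorm
    rw [hAh] at h5
    have e6 : ∀ ξ : ℝ, ((1 + |ξ|) ^ σ)⁻¹ = (1 + |ξ|) ^ (-σ) := fun ξ =>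
      (Real.rpow_neg (by positivity) _).symm
    simp only [e6] at h3
    set N := ∫⁻ ξ, ENNReal.ofReal ((1 + |ξ|) ^ σ) * ‖F ξ‖ₑ ^ 2 with hN
    have h7 : A * A ≤ (∫⁻ x, Φ x) * N * A := by
      calc A * A = A ^ 2 := (sq A).symm
        _ ≤ ‖∫ x, h x * U x‖ₑ ^ 2 := by gcongr
        _ ≤ N * ((∫⁻ x, Φ x) * A) := by
          rw [hU, h2]
          exact h3.trans (by gcongr; exact h4.trans h5)
        _ = _ := by ring
    rcases eq_or_ne A 0 with h0 | h0
    · rw [h0]; exact zero_le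
    · exact (ENNReal.mul_le_mul_iff_left h0 hAfin).1 h7
  have hun : ⋃ n : ℕ, Icc (-n : ℝ) n = univ := by
    refine eq_univ_of_forall fun x => ?_
    obtain ⟨n, hn⟩ := exists_nat_ge |x|
    exact mem_iUnion.2 ⟨n, abs_le.1 hn⟩
  have hmono : Monotone (fun n : ℕ => Icc (-n : ℝ) n) := by
    intro m n hmn
    have : (m : ℝ) ≤ n := by exact_mod_cast hmn
    exact Icc_subset_Icc (by linarith) this
  rw [← setLIntegral_univ, ← hun, setLIntegral_iUnion_of_directed _ hmono.directed_le]
  exact iSup_le main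

/-! ### From measurable times to the supremum. -/

/-- Continuity in time at fixed `x` lets a countable dense set of times determine the supremum. -/
lemma continuousAt_evol {a γ t₀ : ℝ} {F : ℝ → ℂ} (ha : 0 < a) (hγ : 0 < γ) (ht₀ : 0 < t₀)
    (hFm : Measurable F) (hF : MemLp F 2 volume) (x : ℝ) :
    ContinuousAt (fun t => evol a γ F t x) t₀ := by
  have hδ : 0 < t₀ / 2 := by positivity
  have hFi : Integrable (fun ξ => F ξ * symbol a γ (t₀ / 2) ξ) :=
    hF.integrable_mul (memLp_two_symbol ha hδ)
  refine continuousAt_of_dominated (bound := fun ξ => ‖F ξ * symbol a γ (t₀ / 2) ξ‖)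
    (Filter.Eventually.of_forall fun t => ?_) ?_ hFi.norm (ae_of_all _ fun ξ => ?_)
  · exact ((hFm.mul (measurable_symbol a γ t)).mul (by fun_prop)).aestronglyMeasurable
  · filter_upwards [lt_mem_nhds (half_lt_self ht₀)] with t ht
    refine ae_of_all _ fun ξ => ?_
    rw [norm_mul, norm_exp_I, mul_one, norm_mul, norm_mul]
    exact mul_le_mul_of_nonneg_left (norm_symbol_le hγ hδ ht.le ξ) (norm_nonneg _)
  · have : ContinuousAt (fun t : ℝ => t ^ γ) t₀ := Real.continuousAt_rpow_const _ _ (Or.inr hγ.le)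
    unfold symbol
    fun_prop

/-- A measurable choice of the time at which finitely many of the functions are maximal. -/
lemma exists_measurable_time {a γ : ℝ} {F : ℝ → ℂ} (hFm : Measurable F)
    (d : ℕ → Ioo (0 : ℝ) 1) (n : ℕ) :
    ∃ (t : ℝ → ℝ) (δ : ℝ), 0 < δ ∧ Measurable t ∧ (∀ x, δ ≤ t x) ∧ (∀ x, t x < 1) ∧
      ∀ i ≤ n, ∀ x, ‖evol a γ F (d i) x‖ₑ ≤ ‖evol a γ F (t x) x‖ₑ := by
  induction n with
  | zero =>
    refine ⟨fun _ => d 0, d 0, (d 0).2.1, measurable_const, fun _ => le_rfl, fun _ => (d 0).2.2,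
      fun i hi x => ?_⟩
    rw [Nat.le_zero.1 hi]
  | succ n ih =>
    obtain ⟨t, δ, hδ, htm, htδ, ht1, h⟩ := ih
    set A : Set ℝ := {x | ‖evol a γ F (t x) x‖ₑ < ‖evol a γ F (d (n + 1)) x‖ₑ} with hA
    have hAm : MeasurableSet A :=
      measurableSet_lt (measurable_evol a γ hFm htm).enorm
        (measurable_evol a γ hFm measurable_const).enorm
    classical
    refine ⟨A.piecewise (fun _ => (d (n + 1) : ℝ)) t, min δ (d (n + 1)),
      lt_min hδ (d (n + 1)).2.1, Measurable.piecewise hAm measurable_const htm, fun x => ?_,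
      fun x => ?_, fun i hi x => ?_⟩
    · by_cases hx : x ∈ A
      · rw [piecewise_eq_of_mem _ _ _ hx]; exact min_le_right _ _
      · rw [piecewise_eq_of_notMem _ _ _ hx]; exact (min_le_left _ _).trans (htδ x)
    · by_cases hx : x ∈ A
      · rw [piecewise_eq_of_mem _ _ _ hx]; exact (d (n + 1)).2.2
      · rw [piecewise_eq_of_notMem _ _ _ hx]; exact ht1 x
    · by_cases hx : x ∈ A
      · rw [piecewise_eq_of_mem _ _ _ hx]
        rcases Nat.le_succ_iff.1 hi with hi | rfl
        · exact (h i hi x).trans (le_of_lt hx)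
        · exact le_rfl
      · rw [piecewise_eq_of_notMem _ _ _ hx]
        rcases Nat.le_succ_iff.1 hi with hi | rfl
        · exact h i hi x
        · exact not_lt.1 hx

/-- The maximum over the first `n` times of a dense sequence is attained at a measurable time
bounded away from `0`, where the linearised estimate holds with a constant independent of that time.
Fatou's lemma passes to the limit; the lower bounds `δ n` may tend to `0`. -/
lemma lintegral_maximal_evol_sq_le {a γ σ : ℝ} {Φ : ℝ → ℝ≥0∞} {F : ℝ → ℂ}
    (ha : 0 < a) (hγ : 0 < γ) (hσ : 0 ≤ σ) (hΦm : Measurable Φ) (hΦn : ∀ x, Φ (-x) = Φ x)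
    (hΦ : ∀ x τ μ : ℝ, |τ| ≤ 1 → |τ| ^ γ ≤ μ → 0 < μ → μ ≤ 2 →
        ‖∫ ξ, fullOsc a σ x τ μ ξ‖ₑ ≤ Φ x)
    (hFm : Measurable F) (hF : MemLp F 2 volume) :
    ∫⁻ x, maximal (evol a γ F) x ^ 2 ≤
      (∫⁻ x, Φ x) * ∫⁻ ξ, ENNReal.ofReal ((1 + |ξ|) ^ σ) * ‖F ξ‖ₑ ^ 2 := by
  have : Nonempty (Ioo (0 : ℝ) 1) := ⟨⟨1 / 2, by norm_num, by norm_num⟩⟩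
  set d := TopologicalSpace.denseSeq (Ioo (0 : ℝ) 1) with hd
  choose t δ hδ htm htδ ht1 h using fun n => exists_measurable_time (a := a) (γ := γ) hFm d n
  have hpt : ∀ x, maximal (evol a γ F) x ^ 2 ≤
      Filter.liminf (fun n => ‖evol a γ F (t n x) x‖ₑ ^ 2) Filter.atTop := by
    intro x
    set L := Filter.liminf (fun n => ‖evol a γ F (t n x) x‖ₑ ^ 2) Filter.atTop with hL
    have hdn : ∀ s : Ioo (0 : ℝ) 1, ‖evol a γ F s x‖ₑ ^ 2 ≤ L := by
      intro s
      refine (TopologicalSpace.denseRange_denseSeq (Ioo (0 : ℝ) 1)).induction_on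
        (p := fun s => ‖evol a γ F s x‖ₑ ^ 2 ≤ L) s ?_ fun i => ?_
      · refine isClosed_le ?_ continuous_const
        refine (ENNReal.continuous_pow 2).comp (continuous_enorm.comp ?_)
        rw [continuous_iff_continuousAt]
        intro s
        exact (continuousAt_evol ha hγ s.2.1 hFm hF x).comp continuousAt_subtype_val
      · refine Filter.le_liminf_of_le (by isBoundedDefault) ?_
        filter_upwards [Filter.eventually_ge_atTop i] with n hn
        gcongr
        exact h n i hn x
    have : maximal (evol a γ F) x ≤ L ^ (2⁻¹ : ℝ) := by
      refine iSup₂_le fun s hs => ?_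
      rw [ENNReal.le_rpow_inv_iff (by norm_num), ENNReal.rpow_two]
      exact hdn ⟨s, hs⟩
    rwa [ENNReal.le_rpow_inv_iff (by norm_num), ENNReal.rpow_two] at this
  calc ∫⁻ x, maximal (evol a γ F) x ^ 2
      ≤ ∫⁻ x, Filter.liminf (fun n => ‖evol a γ F (t n x) x‖ₑ ^ 2) Filter.atTop :=
        lintegral_mono hpt
    _ ≤ Filter.liminf (fun n => ∫⁻ x, ‖evol a γ F (t n x) x‖ₑ ^ 2) Filter.atTop :=
        lintegral_liminf_le fun n => (measurable_evol a γ hFm (htm n)).enorm.pow_const 2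
    _ ≤ _ := by
        refine Filter.liminf_le_of_le (by isBoundedDefault) fun b hb => ?_
        obtain ⟨n, hn⟩ := hb.exists
        exact hn.trans (lintegral_evol_sq_le ha hγ hσ hΦm hΦn hΦ (hδ n) (htm n) (htδ n) (ht1 n)
          hFm hF)

lemma measurable_fhat (f : Lp ℂ 2 (volume : Measure ℝ)) : Measurable (fhat f) :=
  (((Lp.stronglyMeasurable _).measurable).comp (measurable_id.div_const _)).const_mul _

lemma sobolevNorm_mono {s s' : ℝ} (h : s ≤ s') (f : Lp ℂ 2 (volume : Measure ℝ)) :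
    sobolevNorm s f ≤ sobolevNorm s' f := by
  unfold sobolevNorm
  gcongr with ξ
  nlinarith [sq_nonneg ξ]

lemma eLpNorm_two_eq (u : ℝ → ℝ≥0∞) (μ : Measure ℝ) :
    eLpNorm u 2 μ = (∫⁻ x, u x ^ 2 ∂μ) ^ (1 / 2 : ℝ) := by
  rw [eLpNorm_eq_lintegral_rpow_enorm_toReal (by norm_num) (by norm_num)]
  simp

/-- The global `L²` estimate, given an integrable majorant of the weighted kernels. -/
theorem exists_eLpNorm_maximal_le {a γ s : ℝ} {Φ : ℝ → ℝ≥0∞} (ha : 0 < a) (hγ : 0 < γ)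
    (hs : 0 ≤ s) (hΦm : Measurable Φ) (hΦi : ∫⁻ x, Φ x < ∞) (hΦn : ∀ x, Φ (-x) = Φ x)
    (hΦ : ∀ x τ μ : ℝ, |τ| ≤ 1 → |τ| ^ γ ≤ μ → 0 < μ → μ ≤ 2 →
        ‖∫ ξ, fullOsc a (2 * s) x τ μ ξ‖ₑ ≤ Φ x) :
    ∃ C : ℝ≥0, ∀ f : Lp ℂ 2 (volume : Measure ℝ),
      eLpNorm (maximal (propagator a γ f)) 2 volume ≤ C * sobolevNorm s f := by
  -- The factor `2^s` pays for replacing `(1+|ξ|)^{2s}` by `(1+ξ²)^s`, through `(1+|ξ|)² ≤ 2(1+ξ²)`.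
  set D : ℝ≥0∞ := ((∫⁻ x, Φ x) * ENNReal.ofReal (2 ^ s)) ^ (1 / 2 : ℝ) with hD
  have hDfin : D ≠ ∞ := by
    refine ENNReal.rpow_ne_top_of_nonneg (by norm_num) (ENNReal.mul_ne_top hΦi.ne ?_)
    exact ENNReal.ofReal_ne_top
  refine ⟨D.toNNReal, fun f => ?_⟩
  rw [ENNReal.coe_toNNReal hDfin, eLpNorm_two_eq, sobolevNorm, hD,
    ← ENNReal.mul_rpow_of_nonneg _ _ (by norm_num)]
  refine ENNReal.rpow_le_rpow ?_ (by norm_num)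
  refine (lintegral_maximal_evol_sq_le ha hγ (by positivity) hΦm hΦn hΦ (measurable_fhat f)
    (memLp_two_fhat f)).trans ?_
  rw [mul_assoc]
  gcongr
  rw [← lintegral_const_mul' _ _ ENNReal.ofReal_ne_top]
  refine lintegral_mono fun ξ => ?_
  rw [← mul_assoc, ← ENNReal.ofReal_mul (by positivity)]
  gcongr
  rw [Real.rpow_mul (by positivity), ← Real.mul_rpow (by norm_num) (by positivity), Real.rpow_two]
  refine Real.rpow_le_rpow (by positivity) ?_ hs
  nlinarith [sq_nonneg (1 - |ξ|), sq_abs ξ]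

/-! ### The Hardy–Littlewood maximal function on the line. -/

/-- The centred Hardy–Littlewood maximal function on the line. -/
noncomputable def hlMaximal (F : ℝ → ℝ≥0∞) (x : ℝ) : ℝ≥0∞ :=
  ⨆ (r : ℝ) (_ : 0 < r), (∫⁻ y in Metric.ball x r, F y) / volume (Metric.ball x r)

lemma lintegral_ball_le_hlMaximal (F : ℝ → ℝ≥0∞) (x : ℝ) {r : ℝ} (hr : 0 < r) :
    ∫⁻ y in Metric.ball x r, F y ≤ ENNReal.ofReal (2 * r) * hlMaximal F x := by
  have h0 : ENNReal.ofReal (2 * r) ≠ 0 := by simpa using hr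
  have h : (∫⁻ y in Metric.ball x r, F y) / volume (Metric.ball x r) ≤ hlMaximal F x :=
    le_iSup₂ (f := fun (r : ℝ) (_ : 0 < r) =>
      (∫⁻ y in Metric.ball x r, F y) / volume (Metric.ball x r)) r hr
  rwa [Real.volume_ball, ENNReal.div_le_iff h0 ENNReal.ofReal_ne_top, mul_comm] at h

lemma hlMaximal_mono {F G : ℝ → ℝ≥0∞} (h : F ≤ᵐ[volume] G) (x : ℝ) :
    hlMaximal F x ≤ hlMaximal G x := by
  refine iSup₂_mono fun r _ => ENNReal.div_le_div_right ?_ _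
  exact lintegral_mono_ae (ae_restrict_of_ae h)

lemma hlMaximal_add_const_le {F : ℝ → ℝ≥0∞} (c : ℝ≥0∞) (x : ℝ) :
    hlMaximal (fun y => F y + c) x ≤ hlMaximal F x + c := by
  refine iSup₂_le fun r hr => ?_
  have h0 : volume (Metric.ball x r) ≠ 0 := by
    rw [Real.volume_ball]; simpa using hr
  have h1 : volume (Metric.ball x r) ≠ ∞ := measure_ball_lt_top.ne
  rw [lintegral_add_right _ measurable_const, setLIntegral_const, ENNReal.add_div,
    ENNReal.mul_div_cancel_right h0 h1]
  gcongr
  exact le_iSup₂ (f := fun (r : ℝ) (_ : 0 < r) =>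
    (∫⁻ y in Metric.ball x r, F y) / volume (Metric.ball x r)) r hr

lemma hlMaximal_le_of_ae_le {F : ℝ → ℝ≥0∞} {c : ℝ≥0∞} (h : ∀ᵐ y, F y ≤ c) (x : ℝ) :
    hlMaximal F x ≤ c := by
  refine iSup₂_le fun r hr => ENNReal.div_le_of_le_mul ?_
  refine (lintegral_mono_ae (ae_restrict_of_ae h)).trans ?_
  rw [setLIntegral_const]

/-- The weak type `(1, 1)` inequality for the Hardy–Littlewood maximal function. -/
theorem mul_volume_hlMaximal_gt_le (F : ℝ → ℝ≥0∞) {l : ℝ≥0∞} (hl : l ≠ 0) :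
    l * volume {x | l < hlMaximal F x} ≤ 4 * ∫⁻ y, F y := by
  rcases eq_or_ne (∫⁻ y, F y) ∞ with hF | hF
  · rw [hF]; simp
  set A := {x | l < hlMaximal F x} with hA
  have hr : ∀ x ∈ A, ∃ r : ℝ, 0 < r ∧ l * volume (Metric.ball x r) < ∫⁻ y in Metric.ball x r, F y := by
    intro x hx
    obtain ⟨r, hr⟩ := lt_iSup_iff.1 (show l < hlMaximal F x from hx)
    obtain ⟨hr0, hr⟩ := lt_iSup_iff.1 hr
    exact ⟨r, hr0, ENNReal.mul_lt_of_lt_div hr⟩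
  choose! r hr0 hr1 using hr
  have hle : ∀ x ∈ A, l * ENNReal.ofReal (2 * r x) ≤ ∫⁻ y, F y := by
    intro x hx
    rw [← Real.volume_ball x]
    exact (hr1 x hx).le.trans (setLIntegral_le_lintegral _ _)
  -- Finite total mass bounds the selected radii, as the Vitali covering lemma requires. Its
  -- enlargement factor, here `4`, becomes the weak type constant.
  have hR : ∀ x ∈ A, r x ≤ ((∫⁻ y, F y) / l).toReal := by
    intro x hx
    have h1 : ENNReal.ofReal (r x) ≤ (∫⁻ y, F y) / l := by
      have hlt : l ≠ ∞ := (lt_of_lt_of_le (show l < hlMaximal F x from hx) le_top).ne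
      rw [ENNReal.le_div_iff_mul_le (Or.inl hl) (Or.inl hlt), mul_comm]
      refine le_trans ?_ (hle x hx)
      gcongr
      linarith [hr0 x hx]
    exact (ENNReal.ofReal_le_iff_le_toReal (ENNReal.div_ne_top hF hl)).1 h1
  obtain ⟨u, huA, hud, hu⟩ := Vitali.exists_disjoint_subfamily_covering_enlargement_ball A
    (fun x => x) r _ hR 4 (by norm_num)
  have huc : u.Countable := hud.countable_of_isOpen (fun _ _ => Metric.isOpen_ball)
    fun x hx => Metric.nonempty_ball.2 (hr0 x (huA hx))
  have hcov : A ⊆ ⋃ b ∈ u, Metric.ball b (4 * r b) := by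
    intro x hx
    obtain ⟨b, hb, hbx⟩ := hu x hx
    exact mem_iUnion₂.2 ⟨b, hb, hbx (Metric.mem_ball_self (hr0 x hx))⟩
  have : Countable u := huc.to_subtype
  calc l * volume A ≤ l * ∑' b : u, volume (Metric.ball (b : ℝ) (4 * r b)) := by
        gcongr
        exact (measure_mono hcov).trans (measure_biUnion_le _ huc _)
    _ = 4 * ∑' b : u, l * volume (Metric.ball (b : ℝ) (r b)) := by
        rw [← ENNReal.tsum_mul_left, ← ENNReal.tsum_mul_left]
        congr 1 with b
        rw [Real.volume_ball, Real.volume_ball, show 2 * (4 * r b) = 4 * (2 * r b) by ring,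
          ENNReal.ofReal_mul (by norm_num), ENNReal.ofReal_ofNat]
        ring
    _ ≤ 4 * ∑' b : u, ∫⁻ y in Metric.ball (b : ℝ) (r b), F y := by
        gcongr with b
        exact (hr1 b (huA b.2)).le
    _ = 4 * ∫⁻ y in ⋃ b ∈ u, Metric.ball (b : ℝ) (r b), F y := by
        rw [lintegral_biUnion huc (fun _ _ => measurableSet_ball) hud]
    _ ≤ _ := by
        gcongr
        exact Measure.restrict_le_self

/-- The part of `ψ` below `l/2` raises the maximal function by at most `l/2`, so only the part above
`l/2` must exceed that level. Applying the weak bound at level `l/2` gives `8 = 2 · 4`. -/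
lemma volume_hlMaximal_gt_le (ψ : ℝ → ℝ≥0) {l : ℝ} (hl : 0 < l) :
    volume {x | ENNReal.ofReal l < hlMaximal (fun y => (ψ y : ℝ≥0∞)) x} ≤
      ENNReal.ofReal (8 / l) * ∫⁻ y in {y | l < 2 * (ψ y : ℝ)}, (ψ y : ℝ≥0∞) := by
  classical
  set A : Set ℝ := {y | l < 2 * (ψ y : ℝ)} with hA
  set G : ℝ → ℝ≥0∞ := A.indicator fun y => (ψ y : ℝ≥0∞) with hG
  have hl2 : ENNReal.ofReal (l / 2) ≠ 0 := by simpa using hl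
  have hle : ∀ y, (ψ y : ℝ≥0∞) ≤ G y + ENNReal.ofReal (l / 2) := by
    intro y
    by_cases hy : y ∈ A
    · rw [hG, indicator_of_mem hy]; exact le_self_add
    · rw [hG, indicator_of_notMem hy, zero_add, ← ENNReal.ofReal_coe_nnreal]
      refine ENNReal.ofReal_le_ofReal ?_
      have : 2 * (ψ y : ℝ) ≤ l := not_lt.1 hy
      linarith
  have hsub : {x | ENNReal.ofReal l < hlMaximal (fun y => (ψ y : ℝ≥0∞)) x} ⊆
      {x | ENNReal.ofReal (l / 2) < hlMaximal G x} := by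
    intro x hx
    have h1 : hlMaximal (fun y => (ψ y : ℝ≥0∞)) x ≤ hlMaximal G x + ENNReal.ofReal (l / 2) :=
      (hlMaximal_mono (ae_of_all _ hle) x).trans (hlMaximal_add_const_le _ x)
    by_contra hcon
    have h2 : hlMaximal G x ≤ ENNReal.ofReal (l / 2) := not_lt.1 hcon
    have h3 : ENNReal.ofReal l = ENNReal.ofReal (l / 2) + ENNReal.ofReal (l / 2) := by
      rw [← ENNReal.ofReal_add (by positivity) (by positivity), add_halves]
    have h4 : ENNReal.ofReal l < _ := hx
    rw [h3] at h4
    exact absurd h4 (not_lt.2 (h1.trans (by gcongr)))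
  have hind : ∫⁻ y, G y ≤ ∫⁻ y in A, (ψ y : ℝ≥0∞) := lintegral_indicator_le _ _
  have hw := mul_volume_hlMaximal_gt_le G hl2
  refine (measure_mono hsub).trans ?_
  have e : ENNReal.ofReal (8 / l) = ENNReal.ofReal (2 / l) * 4 := by
    rw [← ENNReal.ofReal_ofNat, ← ENNReal.ofReal_mul (by positivity)]; congr 1; ring
  have e2 : ENNReal.ofReal (2 / l) * ENNReal.ofReal (l / 2) = 1 := by
    rw [← ENNReal.ofReal_mul (by positivity), ← ENNReal.ofReal_one]
    congr 1
    field_simp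
  calc volume {x | ENNReal.ofReal (l / 2) < hlMaximal G x}
      = ENNReal.ofReal (2 / l) * (ENNReal.ofReal (l / 2) *
        volume {x | ENNReal.ofReal (l / 2) < hlMaximal G x}) := by
        rw [← mul_assoc, e2, one_mul]
    _ ≤ ENNReal.ofReal (2 / l) * (4 * ∫⁻ y in A, (ψ y : ℝ≥0∞)) := by
        exact mul_le_mul_right (hw.trans (mul_le_mul_right hind _)) _
    _ = _ := by rw [e, mul_assoc]

lemma lintegral_Ioo_rpow {p c : ℝ} (hp : 1 < p) (hc : 0 ≤ c) :
    ∫⁻ l in Ioo 0 c, ENNReal.ofReal (l ^ (p - 2)) = ENNReal.ofReal (c ^ (p - 1) / (p - 1)) := by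
  have hi : IntegrableOn (fun l : ℝ => l ^ (p - 2)) (Ioc 0 c) :=
    (intervalIntegrable_iff_integrableOn_Ioc_of_le hc).1
      (intervalIntegral.intervalIntegrable_rpow' (by linarith))
  have e := integral_rpow (a := 0) (b := c) (r := p - 2) (Or.inl (by linarith))
  rw [intervalIntegral.integral_of_le hc, Real.zero_rpow (by linarith), sub_zero,
    show p - 2 + 1 = p - 1 by ring] at e
  rw [setLIntegral_congr Ioo_ae_eq_Ioc, ← ofReal_integral_eq_lintegral_ofReal hi, e]
  filter_upwards [ae_restrict_mem measurableSet_Ioc] with l hl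
  exact Real.rpow_nonneg hl.1.le _

/-- The strong type `(p, p)` inequality for measurable functions that are dominated by the
Hardy–Littlewood maximal function. -/
theorem lintegral_rpow_le_of_le_hlMaximal {p : ℝ} (hp : 1 < p) {ψ : ℝ → ℝ≥0}
    (hψ : Measurable ψ) {G : ℝ → ℝ≥0∞} (hG : Measurable G)
    (hle : ∀ x, G x ≤ hlMaximal (fun y => (ψ y : ℝ≥0∞)) x) :
    ∫⁻ x, G x ^ p ≤ ENNReal.ofReal (p * (8 * (2 ^ (p - 1) / (p - 1)))) *
      ∫⁻ y, (ψ y : ℝ≥0∞) ^ p := by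
  have hp0 : 0 < p := by linarith
  have hp1 : 0 < p - 1 := by linarith
  -- Exchanging the integrals over levels and points: for fixed `y` the levels run over `l < 2ψ(y)`,
  -- and integrating `l^{p-2}` there, convergent since `p > 1`, gives the power of `ψ`.
  have hR : ∫⁻ l in Ioi (0 : ℝ), (ENNReal.ofReal (8 / l) * ∫⁻ y in {y | l < 2 * (ψ y : ℝ)},
      (ψ y : ℝ≥0∞)) * ENNReal.ofReal (l ^ (p - 1)) =
      ENNReal.ofReal (8 * (2 ^ (p - 1) / (p - 1))) * ∫⁻ y, (ψ y : ℝ≥0∞) ^ p := by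
    have hset : MeasurableSet {q : ℝ × ℝ | q.1 < 2 * (ψ q.2 : ℝ)} :=
      measurableSet_lt measurable_fst (by fun_prop)
    have hm : Measurable ({q : ℝ × ℝ | q.1 < 2 * (ψ q.2 : ℝ)}.indicator
        fun q => ENNReal.ofReal (8 * q.1 ^ (p - 2)) * (ψ q.2 : ℝ≥0∞)) :=
      Measurable.indicator (by fun_prop) hset
    calc _ = ∫⁻ l in Ioi (0 : ℝ), ∫⁻ y, {q : ℝ × ℝ | q.1 < 2 * (ψ q.2 : ℝ)}.indicator
          (fun q => ENNReal.ofReal (8 * q.1 ^ (p - 2)) * (ψ q.2 : ℝ≥0∞)) (l, y) := by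
          refine setLIntegral_congr_fun measurableSet_Ioi fun l hl => ?_
          have hl : (0 : ℝ) < l := hl
          have hA : MeasurableSet {y | l < 2 * (ψ y : ℝ)} :=
            measurableSet_lt measurable_const (by fun_prop)
          have e : ∀ y, {q : ℝ × ℝ | q.1 < 2 * (ψ q.2 : ℝ)}.indicator
              (fun q => ENNReal.ofReal (8 * q.1 ^ (p - 2)) * (ψ q.2 : ℝ≥0∞)) (l, y) =
              {y | l < 2 * (ψ y : ℝ)}.indicator
                (fun y => ENNReal.ofReal (8 * l ^ (p - 2)) * (ψ y : ℝ≥0∞)) y := fun y => rfl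
          simp only [e]
          rw [lintegral_indicator hA, lintegral_const_mul _ (by fun_prop), mul_right_comm,
            ← ENNReal.ofReal_mul (by positivity)]
          congr 2
          rw [show p - 1 = p - 2 + 1 by ring, Real.rpow_add_one hl.ne']
          field_simp
      _ = ∫⁻ y, ∫⁻ l in Ioi (0 : ℝ), {q : ℝ × ℝ | q.1 < 2 * (ψ q.2 : ℝ)}.indicator
          (fun q => ENNReal.ofReal (8 * q.1 ^ (p - 2)) * (ψ q.2 : ℝ≥0∞)) (l, y) :=
          lintegral_lintegral_swap hm.aemeasurable
      _ = ∫⁻ y, ENNReal.ofReal (8 * (2 ^ (p - 1) / (p - 1))) * (ψ y : ℝ≥0∞) ^ p := by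
          refine lintegral_congr fun y => ?_
          have e : ∀ l, {q : ℝ × ℝ | q.1 < 2 * (ψ q.2 : ℝ)}.indicator
              (fun q => ENNReal.ofReal (8 * q.1 ^ (p - 2)) * (ψ q.2 : ℝ≥0∞)) (l, y) =
              (Iio (2 * (ψ y : ℝ))).indicator
                (fun l => ENNReal.ofReal (8 * l ^ (p - 2)) * (ψ y : ℝ≥0∞)) l := fun l => rfl
          simp only [e]
          rw [setLIntegral_indicator measurableSet_Iio, inter_comm, Ioi_inter_Iio,
            lintegral_mul_const _ (by fun_prop)]
          simp only [ENNReal.ofReal_mul (by norm_num : (0 : ℝ) ≤ 8)]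
          rw [lintegral_const_mul _ (by fun_prop), lintegral_Ioo_rpow hp (by positivity),
            Real.mul_rpow (by norm_num) (by positivity), mul_div_right_comm,
            ENNReal.ofReal_mul (by positivity), mul_assoc, mul_assoc, mul_assoc]
          congr 2
          rw [← ENNReal.ofReal_rpow_of_nonneg (by positivity) hp1.le, ENNReal.ofReal_coe_nnreal]
          conv_rhs => rw [show p = p - 1 + 1 by ring,
            ENNReal.rpow_add_of_nonneg _ _ hp1.le zero_le_one, ENNReal.rpow_one]
      _ = _ := lintegral_const_mul _ (by fun_prop)
  -- The layer-cake formula is applied to real-valued functions, so `G` is truncated at `N`; Fatou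
  -- removes the truncation.
  have hN : ∀ N : ℕ, ∫⁻ x, (min (G x) N) ^ p ≤ ENNReal.ofReal (p * (8 * (2 ^ (p - 1) / (p - 1)))) *
      ∫⁻ y, (ψ y : ℝ≥0∞) ^ p := by
    intro N
    have hfin : ∀ x, min (G x) N ≠ ∞ := fun x =>
      (lt_of_le_of_lt (min_le_right _ _) (ENNReal.natCast_lt_top N)).ne
    have e1 : ∀ x, (min (G x) N) ^ p = ENNReal.ofReal ((min (G x) N).toReal ^ p) := by
      intro x
      rw [← ENNReal.ofReal_rpow_of_nonneg ENNReal.toReal_nonneg hp0.le,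
        ENNReal.ofReal_toReal (hfin x)]
    simp only [e1]
    rw [lintegral_rpow_eq_lintegral_meas_lt_mul volume (ae_of_all _ fun x => ENNReal.toReal_nonneg)
      (hG.min measurable_const).ennreal_toReal.aemeasurable hp0,
      ENNReal.ofReal_mul hp0.le, mul_assoc, ← hR]
    refine mul_le_mul_right (setLIntegral_mono' measurableSet_Ioi fun l hl => ?_) _
    refine mul_le_mul_left ?_ _
    refine le_trans (measure_mono fun x hx => ?_) (volume_hlMaximal_gt_le ψ hl)
    have h1 : ENNReal.ofReal l < min (G x) N :=
      (ENNReal.ofReal_lt_iff_lt_toReal (le_of_lt hl) (hfin x)).2 hx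
    exact (h1.trans_le (min_le_left _ _)).trans_le (hle x)
  have hlim : ∀ x, G x ^ p = Filter.liminf (fun N : ℕ => (min (G x) N) ^ p) Filter.atTop := by
    intro x
    have h1 : Filter.Tendsto (fun N : ℕ => min (G x) (N : ℝ≥0∞)) Filter.atTop
        (nhds (min (G x) ∞)) := tendsto_const_nhds.min ENNReal.tendsto_nat_nhds_top
    rw [min_eq_left le_top] at h1
    exact (h1.ennrpow_const p).liminf_eq.symm
  simp only [hlim]
  refine (lintegral_liminf_le fun N => (hG.min measurable_const).pow_const p).trans ?_
  refine Filter.liminf_le_of_le (by isBoundedDefault) fun b hb => ?_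
  obtain ⟨n, hn⟩ := hb.exists
  exact hn.trans (hN n)

/-! ### The range `γ ≤ 1`: domination by the maximal function. -/

/-- Convolution with a kernel that is dominated by a dilated radially decreasing integrable
function is dominated by the Hardy–Littlewood maximal function, uniformly in the dilation. -/
theorem exists_lintegral_conv_le_hlMaximal {a C : ℝ} (ha : 0 < a) (hC : 0 ≤ C) :
    ∃ A : ℝ≥0, ∀ (r : ℝ) (K : ℝ → ℂ), 0 < r →
      (∀ z, ‖K z‖ ≤ C * r⁻¹ * (max 1 (|z| / r)) ^ (-1 - a)) → ∀ (F : ℝ → ℝ≥0∞) (x : ℝ),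
        AEMeasurable F → ∫⁻ y, ‖K (x - y)‖ₑ * F y ≤ A * hlMaximal F x := by
  set q : ℝ := 2 ^ (-a) with hq
  have hq0 : 0 < q := by positivity
  have hq1 : q < 1 := Real.rpow_lt_one_of_one_lt_of_neg (by norm_num) (by linarith)
  set B : ℝ := C * 2 ^ (1 + a) * 2 with hB
  have hB0 : 0 ≤ B := by positivity
  set S : ℝ := ∑' k : ℕ, B * q ^ k with hS
  have hsum : Summable fun k : ℕ => B * q ^ k :=
    (summable_geometric_of_lt_one hq0.le hq1).mul_left B
  refine ⟨S.toNNReal, fun r K hr hK F x hF => ?_⟩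
  set c : ℕ → ℝ := fun k => C * r⁻¹ * (2 ^ (1 + a) * ((2 : ℝ) ^ k) ^ (-1 - a)) with hc
  have hc0 : ∀ k, 0 ≤ c k := fun k => by positivity
  -- The kernel is dominated by a sum of multiples of indicators of dyadic balls. Multiplying the
  -- coefficient `c k` by the measure of its ball leaves `B q^k` with `q = 2^{-a} < 1`, independent
  -- of the dilation `r`.
  have hpt : ∀ y, ‖K (x - y)‖ₑ ≤
      ∑' k : ℕ, (Metric.ball x (2 ^ k * r)).indicator (fun _ => ENNReal.ofReal (c k)) y := by
    intro y
    set m : ℝ := max 1 (|x - y| / r) with hm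
    obtain ⟨n, hn1, hn2⟩ := exists_nat_pow_near (le_max_left _ _ : (1 : ℝ) ≤ m) one_lt_two
    have hm0 : 0 < m := by positivity
    have hy : y ∈ Metric.ball x (2 ^ (n + 1) * r) := by
      rw [Metric.mem_ball, dist_comm, Real.dist_eq, ← div_lt_iff₀ hr]
      exact (le_max_right _ _).trans_lt hn2
    refine le_trans ?_ (ENNReal.le_tsum (n + 1))
    rw [indicator_of_mem hy, ← ofReal_norm]
    refine ENNReal.ofReal_le_ofReal ((hK _).trans ?_)
    rw [hc]
    refine mul_le_mul_of_nonneg_left ?_ (by positivity)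
    have e : (2 : ℝ) ^ (1 + a) * ((2 : ℝ) ^ (n + 1)) ^ (-1 - a) = ((2 : ℝ) ^ n) ^ (-1 - a) := by
      rw [pow_succ, Real.mul_rpow (by positivity) (by norm_num), mul_left_comm,
        ← Real.rpow_add (by norm_num)]
      simp
    rw [e]
    exact Real.rpow_le_rpow_of_nonpos (by positivity) hn1 (by linarith)
  calc ∫⁻ y, ‖K (x - y)‖ₑ * F y
      ≤ ∫⁻ y, ∑' k : ℕ, (Metric.ball x (2 ^ k * r)).indicator
          (fun y => ENNReal.ofReal (c k) * F y) y := by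
        refine lintegral_mono fun y => ?_
        refine (mul_le_mul_left (hpt y) _).trans (le_of_eq ?_)
        rw [← ENNReal.tsum_mul_right]
        congr 1 with k
        by_cases hy : y ∈ Metric.ball x (2 ^ k * r)
        · simp only [indicator_of_mem hy]
        · simp only [indicator_of_notMem hy, zero_mul]
    _ = ∑' k : ℕ, ENNReal.ofReal (c k) * ∫⁻ y in Metric.ball x (2 ^ k * r), F y := by
        rw [lintegral_tsum fun k => (hF.const_mul _).indicator measurableSet_ball]
        congr 1 with k
        rw [lintegral_indicator measurableSet_ball, lintegral_const_mul'' _ hF.restrict]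
    _ ≤ ∑' k : ℕ, ENNReal.ofReal (B * q ^ k) * hlMaximal F x := by
        refine ENNReal.tsum_le_tsum fun k => ?_
        refine (mul_le_mul_right (lintegral_ball_le_hlMaximal F x
          (by positivity : 0 < 2 ^ k * r)) _).trans (le_of_eq ?_)
        rw [← mul_assoc, ← ENNReal.ofReal_mul (hc0 k)]
        congr 2
        have e : ((2 : ℝ) ^ k) ^ (-1 - a) * 2 ^ k = q ^ k := by
          rw [← Real.rpow_add_one (by positivity), show -1 - a + 1 = -a by ring, hq,
            ← Real.rpow_natCast, ← Real.rpow_natCast, ← Real.rpow_mul (by norm_num),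
            ← Real.rpow_mul (by norm_num), mul_comm]
        rw [← e, hc, hB]
        field_simp
    _ = ENNReal.ofReal S * hlMaximal F x := by
        rw [ENNReal.tsum_mul_right, hS, ENNReal.ofReal_tsum_of_nonneg (fun k => by positivity) hsum]
    _ = _ := rfl

lemma norm_integral_fullOsc_zero_le (a x τ : ℝ) (ha : 0 < a) :
    ‖∫ ξ, fullOsc a 0 x τ 1 ξ‖ ≤ ∫ ξ, Real.exp (-1 * |ξ| ^ a) := by
  refine norm_integral_le_of_norm_le (integrable_exp_neg_mul_abs_rpow ha one_pos)
    (ae_of_all _ fun ξ => le_of_eq ?_)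
  rw [fullOsc, norm_mul, norm_mul, norm_exp_I, Complex.norm_exp, Complex.re_mul_ofReal]
  simp

/-- For `|x| ≥ 2` this is the decay from the cancelled boundary terms. For smaller `|x|` the damping
alone bounds the integral, and `2^{1+a}` compensates the smallest value of the profile. -/
lemma exists_norm_integral_fullOsc_zero_le {a : ℝ} (ha : 0 < a) (ha1 : a ≤ 1) :
    ∃ C : ℝ, 0 ≤ C ∧ ∀ x τ : ℝ, |τ| ≤ 1 →
      ‖∫ ξ, fullOsc a 0 x τ 1 ξ‖ ≤ C * max 1 |x| ^ (-1 - a) := by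
  obtain ⟨C, hC, h⟩ := exists_norm_integral_fullOsc_le ha ha1 le_rfl
  set J := ∫ ξ : ℝ, Real.exp (-1 * |ξ| ^ a) with hJ
  have hJ0 : 0 ≤ J := integral_nonneg fun ξ => (Real.exp_pos _).le
  refine ⟨C + J * 2 ^ (1 + a), by positivity, fun x τ hτ => ?_⟩
  have hm : 0 ≤ max 1 |x| ^ (-1 - a) := by positivity
  rw [add_mul]
  rcases le_or_gt 2 |x| with hx | hx
  · have h1 := h x τ 1 hx hτ one_pos one_le_two
    rw [max_eq_right (by linarith)] at hm ⊢
    have : 0 ≤ J * 2 ^ (1 + a) * |x| ^ (-1 - a) := by positivity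
    linarith
  · have h1 := norm_integral_fullOsc_zero_le a x τ ha
    have h2 : (2 : ℝ) ^ (-1 - a) ≤ max 1 |x| ^ (-1 - a) :=
      Real.rpow_le_rpow_of_nonpos (by positivity) (max_le one_le_two hx.le) (by linarith)
    have h3 : (1 : ℝ) = 2 ^ (1 + a) * 2 ^ (-1 - a) := by
      rw [← Real.rpow_add (by norm_num)]; simp
    have h4 : J ≤ J * 2 ^ (1 + a) * max 1 |x| ^ (-1 - a) := by
      calc J = J * (2 ^ (1 + a) * 2 ^ (-1 - a)) := by rw [← h3, mul_one]
        _ ≤ J * (2 ^ (1 + a) * max 1 |x| ^ (-1 - a)) := by gcongr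
        _ = _ := by ring
    have : 0 ≤ C * max 1 |x| ^ (-1 - a) := by positivity
    linarith

/-- Substitute `ξ ↦ rξ` with `r^a = t^γ`: the damping coefficient becomes `1` and the phase
coefficient `t^{1-γ}`, which stays bounded by `1` for `0 < t < 1` precisely when `γ ≤ 1`. -/
lemma kernel_eq {a γ t : ℝ} (ha : 0 < a) (ht : 0 < t) (x : ℝ) :
    kernel a γ t x = ((2 * Real.pi : ℝ) : ℂ)⁻¹ * (((t ^ (γ / a))⁻¹ : ℝ) : ℂ) *
      ∫ ξ, fullOsc a 0 (x / t ^ (γ / a)) (t ^ (1 - γ)) 1 ξ := by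
  set r : ℝ := t ^ (γ / a) with hr
  have hr0 : 0 < r := by positivity
  have hra : r ^ a = t ^ γ := by
    rw [hr, ← Real.rpow_mul ht.le, div_mul_cancel₀ _ ha.ne']
  have htt : t ^ (1 - γ) * t ^ γ = t := by
    rw [← Real.rpow_add ht, sub_add_cancel, Real.rpow_one]
  have e := Measure.integral_comp_mul_left (fullOsc a 0 (x / r) (t ^ (1 - γ)) 1) r
  rw [abs_of_pos (inv_pos.2 hr0), Complex.real_smul] at e
  rw [kernel, mul_assoc, ← e]
  congr 2 with ξ
  rw [fullOsc, symbol, mul_comm, abs_mul, abs_of_pos hr0, Real.mul_rpow hr0.le (abs_nonneg ξ), hra]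
  have hrc : (r : ℂ) ≠ 0 := by exact_mod_cast hr0.ne'
  have htc : ((t ^ (1 - γ) : ℝ) : ℂ) * ((t ^ γ : ℝ) : ℂ) = t := by
    rw [← Complex.ofReal_mul, htt]
  simp only [neg_zero, Real.rpow_zero, Complex.ofReal_one, mul_one]
  congr 2
  · push_cast
    field_simp
  · rw [Complex.ofReal_mul, ← htc]
    ring

/-- The kernels are dominated by dilates of a fixed integrable function. -/
lemma exists_norm_kernel_le {a γ : ℝ} (ha : 0 < a) (ha1 : a ≤ 1) (hγ1 : γ ≤ 1) :
    ∃ C : ℝ, 0 ≤ C ∧ ∀ t ∈ Ioo (0 : ℝ) 1, ∀ x, ‖kernel a γ t x‖ ≤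
      C * (t ^ (γ / a))⁻¹ * max 1 (|x| / t ^ (γ / a)) ^ (-1 - a) := by
  obtain ⟨C, hC, h⟩ := exists_norm_integral_fullOsc_zero_le ha ha1
  refine ⟨(2 * Real.pi)⁻¹ * C, by positivity, fun t ht x => ?_⟩
  have hr0 : 0 < t ^ (γ / a) := Real.rpow_pos_of_pos ht.1 _
  have hτ : |t ^ (1 - γ)| ≤ 1 := by
    rw [abs_of_nonneg (Real.rpow_nonneg ht.1.le _)]
    exact Real.rpow_le_one ht.1.le ht.2.le (by linarith)
  have h1 := h (x / t ^ (γ / a)) _ hτ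
  rw [abs_div, abs_of_pos hr0] at h1
  rw [kernel_eq ha ht.1, norm_mul, norm_mul, norm_inv, Complex.norm_real, Complex.norm_real,
    Real.norm_of_nonneg (by positivity), Real.norm_of_nonneg (by positivity)]
  calc _ ≤ (2 * Real.pi)⁻¹ * (t ^ (γ / a))⁻¹ *
        (C * max 1 (|x| / t ^ (γ / a)) ^ (-1 - a)) := by gcongr
    _ = _ := by ring

lemma continuous_kernel {a γ t : ℝ} (ha : 0 < a) (ht : 0 < t) : Continuous (kernel a γ t) := by
  refine continuous_const.mul (continuous_of_dominated (fun x => ?_)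
    (fun x => ae_of_all _ fun ξ => ?_) (integrable_symbol (γ := γ) ha ht).norm
    (ae_of_all _ fun ξ => by fun_prop))
  · exact ((measurable_symbol a γ t).mul (by fun_prop)).aestronglyMeasurable
  · rw [norm_mul, norm_exp_I, mul_one]

/-- Here `t` is fixed and the constant may depend on it. Separating `x` from `y` gives a weight in
`y` that dominates the convolution locally uniformly in `x`, for both convergence and continuity. -/
lemma exists_norm_kernel_sub_le {a γ t : ℝ} (ha : 0 < a) (ha1 : a ≤ 1) (hγ1 : γ ≤ 1)
    (ht : t ∈ Ioo (0 : ℝ) 1) : ∃ C : ℝ, 0 ≤ C ∧ ∀ x y, ‖kernel a γ t (x - y)‖ ≤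
      C * (1 + |x|) ^ (1 + a) * (1 + |y|) ^ (-(1 + a)) := by
  obtain ⟨C, hC, h⟩ := exists_norm_kernel_le ha ha1 hγ1
  set r := t ^ (γ / a) with hr
  have hr0 : 0 < r := Real.rpow_pos_of_pos ht.1 _
  refine ⟨C * r⁻¹ * (1 + r) ^ (1 + a), by positivity, fun x y => ?_⟩
  refine (h t ht (x - y)).trans ?_
  suffices key : max 1 (|x - y| / r) ^ (-1 - a) ≤
      (1 + r) ^ (1 + a) * (1 + |x|) ^ (1 + a) * (1 + |y|) ^ (-(1 + a)) by
    calc _ ≤ C * r⁻¹ * ((1 + r) ^ (1 + a) * (1 + |x|) ^ (1 + a) * (1 + |y|) ^ (-(1 + a))) := by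
          gcongr
      _ = _ := by ring
  have h1 : 1 + |x - y| ≤ (1 + r) * max 1 (|x - y| / r) := by
    have h2 : |x - y| = r * (|x - y| / r) := by field_simp
    have h3 := le_max_left 1 (|x - y| / r)
    have h4 := le_max_right 1 (|x - y| / r)
    nlinarith
  have h2 : 1 + |y| ≤ (1 + |x|) * (1 + |x - y|) := by
    have : |y| ≤ |x| + |x - y| := by
      calc |y| = |x - (x - y)| := by rw [sub_sub_cancel]
        _ ≤ _ := abs_sub _ _
    nlinarith [abs_nonneg x, abs_nonneg (x - y), mul_nonneg (abs_nonneg x) (abs_nonneg (x - y))]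
  have h3 : 1 + |y| ≤ (1 + r) * ((1 + |x|) * max 1 (|x - y| / r)) := by
    refine h2.trans ?_
    have := mul_le_mul_of_nonneg_left h1 (by positivity : (0 : ℝ) ≤ 1 + |x|)
    linarith
  have h4 := Real.rpow_le_rpow (z := 1 + a) (by positivity) h3 (by linarith)
  rw [Real.mul_rpow (by positivity) (by positivity), Real.mul_rpow (by positivity)
    (by positivity)] at h4
  have hm : 0 < max 1 (|x - y| / r) := by positivity
  have hm' : 0 < max 1 (|x - y| / r) ^ (1 + a) := by positivity
  have hy' : 0 < (1 + |y|) ^ (1 + a) := by positivity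
  rw [show -1 - a = -(1 + a) by ring, Real.rpow_neg hm.le, Real.rpow_neg (by positivity),
    inv_eq_one_div, div_le_iff₀ hm', mul_right_comm, ← div_eq_mul_inv,
    le_div_iff₀ hy', one_mul]
  linarith

lemma integrable_weight_mul {a : ℝ} (ha : 0 < a) {p : ℝ≥0∞} (hp : 1 ≤ p) {f : ℝ → ℂ}
    (hf : MemLp f p volume) : Integrable (fun y => (1 + |y|) ^ (-(1 + a)) * ‖f y‖) := by
  have hw : Integrable (fun y : ℝ => (1 + |y|) ^ (-(1 + a))) := by
    have := integrable_one_add_norm (E := ℝ) (μ := volume) (r := 1 + a) (by simpa using ha)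
    simpa using this
  have hw0 : ∀ y : ℝ, 0 ≤ (1 + |y|) ^ (-(1 + a)) := fun y => by positivity
  have hw1 : ∀ y : ℝ, (1 + |y|) ^ (-(1 + a)) ≤ 1 := fun y =>
    Real.rpow_le_one_of_one_le_of_nonpos (by linarith [abs_nonneg y]) (by linarith)
  rcases eq_or_ne p ∞ with rfl | hpt
  · refine hw.mul_bdd (c := (eLpNorm f ∞ volume).toReal) hf.1.norm ?_
    have hb := ae_le_eLpNormEssSup (f := f) (μ := volume)
    rw [← eLpNorm_exponent_top] at hb
    filter_upwards [hb] with y hy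
    rw [norm_norm, ← toReal_enorm]
    exact ENNReal.toReal_mono hf.2.ne hy
  · have hp0 : p ≠ 0 := (zero_lt_one.trans_le hp).ne'
    have hi := hf.integrable_norm_rpow hp0 hpt
    have hp1 : 1 ≤ p.toReal := by
      have := ENNReal.toReal_mono hpt hp
      simpa using this
    refine (hw.add hi).mono' (hw.1.mul hf.1.norm) (ae_of_all _ fun y => ?_)
    rw [Real.norm_of_nonneg (mul_nonneg (hw0 y) (norm_nonneg _)), Pi.add_apply]
    -- In place of Hölder: with `0 ≤ w ≤ 1` and `w` integrable, `w|f| ≤ w + |f|^p`.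
    rcases le_total ‖f y‖ 1 with h1 | h1
    · have := mul_le_of_le_one_right (hw0 y) h1
      have h2 : 0 ≤ ‖f y‖ ^ p.toReal := by positivity
      linarith
    · have := mul_le_of_le_one_left (norm_nonneg (f y)) (hw1 y)
      have h2 : ‖f y‖ ≤ ‖f y‖ ^ p.toReal := by
        calc ‖f y‖ = ‖f y‖ ^ (1 : ℝ) := (Real.rpow_one _).symm
          _ ≤ _ := Real.rpow_le_rpow_of_exponent_le h1 hp1
      linarith [hw0 y]

lemma integrable_kernel_mul {a γ t : ℝ} (ha : 0 < a) (ha1 : a ≤ 1) (hγ1 : γ ≤ 1)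
    (ht : t ∈ Ioo (0 : ℝ) 1) {p : ℝ≥0∞} (hp : 1 ≤ p) {f : ℝ → ℂ} (hf : MemLp f p volume) (x : ℝ) :
    Integrable (fun y : ℝ => kernel a γ t (x - y) * f y) := by
  obtain ⟨C, hC, h⟩ := exists_norm_kernel_sub_le ha ha1 hγ1 ht
  refine ((integrable_weight_mul ha hp hf).const_mul (C * (1 + |x|) ^ (1 + a))).mono'
    (((continuous_kernel ha ht.1).comp (continuous_sub_left x)).aestronglyMeasurable.mul hf.1)
    (ae_of_all _ fun y => ?_)
  rw [norm_mul, ← mul_assoc]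
  exact mul_le_mul_of_nonneg_right (h x y) (norm_nonneg _)

lemma continuous_convPropagator {a γ t : ℝ} (ha : 0 < a) (ha1 : a ≤ 1) (hγ1 : γ ≤ 1)
    (ht : t ∈ Ioo (0 : ℝ) 1) {p : ℝ≥0∞} (hp : 1 ≤ p) {f : ℝ → ℂ} (hf : MemLp f p volume) :
    Continuous (convPropagator a γ f t) := by
  obtain ⟨C, hC, h⟩ := exists_norm_kernel_sub_le ha ha1 hγ1 ht
  rw [continuous_iff_continuousAt]
  intro x₀
  refine continuousAt_of_dominated
    (Filter.Eventually.of_forall fun x => (integrable_kernel_mul ha ha1 hγ1 ht hp hf x).1) ?_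
    ((integrable_weight_mul ha hp hf).const_mul (C * (2 + |x₀|) ^ (1 + a)))
    (ae_of_all _ fun y => ?_)
  · filter_upwards [Metric.ball_mem_nhds x₀ one_pos] with x hx
    refine ae_of_all _ fun y => ?_
    rw [norm_mul, ← mul_assoc]
    refine mul_le_mul_of_nonneg_right ((h x y).trans ?_) (norm_nonneg _)
    have hx' : |x| ≤ 1 + |x₀| := by
      rw [Metric.mem_ball, Real.dist_eq] at hx
      have := abs_sub_abs_le_abs_sub x x₀
      linarith
    have : 0 ≤ 1 + a := by linarith
    have h2 : (1 + |x|) ^ (1 + a) ≤ (2 + |x₀|) ^ (1 + a) :=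
      Real.rpow_le_rpow (by positivity) (by linarith) this
    gcongr
  · exact (((continuous_kernel ha ht.1).comp (continuous_sub_right y)).mul
      continuous_const).continuousAt

lemma measurable_maximal_convPropagator {a γ : ℝ} (ha : 0 < a) (ha1 : a ≤ 1) (hγ1 : γ ≤ 1)
    {p : ℝ≥0∞} (hp : 1 ≤ p) {f : ℝ → ℂ} (hf : MemLp f p volume) :
    Measurable (maximal (convPropagator a γ f)) :=
  LowerSemicontinuous.measurable (lowerSemicontinuous_iSup fun _ =>
    lowerSemicontinuous_iSup fun ht => Continuous.lowerSemicontinuous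
      (continuous_enorm.comp (continuous_convPropagator ha ha1 hγ1 ht hp hf)))

lemma exists_maximal_le_hlMaximal {a γ : ℝ} (ha : 0 < a) (ha1 : a ≤ 1) (hγ1 : γ ≤ 1) :
    ∃ A : ℝ≥0, ∀ f : ℝ → ℂ, AEStronglyMeasurable f volume → ∀ x,
      maximal (convPropagator a γ f) x ≤ A * hlMaximal (fun y => ‖f y‖ₑ) x := by
  obtain ⟨C, hC, h⟩ := exists_norm_kernel_le ha ha1 hγ1
  obtain ⟨A, hA⟩ := exists_lintegral_conv_le_hlMaximal ha hC
  refine ⟨A, fun f hf x => iSup₂_le fun t ht => ?_⟩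
  refine (enorm_integral_le_lintegral_enorm _).trans ?_
  simp only [enorm_mul]
  exact hA _ _ (Real.rpow_pos_of_pos ht.1 _) (h t ht) _ x hf.enorm

lemma exists_eLpNorm_maximal_convPropagator_le {a γ : ℝ} (ha : 0 < a) (ha1 : a ≤ 1)
    (hγ1 : γ ≤ 1) {p : ℝ≥0∞} (hp : 1 < p) : ∃ C : ℝ≥0, ∀ f : ℝ → ℂ, MemLp f p volume →
      eLpNorm (maximal (convPropagator a γ f)) p volume ≤ C * eLpNorm f p volume := by
  obtain ⟨A, hA⟩ := exists_maximal_le_hlMaximal ha ha1 hγ1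
  rcases eq_or_ne p ∞ with rfl | hpt
  · refine ⟨A, fun f hf => ?_⟩
    rw [eLpNorm_exponent_top, eLpNorm_exponent_top]
    refine eLpNormEssSup_le_of_ae_enorm_bound (ae_of_all _ fun x => ?_)
    rw [enorm_eq_self]
    refine (hA f hf.1 x).trans ?_
    gcongr
    exact hlMaximal_le_of_ae_le ae_le_eLpNormEssSup x
  · have hp0 : p ≠ 0 := (zero_lt_one.trans hp).ne'
    have hp1 : 1 < p.toReal := by
      have := (ENNReal.toReal_lt_toReal ENNReal.one_ne_top hpt).2 hp
      simpa using this
    set q := p.toReal with hq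
    set B : ℝ≥0∞ := ENNReal.ofReal (q * (8 * (2 ^ (q - 1) / (q - 1)))) with hB
    -- Adding `1` makes the constant invertible, so that the rescaled maximal function lies
    -- pointwise below the Hardy–Littlewood one.
    set A' : ℝ≥0 := A + 1 with hA'
    have hA0 : (A' : ℝ≥0∞) ≠ 0 := by simp [hA']
    have hBfin : B ^ (1 / q) ≠ ∞ :=
      ENNReal.rpow_ne_top_of_nonneg (by positivity) ENNReal.ofReal_ne_top
    refine ⟨A' * (B ^ (1 / q)).toNNReal, fun f hf => ?_⟩
    set ψ : ℝ → ℝ≥0 := fun y => ‖hf.1.mk f y‖₊ with hψ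
    have hψm : Measurable ψ := hf.1.stronglyMeasurable_mk.measurable.nnnorm
    have hψf : (fun y => ‖f y‖ₑ) =ᵐ[volume] fun y => (ψ y : ℝ≥0∞) := by
      filter_upwards [hf.1.ae_eq_mk] with y hy
      rw [hψ, hy]; rfl
    set G : ℝ → ℝ≥0∞ := fun x => (A' : ℝ≥0∞)⁻¹ * maximal (convPropagator a γ f) x with hG
    have hGm : Measurable G :=
      (measurable_maximal_convPropagator ha ha1 hγ1 hp.le hf).const_mul _
    have hGle : ∀ x, G x ≤ hlMaximal (fun y => (ψ y : ℝ≥0∞)) x := by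
      intro x
      have h1 : maximal (convPropagator a γ f) x ≤ A' * hlMaximal (fun y => (ψ y : ℝ≥0∞)) x := by
        refine (hA f hf.1 x).trans ?_
        gcongr
        · exact le_self_add
        · exact hlMaximal_mono hψf.le x
      simp only [hG]
      rw [mul_comm, ← div_eq_mul_inv]
      exact ENNReal.div_le_of_le_mul (by rwa [mul_comm])
    have hmain := lintegral_rpow_le_of_le_hlMaximal hp1 hψm hGm hGle
    have eG : maximal (convPropagator a γ f) = fun x => (A' : ℝ≥0∞) * G x := by
      funext x
      rw [hG, ← mul_assoc, ENNReal.mul_inv_cancel hA0 ENNReal.coe_ne_top, one_mul]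
    have hψi : ∫⁻ y, (ψ y : ℝ≥0∞) ^ q = ∫⁻ y, ‖f y‖ₑ ^ q :=
      lintegral_congr_ae (by filter_upwards [hψf] with y hy; rw [← hy])
    have hq0 : 0 < q := by linarith
    rw [eLpNorm_eq_lintegral_rpow_enorm_toReal hp0 hpt,
      eLpNorm_eq_lintegral_rpow_enorm_toReal hp0 hpt, ← hq, eG]
    simp only [enorm_eq_self, ENNReal.mul_rpow_of_nonneg _ _ hq0.le]
    rw [lintegral_const_mul _ (hGm.pow_const q), ENNReal.mul_rpow_of_nonneg _ _ (by positivity),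
      ← ENNReal.rpow_mul, mul_one_div_cancel hq0.ne', ENNReal.rpow_one, ENNReal.coe_mul,
      ENNReal.coe_toNNReal hBfin, mul_assoc, ← ENNReal.mul_rpow_of_nonneg _ _ (by positivity)]
    rw [hψi] at hmain
    gcongr

lemma exists_volume_maximal_gt_le {a γ : ℝ} (ha : 0 < a) (ha1 : a ≤ 1) (hγ1 : γ ≤ 1) :
    ∃ C : ℝ≥0, ∀ f : ℝ → ℂ, MemLp f 1 volume → ∀ l : ℝ, 0 < l →
      volume {x : ℝ | ENNReal.ofReal l < maximal (convPropagator a γ f) x} ≤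
        C * eLpNorm f 1 volume / ENNReal.ofReal l := by
  obtain ⟨A, hA⟩ := exists_maximal_le_hlMaximal ha ha1 hγ1
  refine ⟨(A + 1) * 4, fun f hf l hl => ?_⟩
  have hl0 : ENNReal.ofReal l ≠ 0 := by simpa using hl
  have hA0 : ((A + 1 : ℝ≥0) : ℝ≥0∞) ≠ 0 := by simp
  set m : ℝ≥0∞ := ENNReal.ofReal l / ((A + 1 : ℝ≥0) : ℝ≥0∞) with hm
  have hm0 : m ≠ 0 := ENNReal.div_ne_zero.2 ⟨hl0, ENNReal.coe_ne_top⟩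
  have hsub : {x : ℝ | ENNReal.ofReal l < maximal (convPropagator a γ f) x} ⊆
      {x | m < hlMaximal (fun y => ‖f y‖ₑ) x} := by
    intro x hx
    have h1 : ENNReal.ofReal l < ((A + 1 : ℝ≥0) : ℝ≥0∞) * hlMaximal (fun y => ‖f y‖ₑ) x := by
      refine lt_of_lt_of_le hx ((hA f hf.1 x).trans ?_)
      gcongr
      exact le_self_add
    exact ENNReal.div_lt_of_lt_mul' h1
  have hw := mul_volume_hlMaximal_gt_le (fun y => ‖f y‖ₑ) hm0
  rw [ENNReal.le_div_iff_mul_le (Or.inl hl0) (Or.inl ENNReal.ofReal_ne_top),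
    eLpNorm_one_eq_lintegral_enorm, mul_comm]
  have e : ENNReal.ofReal l = ((A + 1 : ℝ≥0) : ℝ≥0∞) * m :=
    (ENNReal.mul_div_cancel hA0 ENNReal.coe_ne_top).symm
  calc _ ≤ ((A + 1 : ℝ≥0) : ℝ≥0∞) * m * volume {x | m < hlMaximal (fun y => ‖f y‖ₑ) x} := by
        rw [← e]
        exact mul_le_mul_right (measure_mono hsub) _
    _ = ((A + 1 : ℝ≥0) : ℝ≥0∞) * (m * volume {x | m < hlMaximal (fun y => ‖f y‖ₑ) x}) :=
        mul_assoc _ _ _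
    _ ≤ ((A + 1 : ℝ≥0) : ℝ≥0∞) * (4 * ∫⁻ y, ‖f y‖ₑ) := by gcongr
    _ = _ := by rw [ENNReal.coe_mul, mul_assoc]; rfl

/-! ### Sobolev estimates in the two ranges of `γ`. -/

/-- The `L²` norm is controlled by every Sobolev norm of nonnegative order. -/
lemma exists_eLpNorm_two_le_sobolevNorm {s : ℝ} (hs : 0 ≤ s) :
    ∃ C : ℝ≥0, ∀ f : Lp ℂ 2 (volume : Measure ℝ), eLpNorm f 2 volume ≤ C * sobolevNorm s f := by
  have h2π : (0 : ℝ) < 2 * Real.pi := by positivity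
  set D : ℝ≥0∞ := ENNReal.ofReal (2 * Real.pi) with hD
  have hDt : D ≠ ∞ := ENNReal.ofReal_ne_top
  refine ⟨(D ^ (1 / 2 : ℝ)).toNNReal, fun f => ?_⟩
  rw [ENNReal.coe_toNNReal (ENNReal.rpow_ne_top_of_nonneg (by norm_num) hDt)]
  set g : ℝ → ℂ := ((𝓕 f : Lp ℂ 2 (volume : Measure ℝ)) : ℝ → ℂ) with hg
  have h1 : eLpNorm f 2 volume = eLpNorm g 2 volume := by
    have := Lp.norm_fourier_eq f
    rw [Lp.norm_def, Lp.norm_def, ENNReal.toReal_eq_toReal_iff' (Lp.eLpNorm_ne_top _)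
      (Lp.eLpNorm_ne_top _)] at this
    exact this.symm
  have h2 : eLpNorm g 2 volume = (∫⁻ ξ, ‖g ξ‖ₑ ^ 2) ^ (1 / 2 : ℝ) := by
    rw [eLpNorm_eq_lintegral_rpow_enorm_toReal (by norm_num) (by norm_num)]
    simp
  have hgm : Measurable g := (Lp.stronglyMeasurable _).measurable
  have h3 : ∫⁻ ξ, ‖g (ξ / (2 * Real.pi))‖ₑ ^ 2 = D * ∫⁻ ξ, ‖g ξ‖ₑ ^ 2 := by
    have hmp := Real.map_volume_mul_right (inv_ne_zero h2π.ne')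
    have e : ∫⁻ ξ, ‖g ξ‖ₑ ^ 2 ∂(Measure.map (· * (2 * Real.pi)⁻¹) volume) =
        ∫⁻ ξ, ‖g (ξ * (2 * Real.pi)⁻¹)‖ₑ ^ 2 :=
      lintegral_map (hgm.enorm.pow_const 2) (measurable_mul_const _)
    rw [hmp, lintegral_smul_measure, inv_inv, abs_of_pos h2π, smul_eq_mul] at e
    simp only [div_eq_mul_inv]
    exact e.symm
  have h4 : ∫⁻ ξ, ‖fhat f ξ‖ₑ ^ 2 = D⁻¹ * ∫⁻ ξ, ‖g ξ‖ₑ ^ 2 := by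
    have e : ∀ ξ, ‖fhat f ξ‖ₑ ^ 2 = (D⁻¹) ^ 2 * ‖g (ξ / (2 * Real.pi))‖ₑ ^ 2 := by
      intro ξ
      rw [fhat, enorm_mul, mul_pow, ← Complex.ofReal_inv, ← ofReal_norm, Complex.norm_real,
        Real.norm_of_nonneg (by positivity), ENNReal.ofReal_inv_of_pos h2π]
    simp only [e]
    rw [lintegral_const_mul' _ _ (by finiteness), h3, ← mul_assoc, sq, mul_assoc D⁻¹,
      ENNReal.inv_mul_cancel (by simpa [hD] using Real.pi_pos) hDt, mul_one]
  have h5 : ∫⁻ ξ, ‖g ξ‖ₑ ^ 2 = D * ∫⁻ ξ, ‖fhat f ξ‖ₑ ^ 2 := by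
    rw [h4, ← mul_assoc, ENNReal.mul_inv_cancel (by simpa [hD] using Real.pi_pos) hDt, one_mul]
  rw [h1, h2, h5, ENNReal.mul_rpow_of_nonneg _ _ (by norm_num), sobolevNorm]
  gcongr with ξ
  refine le_mul_of_one_le_left zero_le ?_
  rw [ENNReal.one_le_ofReal]
  exact Real.one_le_rpow (by nlinarith [sq_nonneg ξ]) hs

/-- For `γ ≤ 1` no smoothness is needed: the `L²` bound for the convolution form suffices, since
both forms of the operator agree on `L²`. -/
lemma exists_eLpNorm_maximal_le_of_le_one {a γ s : ℝ} (ha : 0 < a) (ha1 : a ≤ 1)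
    (hγ1 : γ ≤ 1) (hs : 0 ≤ s) : ∃ C : ℝ≥0, ∀ f : Lp ℂ 2 (volume : Measure ℝ),
      eLpNorm (maximal (propagator a γ f)) 2 volume ≤ C * sobolevNorm s f := by
  obtain ⟨C, hC⟩ := exists_eLpNorm_maximal_convPropagator_le ha ha1 hγ1 (p := 2) (by norm_num)
  obtain ⟨D, hD⟩ := exists_eLpNorm_two_le_sobolevNorm hs
  refine ⟨C * D, fun f => ?_⟩
  have e : maximal (propagator a γ f) = maximal (convPropagator a γ f) := by
    funext x
    exact iSup_congr fun t => iSup_congr fun ht => by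
      rw [convPropagator_eq_propagator ha ht.1]
  rw [e, ENNReal.coe_mul, mul_assoc]
  exact (hC f (Lp.memLp f)).trans (by gcongr; exact hD f)

lemma exists_eLpNorm_maximal_le_of_one_lt {a γ s : ℝ} (ha : 0 < a) (hγ : 1 < γ)
    (h : (a < 1 ∧ a / 4 * (1 - 1 / γ) < s) ∨ (a = 1 ∧ 1 / 2 * (1 - 1 / γ) < s)) :
    ∃ C : ℝ≥0, ∀ f : Lp ℂ 2 (volume : Measure ℝ),
      eLpNorm (maximal (propagator a γ f)) 2 volume ≤ C * sobolevNorm s f := by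
  have hγ0 : 0 < γ := by linarith
  have hd0 : 0 < 1 - 1 / γ := by
    rw [sub_pos, div_lt_one hγ0]; exact hγ
  have hd1 : 1 - 1 / γ < 1 := by
    have : 0 < 1 / γ := by positivity
    linarith
  -- The majorant needs `σ = 2s'` below `1/2` (or below `1` when `a = 1`). Since the threshold for
  -- `s` lies strictly below this cap, a large `s` can be lowered to such an `s'` by monotonicity of
  -- the Sobolev norms.
  obtain ⟨s', hs', hs0, h'⟩ : ∃ s' ≤ s, 0 < s' ∧
      ((a < 1 ∧ 2 * s' < 1 / 2 ∧ a / 2 * (1 - 1 / γ) < 2 * s') ∨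
        (a = 1 ∧ 2 * s' < 1 ∧ 1 - 1 / γ < 2 * s')) := by
    rcases h with ⟨h1, h2⟩ | ⟨h1, h2⟩
    · have hlt : a / 4 * (1 - 1 / γ) < 1 / 4 := by nlinarith
      obtain ⟨s', hl, hu⟩ := exists_between (lt_min h2 hlt)
      have := lt_min_iff.1 hu
      have h0 : 0 < a / 4 * (1 - 1 / γ) := by positivity
      exact ⟨s', this.1.le, h0.trans hl, Or.inl ⟨h1, by linarith [this.2], by linarith⟩⟩
    · have hlt : 1 / 2 * (1 - 1 / γ) < 1 / 2 := by linarith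
      obtain ⟨s', hl, hu⟩ := exists_between (lt_min h2 hlt)
      have := lt_min_iff.1 hu
      exact ⟨s', this.1.le, by linarith, Or.inr ⟨h1, by linarith [this.2], by linarith⟩⟩
  have ha1 : a ≤ 1 := by
    rcases h with h | h
    · exact h.1.le
    · exact h.1.le
  obtain ⟨Φ, hΦm, hΦi, hΦn, hΦ⟩ :=
    exists_integrable_majorant (σ := 2 * s') ha ha1 hγ0 (by positivity) h'
  obtain ⟨C, hC⟩ := exists_eLpNorm_maximal_le ha hγ0 hs0.le hΦm hΦi hΦn hΦ
  exact ⟨C, fun f => (hC f).trans (by gcongr; exact sobolevNorm_mono hs' f)⟩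

end FracSchrodinger

theorem theorem1p1 (a γ : ℝ) (ha : 0 < a) (ha1 : a ≤ 1) (hγ : 0 < γ) :
    -- (i) local estimate
    (a < 1 → ∀ s : ℝ, a / 4 * max 0 (1 - 1 / γ) < s → ∃ C : ℝ≥0,
      ∀ f : Lp ℂ 2 (volume : Measure ℝ), FracSchrodinger.MemSobolev s f →
        eLpNorm (FracSchrodinger.maximal (FracSchrodinger.propagator a γ f)) 2
          (volume.restrict (Metric.ball (0 : ℝ) 1)) ≤ C * FracSchrodinger.sobolevNorm s f) ∧
    (a = 1 → ∀ s : ℝ, 1 / 2 * max 0 (1 - 1 / γ) < s → ∃ C : ℝ≥0,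
      ∀ f : Lp ℂ 2 (volume : Measure ℝ), FracSchrodinger.MemSobolev s f →
        eLpNorm (FracSchrodinger.maximal (FracSchrodinger.propagator a γ f)) 2
          (volume.restrict (Metric.ball (0 : ℝ) 1)) ≤ C * FracSchrodinger.sobolevNorm s f) ∧
    -- (ii) global estimate
    (a < 1 → 1 < γ → ∀ s : ℝ, a / 4 * (1 - 1 / γ) < s → ∃ C : ℝ≥0,
      ∀ f : Lp ℂ 2 (volume : Measure ℝ), FracSchrodinger.MemSobolev s f →
        eLpNorm (FracSchrodinger.maximal (FracSchrodinger.propagator a γ f)) 2 volume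
          ≤ C * FracSchrodinger.sobolevNorm s f) ∧
    (a = 1 → 1 < γ → ∀ s : ℝ, 1 / 2 * (1 - 1 / γ) < s → ∃ C : ℝ≥0,
      ∀ f : Lp ℂ 2 (volume : Measure ℝ), FracSchrodinger.MemSobolev s f →
        eLpNorm (FracSchrodinger.maximal (FracSchrodinger.propagator a γ f)) 2 volume
          ≤ C * FracSchrodinger.sobolevNorm s f) ∧
    -- (iii) for `γ ≤ 1`: the operators are well defined on every `L^p`, `1 ≤ p ≤ ∞`,
    -- strong type `(p, p)` for `1 < p ≤ ∞`, weak type `(1, 1)`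
    (γ ≤ 1 →
      (∀ p : ℝ≥0∞, 1 ≤ p → ∀ f : ℝ → ℂ, MemLp f p volume →
        (∀ t ∈ Ioo (0 : ℝ) 1, ∀ x : ℝ,
          Integrable (fun y : ℝ => FracSchrodinger.kernel a γ t (x - y) * f y)) ∧
        Measurable (FracSchrodinger.maximal (FracSchrodinger.convPropagator a γ f))) ∧
      (∀ p : ℝ≥0∞, 1 < p → ∃ C : ℝ≥0, ∀ f : ℝ → ℂ, MemLp f p volume →
        eLpNorm (FracSchrodinger.maximal (FracSchrodinger.convPropagator a γ f)) p volume
          ≤ C * eLpNorm f p volume) ∧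
      (∃ C : ℝ≥0, ∀ f : ℝ → ℂ, MemLp f 1 volume → ∀ l : ℝ, 0 < l →
        volume {x : ℝ | ENNReal.ofReal l <
            FracSchrodinger.maximal (FracSchrodinger.convPropagator a γ f) x}
          ≤ C * eLpNorm f 1 volume / ENNReal.ofReal l)) := by
  have restrict_le : ∀ u : ℝ → ℝ≥0∞, eLpNorm u 2 (volume.restrict (Metric.ball (0 : ℝ) 1)) ≤
      eLpNorm u 2 volume := fun u => eLpNorm_mono_measure u Measure.restrict_le_self
  have max_eq : 1 < γ → max 0 (1 - 1 / γ) = 1 - 1 / γ := fun h => by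
    refine max_eq_right ?_
    rw [sub_nonneg, div_le_one hγ]
    exact h.le
  -- The coefficient `c` stands for `a/4` or `1/2`, so both cases of the local estimate share one
  -- argument. For `γ ≤ 1` the hypothesis only serves to give `s ≥ 0`.
  have local_estimate : ∀ s c : ℝ, 0 ≤ c → c * max 0 (1 - 1 / γ) < s →
      (1 < γ → c * (1 - 1 / γ) < s →
        (a < 1 ∧ a / 4 * (1 - 1 / γ) < s) ∨ (a = 1 ∧ 1 / 2 * (1 - 1 / γ) < s)) →
      ∃ C : ℝ≥0, ∀ f : Lp ℂ 2 (volume : Measure ℝ),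
        eLpNorm (FracSchrodinger.maximal (FracSchrodinger.propagator a γ f)) 2
          (volume.restrict (Metric.ball (0 : ℝ) 1)) ≤ C * FracSchrodinger.sobolevNorm s f := by
    intro s c hc hs h
    rcases le_or_gt γ 1 with hγ1 | hγ1
    · have hs0 : 0 ≤ s := (mul_nonneg hc (le_max_left _ _)).trans hs.le
      obtain ⟨C, hC⟩ := FracSchrodinger.exists_eLpNorm_maximal_le_of_le_one ha ha1 hγ1 hs0
      exact ⟨C, fun f => (restrict_le _).trans (hC f)⟩
    · rw [max_eq hγ1] at hs
      obtain ⟨C, hC⟩ := FracSchrodinger.exists_eLpNorm_maximal_le_of_one_lt ha hγ1 (h hγ1 hs)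
      exact ⟨C, fun f => (restrict_le _).trans (hC f)⟩
  refine ⟨fun h s hs => ?_, fun h s hs => ?_, fun h hγ1 s hs => ?_, fun h hγ1 s hs => ?_,
    fun hγ1 => ⟨fun p hp f hf => ⟨fun t ht x => ?_, ?_⟩, fun p hp => ?_, ?_⟩⟩
  · obtain ⟨C, hC⟩ := local_estimate s (a / 4) (by positivity) hs fun _ hs' => Or.inl ⟨h, hs'⟩
    exact ⟨C, fun f _ => hC f⟩
  · obtain ⟨C, hC⟩ := local_estimate s (1 / 2) (by norm_num) hs fun _ hs' => Or.inr ⟨h, hs'⟩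
    exact ⟨C, fun f _ => hC f⟩
  · obtain ⟨C, hC⟩ := FracSchrodinger.exists_eLpNorm_maximal_le_of_one_lt ha hγ1
      (Or.inl ⟨h, hs⟩)
    exact ⟨C, fun f _ => hC f⟩
  · obtain ⟨C, hC⟩ := FracSchrodinger.exists_eLpNorm_maximal_le_of_one_lt ha hγ1
      (Or.inr ⟨h, hs⟩)
    exact ⟨C, fun f _ => hC f⟩
  · exact FracSchrodinger.integrable_kernel_mul ha ha1 hγ1 ht hp hf x
  · exact FracSchrodinger.measurable_maximal_convPropagator ha ha1 hγ1 hp hf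
  · exact FracSchrodinger.exists_eLpNorm_maximal_convPropagator_le ha ha1 hγ1 hp
  · exact FracSchrodinger.exists_volume_maximal_gt_le ha ha1 hγ1
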